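/- For a graph $G$ and a positive integer $k$, a set $U\subseteq V(G)$ is a *$k$-dominating set* if every vertex not in $U$ has at least $k$ neighbors in $U$, and a *total $k$-dominating set* if every vertex of $G$ has at least $k$ neighbors in $U$. In the weighted $k$-domination (resp. weighted total $k$-domination) problem one is given a graph $G$ with a cost $c(u)\ge 0$ for each vertex $u\in V(G)$, and the task is to find a $k$-dominating (resp. total $k$-dominating) set $U$ of $G$ of minimum total cost $\sum_{u\in U}c(u)$, or to report that no such set exists. A *proper interval graph* is a graph that has an intersection model of closed intervals on the real line in which no interval contains another one. **Theorem.** For every positive integer $k$, the weighted $k$-domination problem and the weighted total $k$-domination problem are both solvable in time $\mathcal{O}(|V(G)|^{3k})$ in the class of proper interval graphs. Here $G$ is given by its vertex count and adjacency matrix (no interval model is given), costs are real numbers that an algorithm can only copy, add and compare, time is the number of steps of a random access machine with words of $\mathcal{O}(\log |V(G)|)$ bits, and the algorithm and the constant in $\mathcal{O}$ depend only on $k$. -/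

import Mathlib

/-! ### Graphs: proper interval graphs, `k`-domination, total `k`-domination -/

/-- `G` has a proper interval model: closed intervals `[l v, r v]` on the real line, none of them
contained in another one, such that distinct vertices are adjacent iff their intervals meet. -/
def IsProperIntervalGraph {V : Type*} (G : SimpleGraph V) : Prop :=
  ∃ l r : V → ℝ,
    (∀ v, l v ≤ r v) ∧
    (∀ u v, u ≠ v → ¬ Set.Icc (l u) (r u) ⊆ Set.Icc (l v) (r v)) ∧
    (∀ u v, G.Adj u v ↔ u ≠ v ∧ (Set.Icc (l u) (r u) ∩ Set.Icc (l v) (r v)).Nonempty)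

open Classical in
/-- Every vertex outside `U` has at least `k` neighbours in `U`. -/
def IsKDominating {V : Type*} (k : ℕ) (G : SimpleGraph V) (U : Finset V) : Prop :=
  ∀ v, v ∉ U → k ≤ (U.filter (fun u => G.Adj v u)).card

open Classical in
/-- Every vertex has at least `k` neighbours in `U`. -/
def IsTotalKDominating {V : Type*} (k : ℕ) (G : SimpleGraph V) (U : Finset V) : Prop :=
  ∀ v, k ≤ (U.filter (fun u => G.Adj v u)).card

/-- `U` satisfies `P` and has minimum total cost among all vertex sets satisfying `P`. -/
def IsMinCost {V : Type*} (P : Finset V → Prop) (c : V → ℝ) (U : Finset V) : Prop :=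
  P U ∧ ∀ U', P U' → ∑ u ∈ U, c u ≤ ∑ u ∈ U', c u

/-! ### A random access machine with a step count

Programs are written in structured form. A program has finitely many integer registers, integer
arrays and cost arrays, each named by a number that is fixed in the program text (only the position
inside an array is computed at run time). Costs are real numbers, which a program can only
copy, add and compare; integers are machine words, see `RAM.Exec`. -/

namespace RAM

/-- The contents of the integer registers, the integer arrays and the cost arrays. -/
structure State where
  reg : ℕ → ℕ
  arr : ℕ → ℕ → ℕ
  cost : ℕ → ℕ → ℝ

/-- Integer expressions; `get a e` reads position `e` of the integer array `a`. -/
inductive IExpr where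
  | lit (m : ℕ)
  | reg (i : ℕ)
  | get (a : ℕ) (e : IExpr)
  | add (e f : IExpr)
  | sub (e f : IExpr)
  | mul (e f : IExpr)

/-- Value of an integer expression (subtraction is truncated at `0`). -/
def IExpr.eval (s : State) : IExpr → ℕ
  | .lit m => m
  | .reg i => s.reg i
  | .get a e => s.arr a (e.eval s)
  | .add e f => e.eval s + f.eval s
  | .sub e f => e.eval s - f.eval s
  | .mul e f => e.eval s * f.eval s

/-- Number of elementary operations in an integer expression. -/
def IExpr.time : IExpr → ℕ
  | .lit _ => 1
  | .reg _ => 1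
  | .get _ e => e.time + 1
  | .add e f => e.time + f.time + 1
  | .sub e f => e.time + f.time + 1
  | .mul e f => e.time + f.time + 1

/-- Cost expressions; `get a e` reads position `e` of the cost array `a`. -/
inductive CExpr where
  | zero
  | get (a : ℕ) (e : IExpr)
  | add (e f : CExpr)

/-- Value of a cost expression. -/
def CExpr.eval (s : State) : CExpr → ℝ
  | .zero => 0
  | .get a e => s.cost a (e.eval s)
  | .add e f => e.eval s + f.eval s

/-- Number of elementary operations in a cost expression. -/
def CExpr.time : CExpr → ℕ
  | .zero => 1
  | .get _ e => e.time + 1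
  | .add e f => e.time + f.time + 1

/-- Tests: comparisons of integers and of costs, and their Boolean combinations. -/
inductive Test where
  | eq (e f : IExpr)
  | le (e f : IExpr)
  | costLe (e f : CExpr)
  | neg (b : Test)
  | conj (b d : Test)

/-- Truth of a test. -/
def Test.Holds (s : State) : Test → Prop
  | .eq e f => e.eval s = f.eval s
  | .le e f => e.eval s ≤ f.eval s
  | .costLe e f => e.eval s ≤ f.eval s
  | .neg b => ¬ b.Holds s
  | .conj b d => b.Holds s ∧ d.Holds s

/-- Number of elementary operations in a test. -/
def Test.time : Test → ℕ
  | .eq e f => e.time + f.time + 1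
  | .le e f => e.time + f.time + 1
  | .costLe e f => e.time + f.time + 1
  | .neg b => b.time + 1
  | .conj b d => b.time + d.time + 1

/-- Programs. -/
inductive Prog where
  | skip
  | setReg (i : ℕ) (e : IExpr)
  | setArr (a : ℕ) (p e : IExpr)
  | setCost (a : ℕ) (p : IExpr) (e : CExpr)
  | seq (P Q : Prog)
  | ite (b : Test) (P Q : Prog)
  | loop (b : Test) (P : Prog)

/-- Write `m` into the integer register `i`. -/
def State.setReg (s : State) (i m : ℕ) : State :=
  { s with reg := Function.update s.reg i m }

/-- Write `m` into position `p` of the integer array `a`. -/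
def State.setArr (s : State) (a p m : ℕ) : State :=
  { s with arr := Function.update s.arr a (Function.update (s.arr a) p m) }

/-- Write `x` into position `p` of the cost array `a`. -/
def State.setCost (s : State) (a p : ℕ) (x : ℝ) : State :=
  { s with cost := Function.update s.cost a (Function.update (s.cost a) p x) }

/-- `Exec W P s t s'`: started in state `s`, the program `P` halts in state `s'` after exactly `t`
steps, and all the integers that it writes and all the array positions that it writes to are
at most `W`. So `W` bounds the size of a machine word. `loop b P` repeats `P` as long as `b` holds,
and every evaluation of `b` is charged. -/
inductive Exec (W : ℕ) : Prog → State → ℕ → State → Prop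
  | skip (s : State) : Exec W .skip s 1 s
  | setReg (s : State) (i : ℕ) (e : IExpr) (he : e.eval s ≤ W) :
      Exec W (.setReg i e) s (e.time + 1) (s.setReg i (e.eval s))
  | setArr (s : State) (a : ℕ) (p e : IExpr) (hp : p.eval s ≤ W) (he : e.eval s ≤ W) :
      Exec W (.setArr a p e) s (p.time + e.time + 1) (s.setArr a (p.eval s) (e.eval s))
  | setCost (s : State) (a : ℕ) (p : IExpr) (e : CExpr) (hp : p.eval s ≤ W) :
      Exec W (.setCost a p e) s (p.time + e.time + 1) (s.setCost a (p.eval s) (e.eval s))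
  | seq {P Q : Prog} {s s₁ s₂ : State} {t₁ t₂ : ℕ}
      (hP : Exec W P s t₁ s₁) (hQ : Exec W Q s₁ t₂ s₂) :
      Exec W (.seq P Q) s (t₁ + t₂) s₂
  | iteTrue {b : Test} {P Q : Prog} {s s₁ : State} {t : ℕ}
      (hb : b.Holds s) (hP : Exec W P s t s₁) :
      Exec W (.ite b P Q) s (b.time + 1 + t) s₁
  | iteFalse {b : Test} {P Q : Prog} {s s₁ : State} {t : ℕ}
      (hb : ¬ b.Holds s) (hQ : Exec W Q s t s₁) :
      Exec W (.ite b P Q) s (b.time + 1 + t) s₁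
  | loopTrue {b : Test} {P : Prog} {s s₁ s₂ : State} {t₁ t₂ : ℕ}
      (hb : b.Holds s) (hP : Exec W P s t₁ s₁) (hL : Exec W (.loop b P) s₁ t₂ s₂) :
      Exec W (.loop b P) s (b.time + 1 + t₁ + t₂) s₂
  | loopFalse {b : Test} {P : Prog} {s : State} (hb : ¬ b.Holds s) :
      Exec W (.loop b P) s (b.time + 1) s

/-! ### Input, output, and solvability in a given time -/

open Classical in
/-- The input: `n` is in register `0`, the adjacency matrix of `G` (row by row) in integer array
`0`, and the vertex costs in cost array `0`. Everything else is `0`. -/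
noncomputable def input {n : ℕ} (G : SimpleGraph (Fin n)) (c : Fin n → ℝ) : State where
  reg i := if i = 0 then n else 0
  arr a p := if a = 0 ∧ ∃ u v : Fin n, G.Adj u v ∧ p = u.val * n + v.val then 1 else 0
  cost a p := if h : a = 0 ∧ p < n then c ⟨p, h.2⟩ else 0

/-- The vertex set whose indicator vector is stored in integer array `1`. -/
def outputSet (n : ℕ) (s : State) : Finset (Fin n) :=
  Finset.univ.filter (fun v => s.arr 1 v.val = 1)

/-- In the final state `s`, either register `0` holds `1` and the output set is a set of minimum
total cost among those satisfying `P`, or register `0` holds `0` and no set satisfies `P`. -/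
def Answers {n : ℕ} (P : Finset (Fin n) → Prop) (c : Fin n → ℝ) (s : State) : Prop :=
  (s.reg 0 = 1 ∧ IsMinCost P c (outputSet n s)) ∨ (s.reg 0 = 0 ∧ ∀ U, ¬ P U)

end RAM

/-- The problem of finding, in a graph `G` of the given class with non-negative vertex costs, a set
of minimum total cost among the vertex sets `U` with `Feasible G U` (or of finding out that there
are none) is solvable in time `O(T(n))`, where `n` is the number of vertices: one program does so on
all such inputs, with `n ≥ 1`, within `C * T n` steps and on words of `O(log n)` bits (that is,
on integers bounded by a polynomial in `n`). -/
def WeightedProblemSolvableInTime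
    (InClass : ∀ {n : ℕ}, SimpleGraph (Fin n) → Prop)
    (Feasible : ∀ {n : ℕ}, SimpleGraph (Fin n) → Finset (Fin n) → Prop)
    (T : ℕ → ℕ) : Prop :=
  ∃ (P : RAM.Prog) (C d : ℕ), ∀ (n : ℕ), 1 ≤ n →
    ∀ (G : SimpleGraph (Fin n)) (c : Fin n → ℝ), InClass G → (∀ v, 0 ≤ c v) →
      ∃ (t : ℕ) (s : RAM.State),
        RAM.Exec (C * n ^ d) P (RAM.input G c) t s ∧ t ≤ C * T n ∧
        RAM.Answers (Feasible G) c s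

/-! Order the vertices of a proper interval graph by left endpoint. As no interval contains another,
the right endpoints come in the same order, so this is an umbrella ordering: if x < y < z and xz is
an edge, then so are xy and yz. The neighbours of a vertex therefore form a stretch around it. If a
vertex has k neighbours in U, it already has k among its k nearest predecessors and k nearest
successors in U: if the farthest of these on one side is adjacent, so are all k on that side, and if
neither end is adjacent, no neighbour in U lies farther out (`IsListing.le_window`).

Hence feasibility is local. List U increasingly, preceded by 2k zeros and followed by 2k sentinels
above n. Feasibility becomes a condition on each window of 2k consecutive entries together with the
entry that follows it (`IsListing.isStep`, `IsListing.isFeasible`). Feasible sets thus correspond to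
paths in a digraph on windows (`IsPath.isFeasible`, `IsFeasible.exists_isPath`). With B = n + 2k +
1, a window is coded by a number below B^(2k), and every step increases the code. So the Bellman
equations (`IsTableAt`) can be solved by decreasing code, with B candidate successors per window, in
time O(n^(2k+1)).

The ordering has to be found from the adjacency matrix. Once the first vertex of a component is
right, a greedy rule continues correctly: take an outside vertex with the most neighbours among
those placed and, among these, of smallest degree. It differs from the vertex that a given umbrella
ordering puts next at most by a twin (`exists_isUmbrella_extend`). Each vertex is tried once as the
start of a component and the result is checked, in total time O(n^3) (`RAM.orderProg_spec`). As k ≥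
1, both 3 and 2k + 1 are at most 3k. -/

namespace RAM

/-! ### Step-counting rules for programs -/

/-- Sum of the times of all the tests and assignments in the program text. -/
def Prog.size : Prog → ℕ
  | .skip => 1
  | .setReg _ e => e.time + 1
  | .setArr _ p e => p.time + e.time + 1
  | .setCost _ p e => p.time + e.time + 1
  | .seq P Q => P.size + Q.size
  | .ite b P Q => b.time + 1 + (P.size + Q.size)
  | .loop b P => b.time + 1 + P.size

/-- Whether an assignment to register `i` occurs in the program text. -/
def Prog.writesReg : Prog → ℕ → Bool
  | .setReg j _, i => Nat.beq j i
  | .seq P Q, i => P.writesReg i || Q.writesReg i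
  | .ite _ P Q, i => P.writesReg i || Q.writesReg i
  | .loop _ P, i => P.writesReg i
  | _, _ => false

/-- Whether an assignment to integer array `i` occurs in the program text. -/
def Prog.writesArr : Prog → ℕ → Bool
  | .setArr j _ _, i => Nat.beq j i
  | .seq P Q, i => P.writesArr i || Q.writesArr i
  | .ite _ P Q, i => P.writesArr i || Q.writesArr i
  | .loop _ P, i => P.writesArr i
  | _, _ => false

/-- Whether an assignment to cost array `i` occurs in the program text. -/
def Prog.writesCost : Prog → ℕ → Bool
  | .setCost j _ _, i => Nat.beq j i
  | .seq P Q, i => P.writesCost i || Q.writesCost i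
  | .ite _ P Q, i => P.writesCost i || Q.writesCost i
  | .loop _ P, i => P.writesCost i
  | _, _ => false

/-- `s'` differs from `s` at most in what `P` assigns to. -/
structure Frame (P : Prog) (s s' : State) : Prop where
  reg : ∀ i, P.writesReg i = false → s'.reg i = s.reg i
  arr : ∀ i, P.writesArr i = false → s'.arr i = s.arr i
  cost : ∀ i, P.writesCost i = false → s'.cost i = s.cost i

theorem Frame.refl (P : Prog) (s : State) : Frame P s s :=
  ⟨fun _ _ => rfl, fun _ _ => rfl, fun _ _ => rfl⟩

theorem Frame.trans {P : Prog} {s s₁ s₂ : State} (h₁ : Frame P s s₁) (h₂ : Frame P s₁ s₂) :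
    Frame P s s₂ :=
  ⟨fun i h => (h₂.reg i h).trans (h₁.reg i h), fun i h => (h₂.arr i h).trans (h₁.arr i h),
    fun i h => (h₂.cost i h).trans (h₁.cost i h)⟩

theorem Frame.mono {P Q : Prog} {s s' : State} (h : Frame P s s')
    (hr : ∀ i, Q.writesReg i = false → P.writesReg i = false)
    (ha : ∀ i, Q.writesArr i = false → P.writesArr i = false)
    (hc : ∀ i, Q.writesCost i = false → P.writesCost i = false) : Frame Q s s' :=
  ⟨fun i hi => h.reg i (hr i hi), fun i hi => h.arr i (ha i hi),
    fun i hi => h.cost i (hc i hi)⟩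

theorem ne_of_beq_eq_false {i j : ℕ} (h : Nat.beq i j = false) : j ≠ i := by
  rintro rfl
  simp [Nat.beq_refl] at h

/-- The write predicates are Booleans computed from the program text, so for a concrete program each
fact "this register or array is unchanged" has the form `hF.reg i rfl`. -/
theorem Exec.frame {W : ℕ} {P : Prog} {s s' : State} {t : ℕ} (h : Exec W P s t s') :
    Frame P s s' := by
  induction h with
  | skip s => exact .refl _ _
  | setReg s i e he =>
    exact ⟨fun j h => Function.update_of_ne (ne_of_beq_eq_false h) _ _, fun _ _ => rfl,
      fun _ _ => rfl⟩
  | setArr s i p e hp he =>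
    exact ⟨fun _ _ => rfl, fun j h => Function.update_of_ne (ne_of_beq_eq_false h) _ _,
      fun _ _ => rfl⟩
  | setCost s i p e hp =>
    exact ⟨fun _ _ => rfl, fun _ _ => rfl,
      fun j h => Function.update_of_ne (ne_of_beq_eq_false h) _ _⟩
  | seq _ _ h₁ h₂ =>
    refine (h₁.mono ?_ ?_ ?_).trans (h₂.mono ?_ ?_ ?_) <;> intro i <;>
      simp +contextual [Prog.writesReg, Prog.writesArr, Prog.writesCost]
  | iteTrue _ _ h =>
    refine h.mono ?_ ?_ ?_ <;> intro i <;>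
      simp +contextual [Prog.writesReg, Prog.writesArr, Prog.writesCost]
  | iteFalse _ _ h =>
    refine h.mono ?_ ?_ ?_ <;> intro i <;>
      simp +contextual [Prog.writesReg, Prog.writesArr, Prog.writesCost]
  | loopTrue _ _ _ h₁ h₂ => exact Frame.trans (h₁.mono (fun _ => id) (fun _ => id) (fun _ => id)) h₂
  | loopFalse _ => exact .refl _ _

/-- `P` halts from `s` within `P.size * K` steps, in a state satisfying `Q`. -/
def Runs (W : ℕ) (P : Prog) (s : State) (K : ℕ) (Q : State → Prop) : Prop :=
  ∃ t s', Exec W P s t s' ∧ t ≤ P.size * K ∧ Q s'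

namespace Runs

variable {W K : ℕ} {P P' : Prog} {s : State} {Q R : State → Prop}

theorem mono {K' : ℕ} (h : Runs W P s K Q) (hK : K ≤ K') (hQ : ∀ s', Frame P s s' → Q s' → R s') :
    Runs W P s K' R := by
  obtain ⟨t, s', h, ht, hQ'⟩ := h
  exact ⟨t, s', h, ht.trans (Nat.mul_le_mul_left _ hK), hQ s' h.frame hQ'⟩

theorem skip (hK : 1 ≤ K) (h : Q s) : Runs W .skip s K Q :=
  ⟨_, _, .skip s, by simpa [Prog.size] using hK, h⟩

theorem setReg (hK : 1 ≤ K) {i : ℕ} {e : IExpr} (he : e.eval s ≤ W)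
    (h : Q (s.setReg i (e.eval s))) : Runs W (.setReg i e) s K Q :=
  ⟨_, _, .setReg s i e he, Nat.le_mul_of_pos_right _ hK, h⟩

theorem setArr (hK : 1 ≤ K) {a : ℕ} {p e : IExpr} (hp : p.eval s ≤ W) (he : e.eval s ≤ W)
    (h : Q (s.setArr a (p.eval s) (e.eval s))) : Runs W (.setArr a p e) s K Q :=
  ⟨_, _, .setArr s a p e hp he, Nat.le_mul_of_pos_right _ hK, h⟩

theorem setCost (hK : 1 ≤ K) {a : ℕ} {p : IExpr} {e : CExpr} (hp : p.eval s ≤ W)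
    (h : Q (s.setCost a (p.eval s) (e.eval s))) : Runs W (.setCost a p e) s K Q :=
  ⟨_, _, .setCost s a p e hp, Nat.le_mul_of_pos_right _ hK, h⟩

/-- Time is measured in multiples of the text size: `K` plays the role of a bound on how often each
instruction is executed. Sizes add under sequencing, so the same `K` serves both parts and constants
never have to be tracked. -/
theorem seq (h : Runs W P s K (fun s' => Runs W P' s' K Q)) : Runs W (.seq P P') s K Q := by
  obtain ⟨t, s', h, ht, t', s'', h', ht', hQ⟩ := h
  exact ⟨_, _, .seq h h', by rw [Prog.size, add_mul]; exact add_le_add ht ht', hQ⟩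

theorem ite (hK : 1 ≤ K) {b : Test} (h : b.Holds s → Runs W P s K Q)
    (h' : ¬ b.Holds s → Runs W P' s K Q) : Runs W (.ite b P P') s K Q := by
  have h1 : b.time + 1 ≤ (b.time + 1) * K := Nat.le_mul_of_pos_right _ hK
  by_cases hb : b.Holds s
  · obtain ⟨t, s', h, ht, hQ⟩ := h hb
    refine ⟨_, _, .iteTrue hb h, ?_, hQ⟩
    rw [Prog.size, add_mul, add_mul P.size]
    omega
  · obtain ⟨t, s', h, ht, hQ⟩ := h' hb
    refine ⟨_, _, .iteFalse hb h, ?_, hQ⟩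
    rw [Prog.size, add_mul, add_mul P.size]
    omega

end Runs

/-- `for i in [0, reg b) do P`. -/
def Prog.for (i b : ℕ) (P : Prog) : Prog :=
  .seq (.setReg i (.lit 0))
    (.loop (.neg (.le (.reg b) (.reg i))) (.seq P (.setReg i (.add (.reg i) (.lit 1)))))

/-- The loop rule with invariant `I`. The factor is `m + 1` because the initialisation and the last,
failing test are paid for even if `m = 0`. The invariant is required after the counter has been
increased. -/
theorem Runs.for {W K m i b : ℕ} {P : Prog} {s : State} (I : ℕ → State → Prop)
    (hK : 1 ≤ K) (hm : s.reg b = m) (hmW : m ≤ W) (hi : P.writesReg i = false)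
    (hb : (Prog.for i b P).writesReg b = false) (h0 : I 0 (s.setReg i 0))
    (hstep : ∀ j s', j < m → s'.reg i = j → Frame (.for i b P) s s' → I j s' →
      Runs W P s' K (fun s'' => I (j + 1) (s''.setReg i (j + 1)))) :
    Runs W (.for i b P) s ((m + 1) * K) (I m) := by
  -- `d` is the number of remaining rounds. A test costs 5 and an increment 4; the final failing
  -- test accounts for the separate term `5 * K`.
  have key : ∀ d j s', j + d = m → s'.reg i = j → Frame (.for i b P) s s' → I j s' →
      ∃ t s'', Exec W (.loop (.neg (.le (.reg b) (.reg i)))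
        (.seq P (.setReg i (.add (.reg i) (.lit 1))))) s' t s'' ∧
        t ≤ 5 * K + d * ((9 + P.size) * K) ∧ I m s'' := by
    intro d
    induction d with
    | zero =>
      intro j s' hj hij hF hI
      have hbm := hF.reg b hb
      refine ⟨_, _, .loopFalse ?_, ?_, ?_⟩
      · simp [Test.Holds, IExpr.eval]; omega
      · simp [Test.time, IExpr.time]; omega
      · simpa [← hj] using hI
    | succ d ih =>
      intro j s' hj hij hF hI
      have hbm := hF.reg b hb
      obtain ⟨t₁, s₁, hP, ht₁, hI₁⟩ := hstep j s' (by omega) hij hF hI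
      have hi₁ : s₁.reg i = j := (hP.frame.reg i hi).trans hij
      have hinc : (IExpr.add (.reg i) (.lit 1)).eval s₁ = j + 1 := by simp [IExpr.eval, hi₁]
      have hbody := Exec.seq hP (.setReg s₁ i (.add (.reg i) (.lit 1)) (by rw [hinc]; omega))
      rw [hinc] at hbody
      obtain ⟨t₂, s₂, hL, ht₂, hI₂⟩ := ih (j + 1) (s₁.setReg i (j + 1)) (by omega)
        (by simp [State.setReg])
        (hF.trans (hbody.frame.mono
          (fun i' h => by
            simp only [Prog.for, Prog.writesReg, Bool.or_eq_false_iff] at h ⊢; exact h.2)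
          (fun i' h => by
            simp only [Prog.for, Prog.writesArr, Bool.or_eq_false_iff] at h ⊢; exact h.2)
          (fun i' h => by
            simp only [Prog.for, Prog.writesCost, Bool.or_eq_false_iff] at h ⊢; exact h.2))) hI₁
      refine ⟨_, _, .loopTrue ?_ hbody hL, ?_, hI₂⟩
      · simp [Test.Holds, IExpr.eval]; omega
      · simp only [Test.time, IExpr.time]
        have h9 : (9 + P.size) * K = 9 * K + P.size * K := add_mul _ _ _
        rw [add_mul, one_mul, h9]
        rw [h9] at ht₂
        omega
  have h0' : Exec W (.setReg i (.lit 0)) s 2 (s.setReg i 0) :=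
    .setReg s i (.lit 0) (Nat.zero_le _)
  obtain ⟨t, s', h, ht, hI⟩ := key m 0 (s.setReg i 0) (by omega) (by simp [State.setReg])
    (h0'.frame.mono (fun i' h => by
            simp only [Prog.for, Prog.writesReg, Bool.or_eq_false_iff] at h ⊢; exact h.1)
          (fun i' h => by
            simp only [Prog.for, Prog.writesArr, Bool.or_eq_false_iff] at h ⊢)
          (fun i' h => by
            simp only [Prog.for, Prog.writesCost, Bool.or_eq_false_iff] at h ⊢)) h0
  refine ⟨_, _, .seq h0' h, ?_, hI⟩
  have hsz : (Prog.for i b P).size = 11 + P.size := by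
    simp [Prog.for, Prog.size, Test.time, IExpr.time]; omega
  rw [hsz]
  calc 2 + t ≤ 2 * K + (5 * K + m * ((9 + P.size) * K)) := by omega
    _ ≤ (11 + P.size) * ((m + 1) * K) := by nlinarith [Nat.zero_le (m * K), Nat.zero_le (P.size * K)]

theorem Runs.for_of {W K K' m i b : ℕ} {P : Prog} {s : State} {Q : State → Prop}
    (I : ℕ → State → Prop) (hK : 1 ≤ K) (hK' : (m + 1) * K ≤ K') (hm : s.reg b = m) (hmW : m ≤ W)
    (hi : P.writesReg i = false) (hb : (Prog.for i b P).writesReg b = false)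
    (h0 : I 0 (s.setReg i 0))
    (hstep : ∀ j s', j < m → s'.reg i = j → Frame (.for i b P) s s' → I j s' →
      Runs W P s' K (fun s'' => I (j + 1) (s''.setReg i (j + 1))))
    (hQ : ∀ s', Frame (.for i b P) s s' → I m s' → Q s') :
    Runs W (.for i b P) s K' Q :=
  (Runs.for I hK hm hmW hi hb h0 hstep).mono hK' hQ

end RAM

/-! ### Umbrella orderings and their greedy construction -/

/-- `a` is the (zero-padded) adjacency matrix of a graph on `{0, …, n - 1}`. -/
structure IsAdjMatrix (n : ℕ) (a : ℕ → ℕ → ℕ) : Prop where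
  le_one : ∀ u v, a u v ≤ 1
  symm : ∀ u v, a u v = a v u
  self : ∀ u, a u u = 0
  lt : ∀ u v, a u v = 1 → u < n

/-- `κ` ranks the vertices so that the closed neighbourhoods are intervals. -/
def IsUmbrella (n : ℕ) (a : ℕ → ℕ → ℕ) (κ : ℕ → ℕ) : Prop :=
  Set.InjOn κ (Set.Iio n) ∧ ∀ x y z, x < n → y < n → z < n → κ x < κ y → κ y < κ z →
    a x z = 1 → a x y = 1 ∧ a y z = 1

/-- `q 0, …, q (m - 1)` are the `m` vertices of lowest rank, in this order. -/
def IsInitial (n : ℕ) (κ q : ℕ → ℕ) (m : ℕ) : Prop :=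
  (∀ i j, i < j → j < m → κ (q i) < κ (q j)) ∧
    ∀ i < m, ∀ y < n, (∀ j < m, q j ≠ y) → κ (q i) < κ y

/-- The set `{q 0, …, q (m - 1)}` is a union of connected components. -/
def IsClosedSeq (n : ℕ) (a : ℕ → ℕ → ℕ) (q : ℕ → ℕ) (m : ℕ) : Prop :=
  ∀ i < m, ∀ y < n, a (q i) y = 1 → ∃ j < m, q j = y

/-- `q 0, …, q (m - 1)` is an umbrella ordering. -/
def IsUmbrellaSeq (a : ℕ → ℕ → ℕ) (q : ℕ → ℕ) (m : ℕ) : Prop :=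
  ∀ i j l, i < j → j < l → l < m → a (q i) (q l) = 1 → a (q i) (q j) = 1 ∧ a (q j) (q l) = 1

/-- Shrinking an edge by one place at either end, again and again, reaches every place below it.
Thus testing pairs suffices instead of triples, which keeps the check quadratic. -/
theorem isUmbrellaSeq_of_local {a : ℕ → ℕ → ℕ} {q : ℕ → ℕ} {m : ℕ}
    (h : ∀ i j, i + 1 < j → j < m → a (q i) (q j) = 1 →
      a (q i) (q (j - 1)) = 1 ∧ a (q (i + 1)) (q j) = 1) : IsUmbrellaSeq a q m := by
  have key : ∀ d i l, i + d = l → l < m → a (q i) (q l) = 1 → ∀ j, i < j → j < l →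
      a (q i) (q j) = 1 ∧ a (q j) (q l) = 1 := by
    intro d
    induction d with
    | zero => intros; omega
    | succ d ih =>
      intro i l hd hl hil j hij hjl
      obtain ⟨h1, h2⟩ := h i l (by omega) hl hil
      constructor
      · rcases Nat.lt_or_ge j (l - 1) with hj | hj
        · exact (ih i (l - 1) (by omega) (by omega) h1 j hij hj).1
        · obtain rfl : j = l - 1 := by omega
          exact h1
      · rcases Nat.lt_or_ge (i + 1) j with hj | hj
        · exact (ih (i + 1) l (by omega) hl h2 j hj hjl).2
        · obtain rfl : j = i + 1 := by omega
          exact h2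
  exact fun i j l hij hjl hl hil => key (l - i) i l (by omega) hl hil j hij hjl

theorem IsUmbrella.isUmbrellaSeq {n : ℕ} {a : ℕ → ℕ → ℕ} {κ q : ℕ → ℕ} {m : ℕ}
    (hκ : IsUmbrella n a κ) (hq : IsInitial n κ q m) (hn : ∀ i < m, q i < n) :
    IsUmbrellaSeq a q m := fun i j l hij hjl hl =>
  hκ.2 _ _ _ (hn i (by omega)) (hn j (by omega)) (hn l hl) (hq.1 i j hij (by omega))
    (hq.1 j l hjl hl)

theorem isInitial_update_iff {n m x : ℕ} {κ q : ℕ → ℕ} (hx : x < n) (hxq : ∀ i < m, q i ≠ x) :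
    IsInitial n κ (Function.update q m x) (m + 1) ↔
      IsInitial n κ q m ∧ ∀ y < n, (∀ j < m, q j ≠ y) → y ≠ x → κ x < κ y := by
  have hu : ∀ i < m, Function.update q m x i = q i := fun i hi =>
    Function.update_of_ne hi.ne _ _
  have hm : Function.update q m x m = x := Function.update_self _ _ _
  constructor
  · rintro ⟨h1, h2⟩
    refine ⟨⟨fun i j hij hj => ?_, fun i hi y hy hyq => ?_⟩, fun y hy hyq hyx => ?_⟩
    · simpa [hu i (by omega), hu j hj] using h1 i j hij (by omega)
    · by_cases hyx : y = x
      · subst hyx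
        simpa [hu i hi, hm] using h1 i m hi (by omega)
      · have := h2 i (by omega) y hy fun j hj => by
          rcases Nat.lt_succ_iff_lt_or_eq.1 hj with hj | rfl
          · rw [hu j hj]; exact hyq j hj
          · rw [hm]; exact Ne.symm hyx
        rwa [hu i hi] at this
    · have := h2 m (by omega) y hy fun j hj => by
          rcases Nat.lt_succ_iff_lt_or_eq.1 hj with hj | rfl
          · rw [hu j hj]; exact hyq j hj
          · rw [hm]; exact Ne.symm hyx
      rwa [hm] at this
  · rintro ⟨⟨h1, h2⟩, h3⟩
    refine ⟨fun i j hij hj => ?_, fun i hi y hy hyq => ?_⟩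
    · rcases Nat.lt_succ_iff_lt_or_eq.1 hj with hj | rfl
      · rw [hu i (by omega), hu j hj]; exact h1 i j hij hj
      · rw [hu i hij, hm]; exact h2 i hij x hx hxq
    · have hyq' : ∀ j < m, q j ≠ y := fun j hj => by
        have := hyq j (by omega)
        rwa [hu j hj] at this
      have hyx : y ≠ x := by
        have := hyq m (by omega)
        rw [hm] at this
        exact this.symm
      rcases Nat.lt_succ_iff_lt_or_eq.1 hi with hi | rfl
      · rw [hu i hi]; exact h2 i hi y hy hyq'
      · rw [hm]; exact h3 y hy hyq' hyx

/-- Two adjacent vertices with the same closed neighbourhoods may be exchanged. -/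
theorem IsUmbrella.swap {n : ℕ} {a : ℕ → ℕ → ℕ} {κ : ℕ → ℕ} (ha : IsAdjMatrix n a)
    (hκ : IsUmbrella n a κ) {v w : ℕ} (hv : v < n) (hw : w < n)
    (h : ∀ y, y ≠ v → y ≠ w → a v y = a w y) :
    IsUmbrella n a (κ ∘ Equiv.swap v w) := by
  have hlt : ∀ x, x < n → Equiv.swap v w x < n := fun x hx => by
    rw [Equiv.swap_apply_def]; split_ifs <;> assumption
  have haut : ∀ x y, a (Equiv.swap v w x) (Equiv.swap v w y) = a x y := by
    intro x y
    simp only [Equiv.swap_apply_def]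
    have := ha.symm
    have := ha.self
    split_ifs <;> grind
  refine ⟨hκ.1.comp (Equiv.swap v w).injective.injOn fun x hx => hlt x hx,
    fun x y z hx hy hz hxy hyz hxz => ?_⟩
  have := hκ.2 _ _ _ (hlt x hx) (hlt y hy) (hlt z hz) hxy hyz (by rwa [haut])
  rwa [haut, haut] at this

/-- The greedy step: an initial segment of an umbrella ordering is extended by a vertex with the
largest number of neighbours in it, and the smallest degree among these vertices. -/
theorem exists_isUmbrella_extend {n : ℕ} {a : ℕ → ℕ → ℕ} (ha : IsAdjMatrix n a) {κ q : ℕ → ℕ}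
    {m w : ℕ} (hκ : IsUmbrella n a κ) (hq : IsInitial n κ q m) (hn : ∀ i < m, q i < n)
    (hw : w < n) (hwq : ∀ i < m, q i ≠ w) (hpos : ∑ i ∈ Finset.range m, a (q i) w ≠ 0)
    (hmax : ∀ v < n, (∀ i < m, q i ≠ v) →
      (∑ i ∈ Finset.range m, a (q i) v) * (n + 1) + (n - ∑ y ∈ Finset.range n, a v y) ≤
        (∑ i ∈ Finset.range m, a (q i) w) * (n + 1) + (n - ∑ y ∈ Finset.range n, a w y)) :
    ∃ κ', IsUmbrella n a κ' ∧ IsInitial n κ' (Function.update q m w) (m + 1) := by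
  -- `v` is the vertex that `κ` itself puts next. If it is not `w`, the two turn out to be twins and
  -- can be exchanged in `κ`.
  obtain ⟨v, hv, hmin⟩ := Finset.exists_min_image
    ((Finset.range n).filter fun v => ∀ i < m, q i ≠ v) κ ⟨w, by simpa using ⟨hw, hwq⟩⟩
  simp only [Finset.mem_filter, Finset.mem_range] at hv hmin
  obtain ⟨hv, hvq⟩ := hv
  by_cases hvw : v = w
  · subst hvw
    refine ⟨κ, hκ, (isInitial_update_iff hw hwq).2 ⟨hq, fun y hy hyq hyv => ?_⟩⟩
    exact lt_of_le_of_ne (hmin y ⟨hy, hyq⟩) fun h => hyv (hκ.1 hv hy h).symm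
  have hlt : ∀ y < n, (∀ i < m, q i ≠ y) → y ≠ v → κ v < κ y := fun y hy hyq hyv =>
    lt_of_le_of_ne (hmin y ⟨hy, hyq⟩) fun h => hyv (hκ.1 hv hy h).symm
  have hκvw := hlt w hw hwq (Ne.symm hvw)
  have h1 : ∀ i < m, a (q i) w = 1 → a (q i) v = 1 ∧ a v w = 1 := fun i hi =>
    hκ.2 _ _ _ (hn i hi) hv hw (hq.2 i hi v hv hvq) hκvw
  have hle : ∀ i ∈ Finset.range m, a (q i) w ≤ a (q i) v := by
    intro i hi
    have := ha.le_one (q i) w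
    rcases Nat.le_one_iff_eq_zero_or_eq_one.1 this with h | h
    · omega
    · rw [h, (h1 i (Finset.mem_range.1 hi) h).1]
  have hsum := Finset.sum_le_sum hle
  have hkey := hmax v hv hvq
  -- The degree term is at most `n`, so the factor `n + 1` makes the priority lexicographic: the
  -- neighbour counts must agree before degrees matter.
  have hsum' : ∑ i ∈ Finset.range m, a (q i) w = ∑ i ∈ Finset.range m, a (q i) v := by
    refine le_antisymm hsum ?_
    by_contra hcon
    have : (∑ i ∈ Finset.range m, a (q i) w + 1) * (n + 1) ≤
        (∑ i ∈ Finset.range m, a (q i) v) * (n + 1) := Nat.mul_le_mul_right _ (by omega)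
    rw [add_mul] at this
    omega
  have heq := (Finset.sum_eq_sum_iff_of_le hle).1 hsum'
  have havw : a v w = 1 := by
    obtain ⟨i, hi, hne⟩ := Finset.exists_ne_zero_of_sum_ne_zero hpos
    have := ha.le_one (q i) w
    exact (h1 i (Finset.mem_range.1 hi) (by omega)).2
  have hdegn : ∀ x < n, ∑ y ∈ Finset.range n, a x y ≤ n := fun x _ => by
    simpa using Finset.sum_le_sum fun y (_ : y ∈ Finset.range n) => ha.le_one x y
  have hdeg : ∑ y ∈ Finset.range n, a w y ≤ ∑ y ∈ Finset.range n, a v y := by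
    have := hdegn v hv
    have := hdegn w hw
    rw [hsum'] at hkey
    omega
  -- The added indicators turn rows into closed neighbourhoods, and the claim is N[v] ⊆ N[w]. A
  -- neighbour of `v` beyond `w` spans `w`; one between `v` and `w` lies under the edge `v w`; those
  -- already placed agree by `heq`.
  have hnb : ∀ y ∈ Finset.range n, a v y + (if y = v then 1 else 0) ≤
      a w y + (if y = w then 1 else 0) := by
    intro y hy
    have hyn := Finset.mem_range.1 hy
    by_cases hyv : y = v
    · subst hyv; simp [ha.self, ha.symm w y, havw]
    by_cases hyw : y = w
    · subst hyw; simp [hyv, ha.self, havw]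
    rcases Nat.le_one_iff_eq_zero_or_eq_one.1 (ha.le_one v y) with h | h
    · simp [hyv, h]
    simp only [hyv, hyw, h, if_false, add_zero]
    suffices a w y = 1 by omega
    by_cases hyq : ∀ i < m, q i ≠ y
    · have hvy := hlt y hyn hyq hyv
      rcases lt_trichotomy (κ y) (κ w) with hyw' | hyw' | hyw'
      · rw [ha.symm]; exact (hκ.2 v y w hv hyn hw hvy hyw' havw).2
      · exact absurd (hκ.1 hyn hw hyw') hyw
      · exact (hκ.2 v w y hv hw hyn hκvw hyw' h).2
    · push Not at hyq
      obtain ⟨i, hi, rfl⟩ := hyq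
      rw [ha.symm, heq i (Finset.mem_range.2 hi), ha.symm, h]
  have hnbsum : ∑ y ∈ Finset.range n, (a v y + (if y = v then 1 else 0)) =
      ∑ y ∈ Finset.range n, (a w y + (if y = w then 1 else 0)) := by
    refine le_antisymm (Finset.sum_le_sum hnb) ?_
    simp only [Finset.sum_add_distrib, Finset.sum_ite_eq', Finset.mem_range, hv, hw, if_true]
    omega
  -- The inclusion together with deg w ≤ deg v forces equality.
  have htwin := (Finset.sum_eq_sum_iff_of_le hnb).1 hnbsum
  refine ⟨κ ∘ Equiv.swap v w, hκ.swap ha hv hw fun y hyv hyw => ?_, ?_⟩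
  · by_cases hy : y < n
    · simpa [hyv, hyw] using htwin y (Finset.mem_range.2 hy)
    · have h0 : ∀ x, a x y = 0 := fun x => by
        have h1 := ha.le_one x y
        have h2 := ha.lt y x
        rw [ha.symm] at h2
        by_contra h
        exact hy (h2 (by omega))
      rw [h0, h0]
  · have hsq : ∀ i < m, Equiv.swap v w (q i) = q i := fun i hi =>
      Equiv.swap_apply_of_ne_of_ne (hvq i hi) (hwq i hi)
    refine (isInitial_update_iff hw hwq).2 ⟨⟨fun i j hij hj => ?_, fun i hi y hy hyq => ?_⟩,
      fun y hy hyq hyw => ?_⟩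
    · simp only [Function.comp, hsq i (hij.trans hj), hsq j hj]
      exact hq.1 i j hij hj
    · simp only [Function.comp, hsq i hi]
      refine hq.2 i hi _ ?_ ?_
      · rw [Equiv.swap_apply_def]; split_ifs <;> assumption
      · rw [Equiv.swap_apply_def]; split_ifs <;> assumption
    · simp only [Function.comp, Equiv.swap_apply_right]
      by_cases hyv : y = v
      · subst hyv; simpa using hκvw
      · rw [Equiv.swap_apply_of_ne_of_ne hyv hyw]
        exact hlt y hy hyq hyv

/-- The vertices outside a closed umbrella sequence can be put behind it, in an order that
starts with any vertex having no earlier outside neighbour. -/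
theorem exists_isUmbrella_of_isClosedSeq {n : ℕ} {a : ℕ → ℕ → ℕ} (ha : IsAdjMatrix n a)
    {κ q : ℕ → ℕ} {m s : ℕ} (hκ : IsUmbrella n a κ)
    (hqi : ∀ i j, i < m → j < m → q i = q j → i = j)
    (hq : IsUmbrellaSeq a q m) (hc : IsClosedSeq n a q m) (hs : s < n) (hsq : ∀ i < m, q i ≠ s)
    (hfirst : ∀ x < n, κ x < κ s → a x s = 0) :
    ∃ κ', IsUmbrella n a κ' ∧ IsInitial n κ' (Function.update q m s) (m + 1) := by
  classical
  obtain ⟨K, hK⟩ : ∃ K, ∀ x < n, κ x < K :=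
    ⟨∑ x ∈ Finset.range n, κ x + 1, fun x hx => Nat.lt_succ_of_le
      (Finset.single_le_sum (f := κ) (fun _ _ => Nat.zero_le _) (Finset.mem_range.2 hx))⟩
  -- The new order has three blocks: the sequence `q`, the outside vertices from `s` on, and finally
  -- the outside vertices before `s`. Since `K` exceeds all old ranks, the last two blocks do not
  -- mix.
  set κ' : ℕ → ℕ := fun x => if h : ∃ i, i < m ∧ q i = x then h.choose else
    if κ s ≤ κ x then m + κ x else m + K + κ x with hκ'
  have e1 : ∀ i < m, κ' (q i) = i := fun i hi => by
    have h : ∃ j, j < m ∧ q j = q i := ⟨i, hi, rfl⟩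
    simp only [hκ', dif_pos h]
    exact hqi _ _ h.choose_spec.1 hi h.choose_spec.2
  have e2 : ∀ x, (∀ i < m, q i ≠ x) → κ s ≤ κ x → κ' x = m + κ x := fun x hx hs => by
    have h : ¬ ∃ i, i < m ∧ q i = x := fun ⟨i, hi, h⟩ => hx i hi h
    simp only [hκ', dif_neg h, if_pos hs]
  have e3 : ∀ x, (∀ i < m, q i ≠ x) → ¬ κ s ≤ κ x → κ' x = m + K + κ x := fun x hx hs => by
    have h : ¬ ∃ i, i < m ∧ q i = x := fun ⟨i, hi, h⟩ => hx i hi h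
    simp only [hκ', dif_neg h, if_neg hs]
  have trich : ∀ x < n, (∃ i < m, x = q i ∧ κ' x = i) ∨
      ((∀ i < m, q i ≠ x) ∧ κ s ≤ κ x ∧ κ' x = m + κ x) ∨
      ((∀ i < m, q i ≠ x) ∧ κ x < κ s ∧ κ' x = m + K + κ x) := by
    intro x hx
    by_cases h : ∃ i < m, x = q i
    · obtain ⟨i, hi, rfl⟩ := h
      exact .inl ⟨i, hi, rfl, e1 i hi⟩
    · push Not at h
      have h' : ∀ i < m, q i ≠ x := fun i hi => (h i hi).symm
      by_cases h2 : κ s ≤ κ x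
      · exact .inr (.inl ⟨h', h2, e2 x h' h2⟩)
      · exact .inr (.inr ⟨h', by omega, e3 x h' h2⟩)
  refine ⟨κ', ⟨fun x hx y hy hxy => ?_, fun x y z hx hy hz hxy hyz hxz => ?_⟩,
    (isInitial_update_iff hs hsq).2 ⟨⟨fun i j hij hj => ?_, fun i hi y hy hyq => ?_⟩,
      fun y hy hyq hys => ?_⟩⟩
  · have hinj : κ x = κ y → x = y := fun h => hκ.1 hx hy h
    have := hK x hx
    have := hK y hy
    rcases trich x hx with ⟨i, hi, hxi, h1⟩ | ⟨h0, h1, h2⟩ | ⟨h0, h1, h2⟩ <;>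
      rcases trich y hy with ⟨i', hi', hxi', h1'⟩ | ⟨h0', h1', h2'⟩ | ⟨h0', h1', h2'⟩
    · rw [hxi, hxi', ← h1, ← h1', hxy]
    all_goals omega
  · have hKx := hK x hx
    have hKy := hK y hy
    have hKz := hK z hz
    rcases trich x hx with ⟨i, hi, hxi, h1⟩ | ⟨h0, h1, h2⟩ | ⟨h0, h1, h2⟩
    · subst hxi
      obtain ⟨l, hl, rfl⟩ := hc i hi z hz hxz
      have hl' := e1 l hl
      rcases trich y hy with ⟨j, hj, rfl, hj'⟩ | ⟨h0', h1', h2'⟩ | ⟨h0', h1', h2'⟩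
      · exact hq i j l (by omega) (by omega) hl hxz
      · omega
      · omega
    · rcases trich z hz with ⟨j, hj, rfl, hj'⟩ | ⟨h0', h1', h2'⟩ | ⟨h0', h1', h2'⟩
      · omega
      · rcases trich y hy with ⟨j, hj, rfl, hj'⟩ | ⟨h0'', h1'', h2''⟩ | ⟨h0'', h1'', h2''⟩
        · omega
        · exact hκ.2 x y z hx hy hz (by omega) (by omega) hxz
        · omega
      -- An edge between the second and third blocks would join some `z` before `s` to some `x` not
      -- before `s`, so `s` would have an earlier neighbour.
      · have h3 := hfirst z hz h1'
        rcases h1.lt_or_eq with h4 | h4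
        · have := (hκ.2 z s x hz hs hx h1' h4 (by rwa [ha.symm])).1
          omega
        · obtain rfl : s = x := hκ.1 hs hx h4
          rw [ha.symm] at h3
          omega
    · rcases trich z hz with ⟨j, hj, rfl, hj'⟩ | ⟨h0', h1', h2'⟩ | ⟨h0', h1', h2'⟩
      · omega
      · omega
      · rcases trich y hy with ⟨j, hj, rfl, hj'⟩ | ⟨h0'', h1'', h2''⟩ | ⟨h0'', h1'', h2''⟩
        · omega
        · omega
        · exact hκ.2 x y z hx hy hz (by omega) (by omega) hxz
  · rw [e1 i (by omega), e1 j hj]; exact hij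
  · rw [e1 i hi]
    rcases trich y hy with ⟨j, hj, rfl, hj'⟩ | ⟨h0', h1', h2'⟩ | ⟨h0', h1', h2'⟩
    · exact absurd rfl (hyq j hj)
    · omega
    · omega
  · have := hK s hs
    rw [e2 s hsq le_rfl]
    by_cases h : κ s ≤ κ y
    · rw [e2 y hyq h]
      have := lt_of_le_of_ne h fun h => hys (hκ.1 hs hy h).symm
      omega
    · rw [e3 y hyq h]; omega

/-- A closed umbrella sequence that misses a vertex can be extended by some vertex outside,
even after cutting it back to an earlier closed part. -/
theorem exists_isInitial_of_ne {n : ℕ} {a : ℕ → ℕ → ℕ} (ha : IsAdjMatrix n a)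
    {κ q : ℕ → ℕ} {m x : ℕ} (hκ : IsUmbrella n a κ)
    (hqi : ∀ i j, i < m → j < m → q i = q j → i = j)
    (hq : IsUmbrellaSeq a q m) (hc : IsClosedSeq n a q m) (hx : x < n) (hxq : ∀ i < m, q i ≠ x) :
    ∃ s < n, (∀ i < m, q i ≠ s) ∧ ∀ m₀ ≤ m, IsClosedSeq n a q m₀ →
      ∃ κ', IsUmbrella n a κ' ∧ IsInitial n κ' (Function.update q m₀ s) (m₀ + 1) := by
  -- `s` is the lowest-ranked vertex outside the whole sequence. It does not depend on `m₀`, so it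
  -- was a valid start at every earlier closed stage as well; this shows that a search which
  -- rejected it once made a contradictory decision.
  obtain ⟨s, hs, hmin⟩ := Finset.exists_min_image
    ((Finset.range n).filter fun v => ∀ i < m, q i ≠ v) κ ⟨x, by simpa using ⟨hx, hxq⟩⟩
  simp only [Finset.mem_filter, Finset.mem_range] at hs hmin
  refine ⟨s, hs.1, hs.2, fun m₀ hm₀ hc₀ => exists_isUmbrella_of_isClosedSeq ha hκ
    (fun i j hi hj => hqi i j (by omega) (by omega))
    (fun i j l hij hjl hl => hq i j l hij hjl (by omega)) hc₀ hs.1 (fun i hi => hs.2 i (by omega))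
    fun y hy hys => ?_⟩
  -- A lower-ranked neighbour of `s` would belong to the sequence, and closedness would then put `s`
  -- into it too.
  by_contra hne
  by_cases hyq : ∀ i < m, q i ≠ y
  · exact absurd (hmin y ⟨hy, hyq⟩) (by omega)
  · push Not at hyq
    obtain ⟨i, hi, rfl⟩ := hyq
    obtain ⟨j, hj, h⟩ := hc i hi s hs.1 (by have := ha.le_one (q i) s; omega)
    exact hs.2 j hj h

/-! ### From proper interval graphs to umbrella orderings -/

open Classical in
/-- The adjacency matrix of `G`, padded with zeros. -/
noncomputable def SimpleGraph.natAdj {n : ℕ} (G : SimpleGraph (Fin n)) (u v : ℕ) : ℕ :=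
  if ∃ u' v' : Fin n, G.Adj u' v' ∧ u'.val = u ∧ v'.val = v then 1 else 0

theorem SimpleGraph.natAdj_eq_one {n : ℕ} {G : SimpleGraph (Fin n)} {u v : ℕ} :
    G.natAdj u v = 1 ↔ ∃ u' v' : Fin n, G.Adj u' v' ∧ u'.val = u ∧ v'.val = v := by
  unfold SimpleGraph.natAdj
  split_ifs with h <;> simp [h]

theorem SimpleGraph.natAdj_val {n : ℕ} {G : SimpleGraph (Fin n)} {u v : Fin n} :
    G.natAdj u v = 1 ↔ G.Adj u v := by
  rw [SimpleGraph.natAdj_eq_one]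
  constructor
  · rintro ⟨u', v', h, hu, hv⟩
    rwa [← Fin.ext hu, ← Fin.ext hv]
  · exact fun h => ⟨u, v, h, rfl, rfl⟩

theorem SimpleGraph.isAdjMatrix_natAdj {n : ℕ} (G : SimpleGraph (Fin n)) :
    IsAdjMatrix n G.natAdj where
  le_one u v := by unfold SimpleGraph.natAdj; split_ifs <;> omega
  symm u v := by
    unfold SimpleGraph.natAdj
    congr 1
    exact propext ⟨fun ⟨a, b, h, ha, hb⟩ => ⟨b, a, h.symm, hb, ha⟩,
      fun ⟨a, b, h, ha, hb⟩ => ⟨b, a, h.symm, hb, ha⟩⟩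
  self u := by
    unfold SimpleGraph.natAdj
    rw [if_neg]
    rintro ⟨a, b, h, rfl, hb⟩
    exact h.ne (Fin.ext hb.symm)
  lt u v h := by
    obtain ⟨a, b, -, rfl, -⟩ := SimpleGraph.natAdj_eq_one.1 h
    exact a.2

/-- Without containment the left endpoints are distinct and the right endpoints are ordered alike.
For u before v, adjacency then just says that v starts no later than u ends. The rank of a vertex is
the number of smaller left endpoints. -/
theorem IsProperIntervalGraph.exists_isUmbrella {n : ℕ} {G : SimpleGraph (Fin n)}
    (h : IsProperIntervalGraph G) : ∃ κ, IsUmbrella n G.natAdj κ := by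
  classical
  obtain ⟨l, r, hlr, hsub, hadj⟩ := h
  have hinj : ∀ u v, l u = l v → u = v := by
    intro u v huv
    by_contra hne
    rcases le_total (r u) (r v) with h | h
    · exact hsub u v hne (Set.Icc_subset_Icc huv.ge h)
    · exact hsub v u (Ne.symm hne) (Set.Icc_subset_Icc huv.le h)
  have hr : ∀ u v, l u < l v → r u < r v := by
    intro u v huv
    by_contra hle
    exact hsub v u (fun h => by simp [h] at huv) (Set.Icc_subset_Icc huv.le (not_lt.1 hle))
  have hadj' : ∀ u v, l u < l v → (G.Adj u v ↔ l v ≤ r u) := by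
    intro u v huv
    rw [hadj]
    constructor
    · rintro ⟨-, x, hx, hx'⟩
      exact hx'.1.trans hx.2
    · exact fun h => ⟨fun h => by simp [h] at huv, l v, ⟨huv.le, h⟩, le_rfl, hlr v⟩
  set κ : ℕ → ℕ := fun x =>
    (Finset.univ.filter fun y : Fin n => ∃ h : x < n, l y < l ⟨x, h⟩).card with hκ
  have hmono : ∀ u v : Fin n, l u < l v → κ u < κ v := by
    intro u v huv
    apply Finset.card_lt_card
    rw [Finset.ssubset_iff_of_subset]
    · exact ⟨u, by simpa using huv, by simp⟩
    · intro y
      simp only [Finset.mem_filter, Finset.mem_univ, true_and, Fin.is_lt, exists_true_left,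
        Fin.eta]
      exact fun h => h.trans huv
  have hmono' : ∀ u v : Fin n, κ u < κ v → l u < l v := by
    intro u v h
    by_contra hle
    rcases (not_lt.1 hle).lt_or_eq with h' | h'
    · exact absurd (hmono v u h') (by omega)
    · rw [hinj _ _ h'] at h; omega
  refine ⟨κ, fun x hx y hy hxy => ?_, fun x y z hx hy hz hxy hyz hxz => ?_⟩
  · have h1 := mt (hmono ⟨x, hx⟩ ⟨y, hy⟩) (by simp [hxy])
    have h2 := mt (hmono ⟨y, hy⟩ ⟨x, hx⟩) (by simp [hxy])
    exact congrArg Fin.val (hinj _ _ (le_antisymm (not_lt.1 h2) (not_lt.1 h1)))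
  · lift x to Fin n using hx
    lift y to Fin n using hy
    lift z to Fin n using hz
    have h1 := hmono' x y hxy
    have h2 := hmono' y z hyz
    rw [SimpleGraph.natAdj_val] at hxz ⊢
    rw [SimpleGraph.natAdj_val]
    rw [hadj' _ _ (h1.trans h2)] at hxz
    rw [hadj' _ _ h1, hadj' _ _ h2]
    exact ⟨h2.le.trans hxz, hxz.trans (hr _ _ h1).le⟩

/-! ### Computing an umbrella ordering in cubic time -/

namespace RAM

/-- Entry `(u, v)` of the input matrix. -/
def adjE (u v : IExpr) : IExpr := .get 0 (.add (.mul u (.reg 0)) v)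

/-- `s` holds the matrix `a` as its input. -/
structure HasAdj (n : ℕ) (a : ℕ → ℕ → ℕ) (s : State) : Prop where
  reg : s.reg 0 = n
  arr : ∀ u v, u < n → v < n → s.arr 0 (u * n + v) = a u v

theorem HasAdj.eval {n : ℕ} {a : ℕ → ℕ → ℕ} {s : State} (h : HasAdj n a s) {u v : IExpr}
    (hu : u.eval s < n) (hv : v.eval s < n) :
    (adjE u v).eval s = a (u.eval s) (v.eval s) := by
  simp only [adjE, IExpr.eval, h.reg]
  exact h.arr _ _ hu hv

theorem HasAdj.congr {n : ℕ} {a : ℕ → ℕ → ℕ} {s s' : State} (h : HasAdj n a s)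
    (hr : s'.reg 0 = s.reg 0) (ha : s'.arr 0 = s.arr 0) : HasAdj n a s' :=
  ⟨hr.trans h.reg, fun u v hu hv => by rw [ha]; exact h.arr u v hu hv⟩

/-- Stores the vertex degrees in integer array `5`. -/
def degProg : Prog :=
  .for 7 0 (.for 8 0
    (.setArr 5 (.reg 7) (.add (.get 5 (.reg 7)) (adjE (.reg 7) (.reg 8)))))

theorem degProg_spec {W n : ℕ} {a : ℕ → ℕ → ℕ} {s : State} (ha : IsAdjMatrix n a)
    (hW : n ≤ W) (hs : HasAdj n a s) (h5 : ∀ v, s.arr 5 v = 0) :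
    Runs W degProg s ((n + 1) ^ 2) fun s' => ∀ v < n, s'.arr 5 v = ∑ y ∈ Finset.range n, a v y := by
  refine Runs.for_of (K := n + 1)
    (fun j s' => s'.arr 5 = fun v => if v < j then ∑ y ∈ Finset.range n, a v y else 0)
    (by omega) (by rw [pow_two]) hs.reg hW rfl rfl ?_ ?_ ?_
  · funext v
    simp [State.setReg, h5]
  · intro i s₁ hi hri hF₁ h₁
    have hs₁ := hs.congr (hF₁.reg 0 rfl) (hF₁.arr 0 rfl)
    refine Runs.for_of (K := 1)
      (fun j s' => s'.arr 5 = Function.update (s₁.arr 5) i (∑ y ∈ Finset.range j, a i y))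
      le_rfl (by omega) hs₁.reg hW rfl rfl ?_ ?_ ?_
    · simp [State.setReg, h₁]
    · intro j s₂ hj hrj hF₂ h₂
      have hs₂ := hs₁.congr (hF₂.reg 0 rfl) (hF₂.arr 0 rfl)
      have hri₂ : s₂.reg 7 = i := (hF₂.reg 7 rfl).trans hri
      have he := hs₂.eval (u := .reg 7) (v := .reg 8) (by simpa [IExpr.eval, hri₂])
        (by simpa [IExpr.eval, hrj])
      simp only [IExpr.eval, hri₂, hrj] at he
      have hsum : ∑ y ∈ Finset.range (j + 1), a i y ≤ n := by
        calc _ ≤ ∑ y ∈ Finset.range (j + 1), 1 := Finset.sum_le_sum fun y _ => ha.le_one i y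
          _ ≤ n := by simp; omega
      rw [Finset.sum_range_succ] at hsum
      refine Runs.setArr le_rfl ?_ ?_ ?_
      · simp [IExpr.eval, hri₂]; omega
      · simp [IExpr.eval, hri₂, he, h₂]; omega
      · simp [IExpr.eval, hri₂, he, h₂, State.setReg, State.setArr, Finset.sum_range_succ]
    · intro s₂ hF₂ h₂
      funext v
      simp only [State.setReg, h₂, h₁, Function.update_apply]
      grind
  · intro s' hF h v hv
    rw [h]
    simp [hv]

end RAM
namespace RAM

/-- Appends vertex `reg 9` to the ordering and updates marks and neighbour counts. -/
def placeProg : Prog :=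
  .seq (.setArr 2 (.reg 5) (.reg 9))
    (.seq (.setReg 5 (.add (.reg 5) (.lit 1)))
      (.seq (.setArr 3 (.reg 9) (.lit 1))
        (.for 7 0 (.setArr 4 (.reg 7) (.add (.get 4 (.reg 7)) (adjE (.reg 9) (.reg 7)))))))

/-- Array `2` holds the tentative sequence, with its length in register `5`. Array `3` holds the
marks of placed vertices and array `4` the numbers of placed neighbours. Register `4` keeps the
length of the part accepted so far. -/
theorem placeProg_spec {W n : ℕ} {a : ℕ → ℕ → ℕ} {s : State} (ha : IsAdjMatrix n a)
    (hW : n + 1 ≤ W) (hs : HasAdj n a s) {len w : ℕ} (hlen : s.reg 5 = len) (hw : s.reg 9 = w)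
    (hlenn : len < n) (hwn : w < n) (hcnt : ∀ v < n, s.arr 4 v ≤ len) :
    Runs W placeProg s (n + 1) fun s' => s'.reg 5 = len + 1 ∧
      s'.arr 2 = Function.update (s.arr 2) len w ∧ s'.arr 3 = Function.update (s.arr 3) w 1 ∧
      ∀ v < n, s'.arr 4 v = s.arr 4 v + a w v := by
  refine .seq (.setArr (by omega) ?_ ?_ ?_)
  · simp [IExpr.eval, hlen]; omega
  · simp [IExpr.eval, hw]; omega
  refine .seq (.setReg (by omega) ?_ ?_)
  · simp [IExpr.eval, hlen, State.setArr]; omega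
  refine .seq (.setArr (by omega) ?_ ?_ ?_)
  · simp [IExpr.eval, hw, State.setArr, State.setReg]; omega
  · simp [IExpr.eval]; omega
  refine Runs.for_of (K := 1) (m := n)
      (fun j s' => s'.arr 4 = fun v => if v < j then s.arr 4 v + a w v else s.arr 4 v)
      le_rfl (by omega) (by simpa [State.setReg, State.setArr] using hs.reg) (by omega) rfl rfl
      ?_ ?_ ?_
  · simp [State.setReg, State.setArr]
  · intro j s₁ hj hrj hF h₁
    have hs₁ : HasAdj n a s₁ := hs.congr (by rw [hF.reg 0 rfl]; simp [State.setReg, State.setArr])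
      (by rw [hF.arr 0 rfl]; simp [State.setReg, State.setArr])
    have h9 : s₁.reg 9 = w := by
      rw [hF.reg 9 rfl]; simpa [State.setReg, State.setArr] using hw
    have he := hs₁.eval (u := .reg 9) (v := .reg 7) (by simpa [IExpr.eval, h9])
        (by simpa [IExpr.eval, hrj])
    simp only [IExpr.eval, h9, hrj] at he
    have := ha.le_one w j
    have := hcnt j hj
    refine Runs.setArr le_rfl ?_ ?_ ?_
    · simp [IExpr.eval, hrj]; omega
    · simp [IExpr.eval, hrj, he, h₁]; omega
    · simp only [IExpr.eval, hrj, he, h₁, State.setReg, State.setArr, Function.update_self]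
      funext v
      simp only [Function.update_apply]
      grind
  · intro s' hF h
    rw [hF.reg 5 rfl, hF.arr 2 rfl, hF.arr 3 rfl, h]
    simp +contextual [State.setReg, State.setArr, IExpr.eval, hlen, hw]

/-- Priority of the vertex `v` in the greedy sweep; it is `0` on marked vertices. -/
def sweepKey (n : ℕ) (s : State) (v : ℕ) : ℕ :=
  (1 - s.arr 3 v) * (s.arr 4 v * (n + 1) + (n - s.arr 5 v))

/-- Expression for `sweepKey`. -/
def keyE (v : IExpr) : IExpr :=
  .mul (.sub (.lit 1) (.get 3 v))
    (.add (.mul (.get 4 v) (.add (.reg 0) (.lit 1))) (.sub (.reg 0) (.get 5 v)))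

theorem keyE_eval {n : ℕ} {s : State} (h : s.reg 0 = n) (v : IExpr) :
    (keyE v).eval s = sweepKey n s (v.eval s) := by
  simp [keyE, IExpr.eval, sweepKey, h]

/-- Puts a vertex of highest priority into register `9`. -/
def selectProg : Prog :=
  .seq (.setReg 9 (.lit 0))
    (.for 7 0 (.ite (.le (keyE (.reg 9)) (keyE (.reg 7))) (.setReg 9 (.reg 7)) .skip))

theorem selectProg_spec {W n : ℕ} {s : State} (hn : 1 ≤ n) (hW : n ≤ W) (hs : s.reg 0 = n) :
    Runs W selectProg s (n + 1) fun s' => s'.reg 9 < n ∧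
      ∀ v < n, sweepKey n s v ≤ sweepKey n s (s'.reg 9) := by
  refine .seq (.setReg (by omega) (Nat.zero_le _) ?_)
  refine Runs.for_of (K := 1) (m := n) (fun j s' => s'.reg 9 < n ∧
      ∀ v < j, sweepKey n s v ≤ sweepKey n s (s'.reg 9))
      le_rfl (by omega) (by simpa [State.setReg] using hs) (by omega) rfl rfl ?_ ?_ ?_
  · simp [State.setReg, IExpr.eval]; omega
  · intro j s₁ hj hrj hF h₁
    have hk : ∀ v, sweepKey n s₁ v = sweepKey n s v := fun v => by
      simp only [sweepKey, hF.arr 3 rfl, hF.arr 4 rfl, hF.arr 5 rfl]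
      simp [State.setReg]
    have h0 : s₁.reg 0 = n := by rw [hF.reg 0 rfl]; simpa [State.setReg] using hs
    have hb : (Test.le (keyE (.reg 9)) (keyE (.reg 7))).Holds s₁ ↔
        sweepKey n s (s₁.reg 9) ≤ sweepKey n s j := by
      simp [Test.Holds, keyE_eval h0, hk, IExpr.eval, hrj]
    refine .ite le_rfl (fun h => .setReg le_rfl ?_ ?_) (fun h => .skip le_rfl ?_)
    · simp [IExpr.eval, hrj]; omega
    · rw [hb] at h
      simp only [IExpr.eval, hrj, State.setReg]
      refine ⟨by simpa using hj, fun v hv => ?_⟩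
      have : v < j → sweepKey n s v ≤ sweepKey n s (s₁.reg 9) := h₁.2 v
      simp only [Function.update_apply]
      norm_num
      rcases Nat.lt_succ_iff_lt_or_eq.1 hv with hv | rfl
      · exact (this hv).trans h
      · exact le_rfl
    · rw [hb] at h
      simp only [State.setReg]
      refine ⟨by simpa using h₁.1, fun v hv => ?_⟩
      have : v < j → sweepKey n s v ≤ sweepKey n s (s₁.reg 9) := h₁.2 v
      simp only [Function.update_apply]
      norm_num
      rcases Nat.lt_succ_iff_lt_or_eq.1 hv with hv | rfl
      · exact this hv
      · omega
  · exact fun s' _ h => h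

/-- The test that fails where the umbrella property is violated. -/
def umbrellaTest : Test :=
  .conj (.le (.add (.reg 7) (.lit 2)) (.reg 8))
    (.conj (.eq (adjE (.get 2 (.reg 7)) (.get 2 (.reg 8))) (.lit 1))
      (.neg (.conj (.eq (adjE (.get 2 (.reg 7)) (.get 2 (.sub (.reg 8) (.lit 1)))) (.lit 1))
        (.eq (adjE (.get 2 (.add (.reg 7) (.lit 1))) (.get 2 (.reg 8))) (.lit 1)))))

/-- Sets register `10` to `1` if the ordering has the umbrella property, and to `0` if not. -/
def checkProg : Prog :=
  .seq (.setReg 10 (.lit 1))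
    (.for 7 5 (.for 8 5 (.ite umbrellaTest (.setReg 10 (.lit 0)) .skip)))

theorem checkProg_spec {W n : ℕ} {a : ℕ → ℕ → ℕ} {s : State}
    (hW : n + 1 ≤ W) (hs : HasAdj n a s) {len : ℕ} (hlen : s.reg 5 = len) (hlenn : len ≤ n)
    (hn : ∀ i < len, s.arr 2 i < n) :
    Runs W checkProg s ((n + 1) ^ 2) fun s' => (s'.reg 10 = 1 ↔ ∀ i < len, ∀ j < len, i + 1 < j →
      a (s.arr 2 i) (s.arr 2 j) = 1 →
        a (s.arr 2 i) (s.arr 2 (j - 1)) = 1 ∧ a (s.arr 2 (i + 1)) (s.arr 2 j) = 1) := by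
  have hn1 : 1 ≤ n + 1 := by omega
  refine .seq (.setReg (Nat.one_le_pow _ _ hn1) (by simp [IExpr.eval]; omega) ?_)
  set C : ℕ → ℕ → Prop := fun i j => i + 1 < j →
      a (s.arr 2 i) (s.arr 2 j) = 1 →
        a (s.arr 2 i) (s.arr 2 (j - 1)) = 1 ∧ a (s.arr 2 (i + 1)) (s.arr 2 j) = 1 with hC
  refine Runs.for_of (K := n + 1) (fun i s' => s'.reg 10 = 1 ↔ ∀ i' < i, ∀ j < len, C i' j)
      (by omega) (by rw [pow_two]; gcongr) (m := len) (by simpa [State.setReg] using hlen)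
      (by omega) rfl rfl ?_ ?_ ?_
  · simp [State.setReg, IExpr.eval]
  · intro i s₁ hi hri hF₁ h₁
    have hs₁ : HasAdj n a s₁ := hs.congr (by rw [hF₁.reg 0 rfl]; simp [State.setReg])
      (by rw [hF₁.arr 0 rfl]; simp [State.setReg])
    have hlen₁ : s₁.reg 5 = len := by rw [hF₁.reg 5 rfl]; simpa [State.setReg] using hlen
    have h2₁ : s₁.arr 2 = s.arr 2 := by rw [hF₁.arr 2 rfl]; simp [State.setReg]
    refine Runs.for_of (K := 1)
      (fun j s' => s'.reg 10 = 1 ↔ (∀ i' < i, ∀ j < len, C i' j) ∧ ∀ j' < j, C i j')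
      le_rfl (by omega) hlen₁ (by omega) rfl rfl ?_ ?_ ?_
    · simpa [State.setReg] using h₁
    · intro j s₂ hj hrj hF₂ h₂
      have hs₂ := hs₁.congr (hF₂.reg 0 rfl) (hF₂.arr 0 rfl)
      have h2₂ : s₂.arr 2 = s.arr 2 := (hF₂.arr 2 rfl).trans h2₁
      have hri₂ : s₂.reg 7 = i := (hF₂.reg 7 rfl).trans hri
      have hb : umbrellaTest.Holds s₂ ↔ ¬ C i j := by
        have eij := hs₂.eval (u := .get 2 (.reg 7)) (v := .get 2 (.reg 8))
          (by simpa [IExpr.eval, h2₂, hri₂] using hn i hi)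
          (by simpa [IExpr.eval, h2₂, hrj] using hn j hj)
        have eij' := hs₂.eval (u := .get 2 (.reg 7)) (v := .get 2 (.sub (.reg 8) (.lit 1)))
          (by simpa [IExpr.eval, h2₂, hri₂] using hn i hi)
          (by simpa [IExpr.eval, h2₂, hrj] using hn (j - 1) (by omega))
        simp only [umbrellaTest, Test.Holds, eij, eij', hC]
        simp only [IExpr.eval, h2₂, hri₂, hrj]
        -- Only in this case is place `i + 1` known to hold a listed vertex. Otherwise the first
        -- conjunct of the test fails and the value read there is irrelevant.
        by_cases hij : i + 1 < j
        · have ei'j := hs₂.eval (u := .get 2 (.add (.reg 7) (.lit 1))) (v := .get 2 (.reg 8))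
            (by simpa [IExpr.eval, h2₂, hri₂] using hn (i + 1) (by omega))
            (by simpa [IExpr.eval, h2₂, hrj] using hn j hj)
          simp only [ei'j]
          simp only [IExpr.eval, h2₂, hri₂, hrj]
          have hij' : i + 2 ≤ j := hij
          simp only [hij, hij', true_and, forall_const]
          tauto
        · have hij' : ¬ i + 2 ≤ j := hij
          simp only [hij, hij', false_and, false_imp_iff, not_true_eq_false]
      refine .ite le_rfl (fun h => .setReg le_rfl (Nat.zero_le _) ?_) (fun h => .skip le_rfl ?_)
      · rw [hb] at h
        simp only [State.setReg, IExpr.eval]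
        simp only [Function.update_apply]
        norm_num
        exact fun _ => ⟨j, by omega, h⟩
      · rw [hb, not_not] at h
        simp only [State.setReg, Function.update_apply]
        norm_num
        rw [h₂]
        refine and_congr_right fun _ => ⟨fun h' j' hj' => ?_, fun h' j' hj' => h' j' (by omega)⟩
        rcases Nat.lt_succ_iff_lt_or_eq.1 (Nat.lt_succ_of_le hj') with hj' | rfl
        · exact h' j' hj'
        · exact h
    · intro s₂ hF₂ h₂
      simp only [State.setReg, Function.update_apply]
      norm_num
      rw [h₂]
      refine ⟨fun h' i' hi' => ?_, fun h' => ⟨fun i' hi' => h' i' (by omega), h' i le_rfl⟩⟩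
      rcases Nat.lt_succ_iff_lt_or_eq.1 (Nat.lt_succ_of_le hi') with hi' | rfl
      · exact h'.1 i' hi'
      · exact h'.2
  · exact fun s' _ h => h

end RAM

/-- `q 0, …, q (m - 1)` is an umbrella ordering of a union of connected components. -/
structure IsPartialOrdering (n : ℕ) (a : ℕ → ℕ → ℕ) (q : ℕ → ℕ) (m : ℕ) : Prop where
  lt : ∀ i < m, q i < n
  inj : ∀ i j, i < m → j < m → q i = q j → i = j
  umbrella : IsUmbrellaSeq a q m
  closed : IsClosedSeq n a q m

/-- Some umbrella ordering of the whole graph starts with `q 0, …, q (m - 1), x`. -/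
def IsExtendable (n : ℕ) (a : ℕ → ℕ → ℕ) (q : ℕ → ℕ) (m x : ℕ) : Prop :=
  ∃ κ, IsUmbrella n a κ ∧ IsInitial n κ (Function.update q m x) (m + 1)

theorem le_of_injOn_lt {n m : ℕ} {q : ℕ → ℕ} (hlt : ∀ i < m, q i < n)
    (hinj : ∀ i j, i < m → j < m → q i = q j → i = j) : m ≤ n := by
  have := Finset.card_le_card_of_injOn (s := Finset.range m) (t := Finset.range n) q
    (fun i hi => by simpa using hlt i (by simpa using hi))
    (fun i hi j hj h => hinj i j (by simpa using hi) (by simpa using hj) h)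
  simpa using this

namespace RAM

/-- Invariant of the greedy sweep from `x`, where `q 0, …, q (m - 1)` was the ordering before. -/
structure SweepInv (n : ℕ) (a : ℕ → ℕ → ℕ) (q : ℕ → ℕ) (m x : ℕ) (s : State) : Prop where
  le : m + 1 ≤ s.reg 5
  lt : ∀ i < s.reg 5, s.arr 2 i < n
  inj : ∀ i j, i < s.reg 5 → j < s.reg 5 → s.arr 2 i = s.arr 2 j → i = j
  agree : ∀ i < m, s.arr 2 i = q i
  start : s.arr 2 m = x
  marked : ∀ i < s.reg 5, s.arr 3 (s.arr 2 i) = 1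
  unmarked : ∀ v < n, (∀ i < s.reg 5, s.arr 2 i ≠ v) → s.arr 3 v = 0
  count_le : ∀ v < n, s.arr 4 v ≤ s.reg 5
  count : ∀ v < n, (∀ i < s.reg 5, s.arr 2 i ≠ v) →
    s.arr 4 v = ∑ i ∈ Finset.range (s.reg 5), a (s.arr 2 i) v
  good : IsExtendable n a q m x → ∃ κ, IsUmbrella n a κ ∧ IsInitial n κ (s.arr 2) (s.reg 5)

theorem SweepInv.congr {n : ℕ} {a : ℕ → ℕ → ℕ} {q : ℕ → ℕ} {m x : ℕ} {s s' : State}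
    (h : SweepInv n a q m x s) (h5 : s'.reg 5 = s.reg 5) (h2 : s'.arr 2 = s.arr 2)
    (h3 : s'.arr 3 = s.arr 3) (h4 : s'.arr 4 = s.arr 4) : SweepInv n a q m x s' := by
  obtain ⟨_, _, _, _, _, _, _, _, _, _⟩ := h
  constructor <;> (try rw [h5]) <;> (try rw [h2]) <;> (try rw [h3]) <;> (try rw [h4]) <;> assumption

theorem SweepInv.le_n {n : ℕ} {a : ℕ → ℕ → ℕ} {q : ℕ → ℕ} {m x : ℕ} {s : State}
    (h : SweepInv n a q m x s) : s.reg 5 ≤ n :=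
  le_of_injOn_lt h.lt h.inj

theorem lt_of_injOn_ne {n m w : ℕ} {q : ℕ → ℕ} (hlt : ∀ i < m, q i < n)
    (hinj : ∀ i j, i < m → j < m → q i = q j → i = j) (hw : w < n) (hwq : ∀ i < m, q i ≠ w) :
    m < n := by
  refine le_of_injOn_lt (m := m + 1) (q := Function.update q m w) (fun i hi => ?_)
    fun i j hi hj h => ?_
  · simp only [Function.update_apply]; grind
  · simp only [Function.update_apply] at h; grind

/-- Placing the unmarked vertex `w` updates the arrays correctly. -/
theorem sweep_update {n len w : ℕ} {a : ℕ → ℕ → ℕ} {s s' : State} (ha : IsAdjMatrix n a)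
    (hlt : ∀ i < len, s.arr 2 i < n)
    (hinj : ∀ i j, i < len → j < len → s.arr 2 i = s.arr 2 j → i = j)
    (hmark : ∀ i < len, s.arr 3 (s.arr 2 i) = 1)
    (hunmark : ∀ v < n, (∀ i < len, s.arr 2 i ≠ v) → s.arr 3 v = 0)
    (hle : ∀ v < n, s.arr 4 v ≤ len)
    (hcount : ∀ v < n, (∀ i < len, s.arr 2 i ≠ v) →
      s.arr 4 v = ∑ i ∈ Finset.range len, a (s.arr 2 i) v)
    (hw : w < n) (hwq : ∀ i < len, s.arr 2 i ≠ w)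
    (h2 : s'.arr 2 = Function.update (s.arr 2) len w)
    (h3 : s'.arr 3 = Function.update (s.arr 3) w 1)
    (h4 : ∀ v < n, s'.arr 4 v = s.arr 4 v + a w v) :
    (∀ i < len + 1, s'.arr 2 i < n) ∧
    (∀ i j, i < len + 1 → j < len + 1 → s'.arr 2 i = s'.arr 2 j → i = j) ∧
    (∀ i < len + 1, s'.arr 3 (s'.arr 2 i) = 1) ∧
    (∀ v < n, (∀ i < len + 1, s'.arr 2 i ≠ v) → s'.arr 3 v = 0) ∧
    (∀ v < n, s'.arr 4 v ≤ len + 1) ∧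
    (∀ v < n, (∀ i < len + 1, s'.arr 2 i ≠ v) →
      s'.arr 4 v = ∑ i ∈ Finset.range (len + 1), a (s'.arr 2 i) v) := by
  have hu : ∀ i < len, s'.arr 2 i = s.arr 2 i := fun i hi => by
    rw [h2, Function.update_of_ne hi.ne]
  have hl : s'.arr 2 len = w := by rw [h2, Function.update_self]
  have hcases : ∀ i < len + 1, i < len ∨ i = len := fun i hi => by omega
  refine ⟨fun i hi => ?_, fun i j hi hj h => ?_, fun i hi => ?_, fun v hv h => ?_,
    fun v hv => ?_, fun v hv h => ?_⟩
  · rcases hcases i hi with hi | rfl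
    · rw [hu i hi]; exact hlt i hi
    · rwa [hl]
  · rcases hcases i hi with hi | rfl <;> rcases hcases j hj with hj | rfl
    · rw [hu i hi, hu j hj] at h; exact hinj i j hi hj h
    · rw [hu i hi, hl] at h; exact absurd h (hwq i hi)
    · rw [hu j hj, hl] at h; exact absurd h.symm (hwq j hj)
    · rfl
  · rw [h3, Function.update_apply]
    split_ifs with h
    · rfl
    · rcases hcases i hi with hi | rfl
      · rw [hu i hi]; exact hmark i hi
      · exact absurd hl h
  · have hvw : v ≠ w := by have := h len (by omega); rw [hl] at this; exact this.symm
    rw [h3, Function.update_of_ne hvw]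
    exact hunmark v hv fun i hi => by rw [← hu i hi]; exact h i (by omega)
  · rw [h4 v hv]
    exact add_le_add (hle v hv) (ha.le_one w v)
  · rw [h4 v hv, Finset.sum_range_succ, hl,
      hcount v hv fun i hi => by rw [← hu i hi]; exact h i (by omega)]
    congr 1
    exact Finset.sum_congr rfl fun i hi => by rw [hu i (Finset.mem_range.1 hi)]

/-- One step of the greedy sweep. -/
def sweepStep : Prog :=
  .seq selectProg (.ite (.le (.add (.reg 0) (.lit 1)) (keyE (.reg 9))) placeProg .skip)

/-- A key of at least `n + 1` means an unmarked vertex with a placed neighbour, so a step either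
adds a vertex or certifies that the placed set is closed. The parameter `d` counts the added
vertices; since the length cannot exceed `n`, `n` steps reach a closed set. -/
theorem sweepStep_spec {W n : ℕ} {a : ℕ → ℕ → ℕ} {q : ℕ → ℕ} {m x d : ℕ} {s : State}
    (ha : IsAdjMatrix n a) (hn : 1 ≤ n) (hW : n + 1 ≤ W) (hs : HasAdj n a s)
    (hdeg : ∀ v < n, s.arr 5 v = ∑ y ∈ Finset.range n, a v y)
    (hI : SweepInv n a q m x s)
    (hd : IsClosedSeq n a (s.arr 2) (s.reg 5) ∨ d ≤ s.reg 5) :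
    Runs W sweepStep s (n + 1) fun s' => SweepInv n a q m x s' ∧
      (IsClosedSeq n a (s'.arr 2) (s'.reg 5) ∨ d + 1 ≤ s'.reg 5) := by
  refine .seq ((selectProg_spec hn (by omega) hs.reg).mono le_rfl fun s₁ hF₁ ⟨hw, hmax⟩ => ?_)
  have hs₁ := hs.congr (hF₁.reg 0 rfl) (hF₁.arr 0 rfl)
  have hI₁ : SweepInv n a q m x s₁ :=
    hI.congr (hF₁.reg 5 rfl) (hF₁.arr 2 rfl) (hF₁.arr 3 rfl) (hF₁.arr 4 rfl)
  have h5₁ : s₁.arr 5 = s.arr 5 := hF₁.arr 5 rfl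
  have hk : ∀ v, sweepKey n s₁ v = sweepKey n s v := fun v => by
    simp only [sweepKey, hF₁.arr 3 rfl, hF₁.arr 4 rfl, h5₁]
  rw [← hF₁.reg 5 rfl, ← hF₁.arr 2 rfl] at hd
  simp only [← hk] at hmax
  rw [← h5₁] at hdeg
  clear hI hk
  set w := s₁.reg 9 with hwdef
  set len := s₁.reg 5 with hlen
  have hkey : ∀ v < n, (∀ i < len, s₁.arr 2 i ≠ v) → sweepKey n s₁ v =
      (∑ i ∈ Finset.range len, a (s₁.arr 2 i) v) * (n + 1) +
        (n - ∑ y ∈ Finset.range n, a v y) := fun v hv h => by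
    rw [sweepKey, hI₁.unmarked v hv h, hI₁.count v hv h, hdeg v hv, Nat.sub_zero, one_mul]
  have hb : (Test.le (.add (.reg 0) (.lit 1)) (keyE (.reg 9))).Holds s₁ ↔
      n + 1 ≤ sweepKey n s₁ w := by
    simp only [Test.Holds, keyE_eval hs₁.reg, IExpr.eval, hs₁.reg, ← hwdef]
  refine .ite (by omega) (fun h => ?_) (fun h => .skip (by omega) ⟨hI₁, .inl ?_⟩)
  · rw [hb] at h
    have hwq : ∀ i < len, s₁.arr 2 i ≠ w := by
      intro i hi heq
      have h3 := hI₁.marked i hi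
      rw [sweepKey, ← heq, h3] at h
      simp at h
    rw [hkey w hw hwq] at h
    have hpos : ∑ i ∈ Finset.range len, a (s₁.arr 2 i) w ≠ 0 := fun h0 => by
      rw [h0] at h; omega
    have hlenn : len < n := lt_of_injOn_ne hI₁.lt hI₁.inj hw hwq
    have hd' : d ≤ len := by
      rcases hd with hd | hd
      · obtain ⟨i, hi, hne⟩ := Finset.exists_ne_zero_of_sum_ne_zero hpos
        have hi := Finset.mem_range.1 hi
        obtain ⟨j, hj, h⟩ := hd i hi w hw (by have := ha.le_one (s₁.arr 2 i) w; omega)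
        exact absurd h (hwq j hj)
      · exact hd
    refine (placeProg_spec ha hW hs₁ hlen.symm hwdef.symm hlenn hw hI₁.count_le).mono le_rfl
      fun s₂ hF₂ ⟨h5, h2, h3, h4⟩ => ⟨?_, .inr (by omega)⟩
    obtain ⟨c1, c2, c3, c4, c5, c6⟩ := sweep_update ha hI₁.lt hI₁.inj hI₁.marked hI₁.unmarked
      hI₁.count_le hI₁.count hw hwq h2 h3 h4
    have hle := hI₁.le
    refine ⟨?_, ?_, ?_, fun i hi => ?_, ?_, ?_, ?_, ?_, ?_, fun hg => ?_⟩
    · omega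
    all_goals try rw [h5]
    all_goals try assumption
    · rw [h2, Function.update_of_ne (by omega)]; exact hI₁.agree i hi
    · rw [h2, Function.update_of_ne (by omega)]; exact hI₁.start
    · obtain ⟨κ, hκ, hq⟩ := hI₁.good hg
      rw [h2]
      refine exists_isUmbrella_extend ha hκ hq hI₁.lt hw hwq hpos fun v hv hvq => ?_
      rw [← hkey v hv hvq, ← hkey w hw hwq]
      exact hmax v hv
  · rw [hb] at h
    intro i hi y hy hiy
    by_contra hcon
    push Not at hcon
    have h1 := hmax y hy
    rw [hkey y hy hcon] at h1
    have h2 : 1 ≤ ∑ i ∈ Finset.range len, a (s₁.arr 2 i) y := by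
      rw [← hiy]
      exact Finset.single_le_sum (f := fun i => a (s₁.arr 2 i) y) (fun _ _ => Nat.zero_le _)
        (Finset.mem_range.2 hi)
    have h3 := Nat.mul_le_mul_right (n + 1) h2
    omega

/-- Tries to extend the ordering by the component of vertex `reg 6`, starting from it. -/
def orderStep : Prog :=
  .seq (.for 7 0 (.seq (.setArr 4 (.reg 7) (.lit 0)) (.setArr 3 (.reg 7) (.lit 0))))
    (.seq (.for 7 4 (.setArr 3 (.get 2 (.reg 7)) (.lit 1)))
      (.ite (.eq (.get 3 (.reg 6)) (.lit 0))
        (.seq (.setReg 9 (.reg 6)) (.seq (.setReg 5 (.reg 4)) (.seq placeProg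
          (.seq (.for 8 0 sweepStep)
            (.seq checkProg (.ite (.eq (.reg 10) (.lit 1)) (.setReg 4 (.reg 5)) .skip))))))
        .skip))

/-- Acceptance relies only on the final check. Rejection proves that `x` was a wrong start: from a
right one the sweep follows some umbrella ordering of the whole graph, and the check would have
succeeded. A failed sweep leaves the accepted prefix intact, as it writes only behind it. -/
theorem orderStep_spec {W n : ℕ} {a : ℕ → ℕ → ℕ} {m x : ℕ} {s : State}
    (ha : IsAdjMatrix n a) (hn : 1 ≤ n) (hW : n + 1 ≤ W) (hs : HasAdj n a s)
    (hdeg : ∀ v < n, s.arr 5 v = ∑ y ∈ Finset.range n, a v y)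
    (hm : s.reg 4 = m) (hx : s.reg 6 = x) (hxn : x < n)
    (hI : IsPartialOrdering n a (s.arr 2) m) :
    Runs W orderStep s ((n + 1) ^ 2) fun s' => m ≤ s'.reg 4 ∧
      (∀ i < m, s'.arr 2 i = s.arr 2 i) ∧ IsPartialOrdering n a (s'.arr 2) (s'.reg 4) ∧
      ((∃ i < s'.reg 4, s'.arr 2 i = x) ∨ ¬ IsExtendable n a (s.arr 2) m x) := by
  have hn1 : n + 1 ≤ (n + 1) ^ 2 := by rw [pow_two]; exact Nat.le_mul_self _
  have hmn : m ≤ n := le_of_injOn_lt hI.lt hI.inj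
  refine .seq (Runs.for_of (K := 1) (m := n)
    (fun j s' => ∀ v < j, s'.arr 4 v = 0 ∧ s'.arr 3 v = 0)
    le_rfl (by omega) hs.reg (by omega) rfl rfl (by simp) ?_ fun s₁ hF₁ h₁ => ?_)
  · intro j s₁ hj hrj hF h₁
    refine .seq (.setArr le_rfl ?_ (Nat.zero_le _) (.setArr le_rfl ?_ (Nat.zero_le _) ?_))
    · simp [IExpr.eval, hrj]; omega
    · simp [IExpr.eval, hrj, State.setArr]; omega
    · intro v hv
      have := h₁ v
      simp only [State.setReg, State.setArr, IExpr.eval, hrj, Function.update_apply]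
      norm_num
      grind
  refine .seq (Runs.for_of (K := 1) (m := m)
    (fun j s' => s'.arr 3 = fun v => if ∃ i < j, s.arr 2 i = v then 1 else s₁.arr 3 v)
    le_rfl (by omega) ((hF₁.reg 4 rfl).trans hm) (by omega) rfl rfl (by simp [State.setReg])
    ?_ fun s₂ hF₂ h₂ => ?_)
  · intro j s₂ hj hrj hF h₂
    have e2 : s₂.arr 2 = s.arr 2 := (hF.arr 2 rfl).trans (hF₁.arr 2 rfl)
    refine .setArr le_rfl ?_ (by simp [IExpr.eval]; omega) ?_
    · have := hI.lt j hj
      simp [IExpr.eval, hrj, e2]; omega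
    · funext v
      simp only [State.setReg, State.setArr, IExpr.eval, hrj, Function.update_apply, e2, h₂]
      have hj1 : (∃ i < j + 1, s.arr 2 i = v) ↔ (∃ i < j, s.arr 2 i = v) ∨ s.arr 2 j = v := by
        simp only [Nat.lt_succ_iff_lt_or_eq, or_and_right, exists_or, exists_eq_left]
      simp only [hj1, if_true, Function.update_apply]
      grind
  have e2 : s₂.arr 2 = s.arr 2 := (hF₂.arr 2 rfl).trans (hF₁.arr 2 rfl)
  have e4 : s₂.reg 4 = m := ((hF₂.reg 4 rfl).trans (hF₁.reg 4 rfl)).trans hm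
  have e6 : s₂.reg 6 = x := ((hF₂.reg 6 rfl).trans (hF₁.reg 6 rfl)).trans hx
  have e5 : s₂.arr 5 = s.arr 5 := (hF₂.arr 5 rfl).trans (hF₁.arr 5 rfl)
  have ec : s₂.arr 4 = s₁.arr 4 := hF₂.arr 4 rfl
  have hs₂ := (hs.congr (hF₁.reg 0 rfl) (hF₁.arr 0 rfl)).congr (hF₂.reg 0 rfl) (hF₂.arr 0 rfl)
  have hmark : ∀ v < n, s₂.arr 3 v = if ∃ i < m, s.arr 2 i = v then 1 else 0 := fun v hv => by
    simp only [h₂, (h₁ v hv).2]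
  have hb : (Test.eq (.get 3 (.reg 6)) (.lit 0)).Holds s₂ ↔ ∀ i < m, s.arr 2 i ≠ x := by
    simp only [Test.Holds, IExpr.eval, e6, hmark x hxn]
    simp
  refine .ite (by omega) (fun h => ?_) (fun h => .skip (by omega) ?_)
  swap
  · rw [hb] at h
    push Not at h
    rw [e2, e4]
    exact ⟨le_rfl, fun _ _ => rfl, hI, .inl h⟩
  rw [hb] at h
  have hmn' : m < n := lt_of_injOn_ne hI.lt hI.inj hxn h
  refine .seq (.setReg (by omega) (by simp [IExpr.eval, e6]; omega) ?_)
  refine .seq (.setReg (by omega) (by simp [IExpr.eval, e4, State.setReg]; omega) ?_)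
  set s₃ := (s₂.setReg 9 ((IExpr.reg 6).eval s₂)).setReg 5
    ((IExpr.reg 4).eval (s₂.setReg 9 ((IExpr.reg 6).eval s₂))) with hs₃def
  have f5 : s₃.reg 5 = m := by simp [s₃, State.setReg, IExpr.eval, e4]
  have f9 : s₃.reg 9 = x := by simp [s₃, State.setReg, IExpr.eval, e6]
  have f4 : s₃.reg 4 = m := by simp [s₃, State.setReg, e4]
  have fa : s₃.arr = s₂.arr := rfl
  have hs₃ : HasAdj n a s₃ := hs₂.congr (by simp [s₃, State.setReg]) rfl
  clear_value s₃
  have hcnt0 : ∀ v < n, s₃.arr 4 v = 0 := fun v hv => by rw [fa, ec]; exact (h₁ v hv).1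
  refine .seq ((placeProg_spec ha hW hs₃ f5 f9 hmn' hxn
    (fun v hv => by rw [hcnt0 v hv]; omega)).mono hn1 fun s₄ hF₄ ⟨h5, h2, h3, h4⟩ => ?_)
  have hs₄ := hs₃.congr (hF₄.reg 0 rfl) (hF₄.arr 0 rfl)
  have h2' : s₄.arr 2 = Function.update (s.arr 2) m x := by rw [h2, fa, e2]
  have hI₄ : SweepInv n a (s.arr 2) m x s₄ := by
    have e2' : s₃.arr 2 = s.arr 2 := by rw [fa, e2]
    obtain ⟨c1, c2, c3, c4, c5, c6⟩ := sweep_update (s := s₃) (s' := s₄) (len := m) (w := x) ha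
      (by rw [e2']; exact hI.lt) (by rw [e2']; exact hI.inj)
      (fun i hi => by
        rw [e2', fa, hmark _ (hI.lt i hi), if_pos ⟨i, hi, rfl⟩])
      (fun v hv hvq => by
        rw [e2'] at hvq
        rw [fa, hmark v hv, if_neg]
        rintro ⟨i, hi, h⟩
        exact hvq i hi h)
      (fun v hv => by rw [hcnt0 v hv]; omega)
      (fun v hv hvq => by
        rw [hcnt0 v hv, eq_comm, Finset.sum_eq_zero_iff]
        intro i hi
        by_contra hne
        rw [e2'] at hvq hne
        obtain ⟨j, hj, h⟩ := hI.closed i (Finset.mem_range.1 hi) v hv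
          (by have := ha.le_one (s.arr 2 i) v; omega)
        exact hvq j hj h)
      hxn (by rw [e2']; exact h) h2 h3 h4
    refine ⟨h5.ge, ?_, ?_, fun i hi => ?_, ?_, ?_, ?_, ?_, ?_, fun hg => ?_⟩
    all_goals try rw [h5]
    all_goals try assumption
    · rw [h2', Function.update_of_ne hi.ne]
    · rw [h2', Function.update_self]
    · rw [h2']; exact hg
  have hdeg₄ : ∀ v < n, s₄.arr 5 v = ∑ y ∈ Finset.range n, a v y := fun v hv => by
    rw [hF₄.arr 5 rfl, fa, e5, hdeg v hv]
  refine .seq (Runs.for_of (K := n + 1) (m := n)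
    (fun j s' => SweepInv n a (s.arr 2) m x s' ∧
      (IsClosedSeq n a (s'.arr 2) (s'.reg 5) ∨ m + 1 + j ≤ s'.reg 5))
    (by omega) (by rw [pow_two]) hs₄.reg (by omega) rfl rfl ?_ ?_ fun s₅ hF₅ ⟨hI₅, hc₅⟩ => ?_)
  · exact ⟨hI₄.congr (by simp [State.setReg]) rfl rfl rfl, .inr (by simp [State.setReg, h5])⟩
  · intro j s₅ hj hrj hF₅ ⟨hI₅, hd⟩
    refine (sweepStep_spec ha hn hW (hs₄.congr (hF₅.reg 0 rfl) (hF₅.arr 0 rfl))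
      (by rw [hF₅.arr 5 rfl]; exact hdeg₄) hI₅ hd).mono le_rfl fun s₆ hF₆ ⟨hI₆, hd₆⟩ => ?_
    exact ⟨hI₆.congr (by simp [State.setReg]) rfl rfl rfl, by
      simpa [State.setReg, ← add_assoc] using hd₆⟩
  have hs₅ := hs₄.congr (hF₅.reg 0 rfl) (hF₅.arr 0 rfl)
  have hle₅ := hI₅.le_n
  -- The alternative would be a length of at least `m + 1 + n`, more than the number of vertices.
  have hc₅' : IsClosedSeq n a (s₅.arr 2) (s₅.reg 5) := by
    rcases hc₅ with h | h
    · exact h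
    · omega
  have g4 : s₅.reg 4 = m := (hF₅.reg 4 rfl).trans ((hF₄.reg 4 rfl).trans f4)
  refine .seq ((checkProg_spec hW hs₅ rfl hle₅ hI₅.lt).mono le_rfl fun s₆ hF₆ h₆ => ?_)
  have k2 : s₆.arr 2 = s₅.arr 2 := hF₆.arr 2 rfl
  have k5 : s₆.reg 5 = s₅.reg 5 := hF₆.reg 5 rfl
  refine .ite (by omega) (fun h => .setReg (by omega) ?_ ?_) (fun h => .skip (by omega) ?_)
  · simp [IExpr.eval, k5]; omega
  · simp only [Test.Holds, IExpr.eval, h₆] at h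
    have hle := hI₅.le
    simp only [IExpr.eval, State.setReg, Function.update_self, k2, k5]
    refine ⟨by omega, hI₅.agree, ⟨hI₅.lt, hI₅.inj, isUmbrellaSeq_of_local fun i j hij hj =>
      h i (by omega) j hj hij, hc₅'⟩, .inl ⟨m, by omega, hI₅.start⟩⟩
  · simp only [Test.Holds, IExpr.eval, h₆] at h
    have l4 : s₆.reg 4 = m := (hF₆.reg 4 rfl).trans g4
    rw [l4, k2]
    have hag := hI₅.agree
    refine ⟨le_rfl, hag, ⟨?_, ?_, ?_, ?_⟩, .inr fun hg => h ?_⟩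
    · intro i hi; rw [hag i hi]; exact hI.lt i hi
    · intro i j hi hj; rw [hag i hi, hag j hj]; exact hI.inj i j hi hj
    · intro i j l hij hjl hl
      rw [hag i (by omega), hag j (by omega), hag l hl]
      exact hI.umbrella i j l hij hjl hl
    · intro i hi y hy
      rw [hag i hi]
      intro h
      obtain ⟨j, hj, hjy⟩ := hI.closed i hi y hy h
      exact ⟨j, hj, by rw [hag j hj, hjy]⟩
    · obtain ⟨κ, hκ, hq⟩ := hI₅.good hg
      have hU := hκ.isUmbrellaSeq hq hI₅.lt
      intro i hi j hj hij h
      constructor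
      · exact (hU i (j - 1) j (by omega) (by omega) hj h).1
      · exact (hU i (i + 1) j (by omega) (by omega) hj h).2

/-- Stores an umbrella ordering in integer array `2` (and its length `n` in register `4`). -/
def orderProg : Prog := .seq degProg (.for 6 0 orderStep)

/-- One pass over the candidates suffices. The invariant remembers, for each candidate not placed, a
closed prefix at which it was not extendable. -/
theorem orderProg_spec {W n : ℕ} {a : ℕ → ℕ → ℕ} {s : State} {κ : ℕ → ℕ}
    (ha : IsAdjMatrix n a) (hn : 1 ≤ n) (hW : n + 1 ≤ W) (hs : HasAdj n a s)
    (h5 : ∀ v, s.arr 5 v = 0) (h4 : s.reg 4 = 0) (hκ : IsUmbrella n a κ) :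
    Runs W orderProg s ((n + 1) ^ 3) fun s' => (∀ i < n, s'.arr 2 i < n) ∧
      (∀ i j, i < n → j < n → s'.arr 2 i = s'.arr 2 j → i = j) ∧
      IsUmbrellaSeq a (s'.arr 2) n := by
  have hn1 : 1 ≤ (n + 1) ^ 2 := Nat.one_le_pow _ _ (by omega)
  refine .seq ((degProg_spec ha (by omega) hs h5).mono
    (Nat.pow_le_pow_right (by omega) (by omega)) fun s₁ hF₁ hdeg => ?_)
  have hs₁ := hs.congr (hF₁.reg 0 rfl) (hF₁.arr 0 rfl)
  have h4₁ : s₁.reg 4 = 0 := (hF₁.reg 4 rfl).trans h4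
  refine Runs.for_of (K := (n + 1) ^ 2) (m := n)
    (fun j s' => IsPartialOrdering n a (s'.arr 2) (s'.reg 4) ∧ ∀ x < j,
      (∃ i < s'.reg 4, s'.arr 2 i = x) ∨ ∃ m₀ ≤ s'.reg 4,
        IsClosedSeq n a (s'.arr 2) m₀ ∧ ¬ IsExtendable n a (s'.arr 2) m₀ x)
    hn1 (by rw [pow_succ' _ 2]) hs₁.reg (by omega) rfl rfl ?_ ?_ ?_
  · have : (s₁.setReg 6 0).reg 4 = 0 := by simp [State.setReg, h4₁]
    rw [this]
    exact ⟨⟨by simp, by simp, fun _ _ _ _ _ h => by simp at h, fun _ h => by simp at h⟩, by simp⟩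
  · intro x s₂ hx hrx hF₂ ⟨hI, hx₂⟩
    refine (orderStep_spec ha hn hW (hs₁.congr (hF₂.reg 0 rfl) (hF₂.arr 0 rfl))
      (by rw [hF₂.arr 5 rfl]; exact hdeg) rfl hrx hx hI).mono le_rfl
      fun s₃ hF₃ ⟨hm, hag, hI₃, h₃⟩ => ?_
    have e4 : (s₃.setReg 6 (x + 1)).reg 4 = s₃.reg 4 := by simp [State.setReg]
    have e2 : (s₃.setReg 6 (x + 1)).arr 2 = s₃.arr 2 := rfl
    rw [e4, e2]
    have hcl : ∀ m₀ ≤ s₂.reg 4, IsClosedSeq n a (s₂.arr 2) m₀ →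
        IsClosedSeq n a (s₃.arr 2) m₀ := by
      intro m₀ hm₀ hc i hi y hy h
      rw [hag i (by omega)] at h
      obtain ⟨j, hj, h'⟩ := hc i hi y hy h
      exact ⟨j, hj, by rw [hag j (by omega), h']⟩
    have hext : ∀ m₀ ≤ s₂.reg 4, ∀ y, IsExtendable n a (s₃.arr 2) m₀ y →
        IsExtendable n a (s₂.arr 2) m₀ y := by
      rintro m₀ hm₀ y ⟨κ', hκ', hi1, hi2⟩
      have hu : ∀ i < m₀ + 1, Function.update (s₃.arr 2) m₀ y i =
          Function.update (s₂.arr 2) m₀ y i := by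
        intro i hi
        simp only [Function.update_apply]
        split_ifs with h
        · rfl
        · exact hag i (by omega)
      refine ⟨κ', hκ', fun i j hij hj => ?_, fun i hi z hz hzq => ?_⟩
      · rw [← hu i (by omega), ← hu j hj]; exact hi1 i j hij hj
      · rw [← hu i hi]
        exact hi2 i hi z hz fun j hj => by rw [hu j hj]; exact hzq j hj
    refine ⟨hI₃, fun y hy => ?_⟩
    rcases Nat.lt_succ_iff_lt_or_eq.1 hy with hy | rfl
    · rcases hx₂ y hy with ⟨i, hi, h⟩ | ⟨m₀, hm₀, hc, hne⟩
      · exact .inl ⟨i, by omega, by rw [hag i hi, h]⟩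
      · exact .inr ⟨m₀, by omega, hcl m₀ hm₀ hc, fun h => hne (hext m₀ hm₀ y h)⟩
    · rcases h₃ with h | h
      · exact .inl h
      · exact .inr ⟨s₂.reg 4, hm, hcl _ le_rfl hI.closed, fun h' => h (hext _ le_rfl y h')⟩
  · intro s' hF ⟨hI, h⟩
    have hmn : s'.reg 4 ≤ n := le_of_injOn_lt hI.lt hI.inj
    suffices hm : s'.reg 4 = n by
      rw [hm] at hI
      exact ⟨hI.lt, hI.inj, hI.umbrella⟩
    by_contra hne
    obtain ⟨x, hx, hxq⟩ : ∃ x < n, ∀ i < s'.reg 4, s'.arr 2 i ≠ x := by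
      by_contra hcon
      push Not at hcon
      choose! f hf using hcon
      exact hne (le_antisymm hmn (le_of_injOn_lt (q := f) (fun i hi => (hf i hi).1)
        fun i j hi hj hij => by rw [← (hf i hi).2, ← (hf j hj).2, hij]))
    -- If a vertex were missing, some missing `y` would be extendable at every closed prefix,
    -- including the one at which it was rejected.
    obtain ⟨y, hy, hyq, hgood⟩ := exists_isInitial_of_ne ha hκ hI.inj hI.umbrella hI.closed hx hxq
    rcases h y hy with ⟨i, hi, h⟩ | ⟨m₀, hm₀, hc, hne⟩
    · exact hyq i hi h
    · exact hne (hgood m₀ hm₀ hc)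

end RAM

/-! ### Feasibility as a condition on windows of 2k chosen positions -/

/-- `R` is the adjacency matrix of a graph on `{1, …, n}` whose closed neighbourhoods are
intervals. -/
structure IsUmbrellaMatrix (n : ℕ) (R : ℕ → ℕ → ℕ) : Prop where
  le_one : ∀ x y, R x y ≤ 1
  symm : ∀ x y, R x y = R y x
  mem : ∀ x y, R x y = 1 → 1 ≤ x ∧ x ≤ n
  umbrella : ∀ x y z, x < y → y < z → R x z = 1 → R x y = 1 ∧ R y z = 1

/-- `U ⊆ {1, …, n}` is `k`-dominating, or total `k`-dominating if `tot = true`. -/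
def IsFeasible (n k : ℕ) (tot : Bool) (R : ℕ → ℕ → ℕ) (U : Finset ℕ) : Prop :=
  (∀ u ∈ U, 1 ≤ u ∧ u ≤ n) ∧
    ∀ v, 1 ≤ v → v ≤ n → (v ∉ U ∨ tot = true) → k ≤ ∑ u ∈ U, R v u

/-- `e` lists `2 * k` zeros and then, increasingly, the members of `U` and further numbers,
all greater than `n`. -/
structure IsListing (n k l : ℕ) (U : Finset ℕ) (e : ℕ → ℕ) : Prop where
  zero : ∀ i < 2 * k, e i = 0
  lt : ∀ i j, i < j → 2 * k ≤ j → j < 2 * k + l → e i < e j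
  mem : ∀ u, u ∈ U ↔ u ≤ n ∧ ∃ i, 2 * k ≤ i ∧ i < 2 * k + l ∧ e i = u

/-- A window may contain `0` several times, but neither `0` nor a number above `n` is adjacent to
anything. The nonzero terms therefore come from distinct members of `U`. -/
theorem IsListing.window_le {n k l : ℕ} {U : Finset ℕ} {e : ℕ → ℕ} {R : ℕ → ℕ → ℕ}
    (hR : IsUmbrellaMatrix n R) (he : IsListing n k l U e) {j m : ℕ} (hj : j + m ≤ 2 * k + l)
    (x : ℕ) : ∑ i ∈ Finset.range m, R x (e (j + i)) ≤ ∑ u ∈ U, R x u := by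
  classical
  have hpos : ∀ y, R x y ≠ 0 → 1 ≤ y ∧ y ≤ n := fun y hy =>
    hR.mem y x (by have := hR.le_one y x; rw [hR.symm] at hy; omega)
  have hge : ∀ i, R x (e (j + i)) ≠ 0 → 2 * k ≤ j + i := fun i hi => by
    by_contra h
    have := he.zero (j + i) (by omega)
    have := hpos _ hi
    omega
  rw [← Finset.sum_filter_ne_zero, ← Finset.sum_image (f := fun y => R x y) (g := fun i => e (j + i))]
  · refine Finset.sum_le_sum_of_subset fun y hy => ?_
    simp only [Finset.mem_image, Finset.mem_filter, Finset.mem_range] at hy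
    obtain ⟨i, ⟨hi, hne⟩, rfl⟩ := hy
    exact (he.mem _).2 ⟨(hpos _ hne).2, j + i, hge i hne, by omega, rfl⟩
  · intro i hi i' hi' h
    simp only [Finset.coe_filter, Finset.mem_range, Set.mem_ofPred_eq] at hi hi'
    have h1 := hge i hi.2
    have h2 := hge i' hi'.2
    simp only at h
    rcases lt_trichotomy i i' with h3 | h3 | h3
    · have := he.lt (j + i) (j + i') (by omega) h2 (by omega)
      omega
    · exact h3
    · have := he.lt (j + i') (j + i) (by omega) h1 (by omega)
      omega

/-- If `x` has at least `k` neighbours in `U`, then it has at least `k` of them among the `k`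
predecessors of `x` in `U`, possibly `x` itself, and the `k` successors. -/
theorem IsListing.le_window {n k l : ℕ} {U : Finset ℕ} {e : ℕ → ℕ} {R : ℕ → ℕ → ℕ}
    (hR : IsUmbrellaMatrix n R) (he : IsListing n k l U e) (hk : 1 ≤ k) {j δ x : ℕ}
    (hj : j + (2 * k + δ) ≤ 2 * k + l) (hl : ∀ i < k, e (j + i) < x)
    (hr : ∀ i < k, x < e (j + (k + δ + i))) (hx : k ≤ ∑ u ∈ U, R x u) :
    k ≤ ∑ i ∈ Finset.range (2 * k + δ), R x (e (j + i)) := by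
  classical
  have hmono : ∀ i i', i ≤ i' → i' < 2 * k + l → e i ≤ e i' := fun i i' h h' => by
    rcases h.eq_or_lt with rfl | h
    · rfl
    · by_cases h2 : 2 * k ≤ i'
      · exact (he.lt i i' h h2 h').le
      · rw [he.zero i (by omega)]; omega
  -- If the farthest predecessor is adjacent to `x`, the umbrella property makes all `k`
  -- predecessors adjacent; the second case treats the farthest successor in the same way.
  by_cases h1 : R x (e j) = 1
  · have hsub : Finset.range k ⊆ Finset.range (2 * k + δ) :=
      Finset.range_subset_range.2 (by omega)
    refine le_trans ?_ (Finset.sum_le_sum_of_subset hsub)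
    have : ∀ i ∈ Finset.range k, 1 ≤ R x (e (j + i)) := fun i hi => by
      have hi := Finset.mem_range.1 hi
      rcases (hmono j (j + i) (by omega) (by omega)).eq_or_lt with h | h
      · rw [← h, h1]
      · rw [hR.symm] at h1 ⊢
        exact (hR.umbrella _ _ _ h (hl i hi) h1).2.ge
    simpa using Finset.sum_le_sum this
  by_cases h2 : R x (e (j + (2 * k + δ - 1))) = 1
  · rw [show 2 * k + δ = (k + δ) + k by omega, Finset.sum_range_add]
    refine le_trans ?_ (Nat.le_add_left _ _)
    have : ∀ i ∈ Finset.range k, 1 ≤ R x (e (j + (k + δ + i))) := fun i hi => by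
      have hi := Finset.mem_range.1 hi
      rcases (hmono (j + (k + δ + i)) (j + (2 * k + δ - 1)) (by omega) (by omega)).eq_or_lt
        with h | h
      · rw [h, h2]
      · exact (hR.umbrella _ _ _ (hr i hi) h h2).1.ge
    simpa using Finset.sum_le_sum this
  -- Neither end is adjacent, so no neighbour of `x` in `U` lies outside the window, and the window
  -- sees all of them.
  · refine hx.trans (le_trans ?_ (Finset.sum_image_le_of_nonneg (f := fun y => R x y)
      (g := fun i => e (j + i)) fun _ _ => Nat.zero_le _))
    refine Finset.sum_le_sum_of_ne_zero fun u hu hne => ?_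
    have hxu : R x u = 1 := by have := hR.le_one x u; omega
    obtain ⟨hun, i, hi, hil, rfl⟩ := (he.mem u).1 hu
    rw [Finset.mem_image]
    refine ⟨i - j, Finset.mem_range.2 ?_, ?_⟩
    · by_contra h
      refine h2 (hR.umbrella x (e (j + (2 * k + δ - 1))) (e i) ?_ ?_ hxu).1
      · have := hr (k - 1) (by omega)
        rwa [show k + δ + (k - 1) = 2 * k + δ - 1 by omega] at this
      · exact he.lt _ _ (by omega) hi hil
    · by_cases hij : j ≤ i
      · rw [show j + (i - j) = i by omega]
      · exfalso
        refine h1 ?_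
        have := hl 0 (by omega)
        rw [hR.symm] at hxu ⊢
        exact (hR.umbrella (e i) (e j) x (he.lt _ _ (by omega) (by omega) (by omega)) this hxu).2

/-- The window `d 0, …, d (2 * k - 1)` may be followed by `w`. -/
def IsStep (n k : ℕ) (tot : Bool) (R : ℕ → ℕ → ℕ) (d : ℕ → ℕ) (w : ℕ) : Prop :=
  d 0 ≤ n ∧ w < n + 2 * k + 1 ∧ d (2 * k - 1) < w ∧
    (∀ v, 1 ≤ v → v ≤ n → d (k - 1) < v → v < d k → k ≤ ∑ i ∈ Finset.range (2 * k), R v (d i)) ∧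
    (tot = true → 1 ≤ d k → d k ≤ n →
      k ≤ ∑ i ∈ Finset.range (2 * k), R (d k) (d i) + R (d k) w)

theorem IsStep.congr {n k : ℕ} {tot : Bool} {R : ℕ → ℕ → ℕ} {d d' : ℕ → ℕ} {w : ℕ} (hk : 1 ≤ k)
    (h : ∀ i < 2 * k, d i = d' i) : IsStep n k tot R d w ↔ IsStep n k tot R d' w := by
  have hs : ∀ v, ∑ i ∈ Finset.range (2 * k), R v (d i) = ∑ i ∈ Finset.range (2 * k), R v (d' i) :=
    fun v => Finset.sum_congr rfl fun i hi => by rw [h i (Finset.mem_range.1 hi)]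
  simp only [IsStep, hs, h 0 (by omega), h (2 * k - 1) (by omega), h k (by omega),
    h (k - 1) (by omega)]

/-- A position strictly between two consecutive entries is not in `U`, and its `k` neighbours on
each side in the list form the window (`δ = 0`). The middle member `d k` is the centre of the `2 * k
+ 1` entries formed by the window and `w` (`δ = 1`). -/
theorem IsListing.isStep {n k l : ℕ} {tot : Bool} {U : Finset ℕ} {e : ℕ → ℕ} {R : ℕ → ℕ → ℕ}
    (hR : IsUmbrellaMatrix n R) (he : IsListing n k l U e) (hk : 1 ≤ k)
    (hU : IsFeasible n k tot R U) {j : ℕ} (hj : j < l) (hjn : e j ≤ n)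
    (hB : e (j + 2 * k) < n + 2 * k + 1) :
    IsStep n k tot R (fun i => e (j + i)) (e (j + 2 * k)) := by
  have hmono : ∀ i i', i ≤ i' → i' < 2 * k + l → e i ≤ e i' := fun i i' h h' => by
    rcases h.eq_or_lt with rfl | h
    · rfl
    · by_cases h2 : 2 * k ≤ i'
      · exact (he.lt i i' h h2 h').le
      · rw [he.zero i (by omega)]; omega
  refine ⟨hjn, hB, he.lt _ _ (by omega) (by omega) (by omega), fun v h1 hn hv hv' => ?_,
    fun htot h1 hn => ?_⟩
  · beta_reduce at hv hv'
    refine he.le_window hR hk (δ := 0) (by omega) (fun i hi => ?_) (fun i hi => ?_)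
      (hU.2 v h1 hn (.inl fun hvU => ?_))
    · exact (hmono _ (j + (k - 1)) (by omega) (by omega)).trans_lt hv
    · exact hv'.trans_le (hmono _ _ (by omega) (by omega))
    · obtain ⟨-, i, hi, hil, rfl⟩ := (he.mem v).1 hvU
      rcases Nat.lt_or_ge i (j + k) with h | h
      · have := hmono i (j + (k - 1)) (by omega) (by omega)
        omega
      · have := hmono (j + k) i h (by omega)
        omega
  · beta_reduce at h1 hn ⊢
    have hjk : 2 * k ≤ j + k := by
      by_contra h
      have := he.zero (j + k) (by omega)
      omega
    have := he.le_window hR hk (δ := 1) (j := j) (x := e (j + k)) (by omega)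
      (fun i hi => he.lt _ _ (by omega) hjk (by omega))
      (fun i hi => he.lt _ _ (by omega) (by omega) (by omega))
      (hU.2 _ h1 hn (.inr htot))
    rwa [Finset.sum_range_succ] at this

/-- Conversely, each member of `U` is the middle member of some window, and each other position lies
in the middle gap of some window. The zeros in front and the end condition make these windows
available at both ends of the list. -/
theorem IsListing.isFeasible {n k l : ℕ} {tot : Bool} {U : Finset ℕ} {e : ℕ → ℕ} {R : ℕ → ℕ → ℕ}
    (hR : IsUmbrellaMatrix n R) (he : IsListing n k l U e) (hk : 1 ≤ k)
    (hend : n < e l)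
    (hstep : ∀ j < l, IsStep n k tot R (fun i => e (j + i)) (e (j + 2 * k))) :
    IsFeasible n k tot R U := by
  classical
  have h2k : 2 * k ≤ l := by
    by_contra h
    rw [he.zero l (by omega)] at hend
    omega
  refine ⟨fun u hu => ?_, fun v h1 hn hv => ?_⟩
  · obtain ⟨hn, i, hi, hil, rfl⟩ := (he.mem u).1 hu
    exact ⟨Nat.one_le_of_lt (he.lt 0 i (by omega) hi hil), hn⟩
  by_cases hvU : v ∈ U
  · have htot := hv.resolve_left (not_not.2 hvU)
    obtain ⟨-, i, hi, hil, rfl⟩ := (he.mem v).1 hvU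
    have hil' : i < l := by
      by_contra h
      rcases (not_lt.1 h).eq_or_lt with rfl | h
      · omega
      · have := he.lt l i h hi hil
        omega
    obtain ⟨j, rfl⟩ : ∃ j, i = j + k := ⟨i - k, by omega⟩
    have := (hstep j (by omega)).2.2.2.2 htot h1 hn
    rw [← Finset.sum_range_succ (fun i => R (e (j + k)) (e (j + i)))] at this
    exact this.trans (he.window_le hR (by omega) _)
  · have hne : ∀ i, i < 2 * k + l → e i ≠ v := by
      rintro i hi rfl
      by_cases h : 2 * k ≤ i
      · exact hvU ((he.mem _).2 ⟨hn, i, h, hi, rfl⟩)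
      · have := he.zero i (by omega)
        omega
    -- The first entry above `v` becomes entry `k` of the window starting at `i - k`; the entry
    -- before it lies below `v`.
    have hex : ∃ i, v < e i := ⟨l, by omega⟩
    set i := Nat.find hex with hidef
    have hi : v < e i := Nat.find_spec hex
    have hil : i ≤ l := Nat.find_min' hex (by omega)
    have hi2 : 2 * k ≤ i := by
      by_contra h
      rw [he.zero i (by omega)] at hi
      omega
    have him : e (i - 1) < v :=
      lt_of_le_of_ne (not_lt.1 (Nat.find_min hex (m := i - 1) (by omega))) (hne _ (by omega))
    have := (hstep (i - k) (by omega)).2.2.2.1 v h1 hn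
      (by simpa only [show i - k + (k - 1) = i - 1 by omega] using him)
      (by simpa only [show i - k + k = i by omega] using hi)
    exact this.trans (he.window_le hR (by omega) _)

/-! ### Windows as numbers and feasible sets as paths -/

/-- Digit `i` of `c` to the base `B`. -/
def dig (B c i : ℕ) : ℕ := c / B ^ i % B

/-- The number with the `m` digits `e j, …, e (j + m - 1)` to the base `B`. -/
def windowCode (B m : ℕ) (e : ℕ → ℕ) (j : ℕ) : ℕ := ∑ i ∈ Finset.range m, e (j + i) * B ^ i

theorem windowCode_succ (B m : ℕ) (e : ℕ → ℕ) (j : ℕ) :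
    windowCode B (m + 1) e j = e j + B * windowCode B m e (j + 1) := by
  simp only [windowCode, Finset.sum_range_succ', Finset.mul_sum]
  rw [add_comm]
  congr 1
  · simp
  · exact Finset.sum_congr rfl fun i _ => by rw [add_right_comm j 1 i, add_assoc]; ring

theorem dig_windowCode {B m : ℕ} {e : ℕ → ℕ} (he : ∀ i, e i < B) (j : ℕ) {i : ℕ} (hi : i < m) :
    dig B (windowCode B m e j) i = e (j + i) := by
  have hB : 0 < B := Nat.zero_lt_of_lt (he 0)
  induction i generalizing j m with
  | zero =>
    obtain ⟨m, rfl⟩ : ∃ m', m = m' + 1 := ⟨m - 1, by omega⟩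
    rw [windowCode_succ]
    simp [dig, Nat.mod_eq_of_lt (he j)]
  | succ i ih =>
    obtain ⟨m, rfl⟩ : ∃ m', m = m' + 1 := ⟨m - 1, by omega⟩
    have := ih (m := m) (j + 1) (by omega)
    rw [dig] at this ⊢
    rw [windowCode_succ, pow_succ', ← Nat.div_div_eq_div_mul, Nat.add_mul_div_left _ _ hB,
      Nat.div_eq_of_lt (he j), zero_add, this]
    congr 1
    omega

/-- Drops the first digit of `c` and appends the digit `w`. -/
def shiftCode (B m c w : ℕ) : ℕ := c / B + w * B ^ (m - 1)

/-- The oldest member is the lowest digit: division by `B` drops it and the new member enters as the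
top digit. -/
theorem shiftCode_windowCode {B m : ℕ} {e : ℕ → ℕ} (hm : 1 ≤ m) (he : ∀ i, e i < B) (j : ℕ) :
    shiftCode B m (windowCode B m e j) (e (j + m)) = windowCode B m e (j + 1) := by
  obtain ⟨m, rfl⟩ : ∃ m', m = m' + 1 := ⟨m - 1, by omega⟩
  have hB : 0 < B := Nat.zero_lt_of_lt (he 0)
  rw [shiftCode, windowCode_succ, Nat.add_mul_div_left _ _ hB, Nat.div_eq_of_lt (he j), zero_add,
    windowCode, windowCode, Finset.sum_range_succ]
  simp [add_assoc, add_comm 1]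

/-- The numbers `L` can be appended one by one to the window with code `c`, until the window
has no member that is at most `n`. -/
def IsPath (n k : ℕ) (tot : Bool) (R : ℕ → ℕ → ℕ) : ℕ → List ℕ → Prop
  | c, [] => n < dig (n + 2 * k + 1) c 0
  | c, w :: L => IsStep n k tot R (dig (n + 2 * k + 1) c) w ∧
      IsPath n k tot R (shiftCode (n + 2 * k + 1) (2 * k) c w) L

theorem isPath_windowCode {n k : ℕ} {tot : Bool} {R : ℕ → ℕ → ℕ} {e : ℕ → ℕ} (hk : 1 ≤ k)
    (he : ∀ i, e i < n + 2 * k + 1) (l j : ℕ) :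
    IsPath n k tot R (windowCode (n + 2 * k + 1) (2 * k) e j)
        ((List.range l).map fun t => e (j + 2 * k + t)) ↔
      (∀ t < l, IsStep n k tot R (fun i => e (j + t + i)) (e (j + t + 2 * k))) ∧
        n < e (j + l) := by
  induction l generalizing j with
  | zero =>
    simp only [List.range_zero, List.map_nil, IsPath]
    rw [dig_windowCode he j (by omega)]
    simp
  | succ l ih =>
    rw [List.range_succ_eq_map, List.map_cons, List.map_map, IsPath, add_zero,
      shiftCode_windowCode (by omega) he, IsStep.congr hk fun i hi => dig_windowCode he j hi]
    have := ih (j + 1)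
    have hf : ((fun t => e (j + 2 * k + t)) ∘ Nat.succ) = fun t => e (j + 1 + 2 * k + t) := by
      funext t
      simp only [Function.comp]
      congr 1
      omega
    rw [hf, this, ← and_assoc, add_right_comm j 1 l, add_assoc j l 1]
    refine and_congr_left fun _ => ⟨fun ⟨h0, h⟩ t ht => ?_, fun h => ⟨?_, fun t ht => ?_⟩⟩
    · rcases t with _ | t
      · simpa using h0
      · simpa only [add_right_comm j 1 t, add_assoc j t 1] using h t (by omega)
    · simpa using h 0 (by omega)
    · simpa only [add_right_comm j 1 t, add_assoc j t 1] using h (t + 1) (by omega)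

/-- `2 * k` zeros, followed by the list `L`. -/
def padded (k : ℕ) (L : List ℕ) (i : ℕ) : ℕ := if i < 2 * k then 0 else L.getD (i - 2 * k) 0

theorem windowCode_padded_zero (B k : ℕ) (L : List ℕ) :
    windowCode B (2 * k) (padded k L) 0 = 0 :=
  Finset.sum_eq_zero fun i hi => by simp [padded, Finset.mem_range.1 hi]

theorem map_range_padded (k : ℕ) (L : List ℕ) :
    ((List.range L.length).map fun t => padded k L (0 + 2 * k + t)) = L := by
  refine List.ext_getElem (by simp) fun i h1 h2 => ?_
  simp [padded, h2]

/-- The code `0` is the window of `2 * k` zeros, which is where every listing starts. -/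
theorem isPath_zero_iff {n k : ℕ} {tot : Bool} {R : ℕ → ℕ → ℕ} (hk : 1 ≤ k) {L : List ℕ}
    (hL : ∀ w ∈ L, w < n + 2 * k + 1) :
    IsPath n k tot R 0 L ↔ (∀ t < L.length, IsStep n k tot R (fun i => padded k L (t + i))
      (padded k L (t + 2 * k))) ∧ n < padded k L L.length := by
  have := isPath_windowCode (tot := tot) (R := R) (e := padded k L) hk (fun i => by
    unfold padded
    split_ifs with h
    · omega
    · rw [List.getD_eq_getElem?_getD]
      rcases lt_or_ge (i - 2 * k) L.length with h' | h'
      · simpa [h'] using hL _ (List.getElem_mem h')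
      · simp [h']) L.length 0
  rw [map_range_padded] at this
  simpa [windowCode_padded_zero] using this

theorem IsPath.lt {n k : ℕ} {tot : Bool} {R : ℕ → ℕ → ℕ} {c : ℕ} {L : List ℕ}
    (h : IsPath n k tot R c L) : ∀ w ∈ L, w < n + 2 * k + 1 := by
  induction L generalizing c with
  | nil => simp
  | cons w L ih =>
    intro w' hw'
    rcases List.mem_cons.1 hw' with rfl | hw'
    · exact h.1.2.1
    · exact ih h.2 w' hw'

theorem isListing_padded {n k : ℕ} {L : List ℕ} (hL : L.Pairwise (· < ·)) (h0 : ∀ w ∈ L, 1 ≤ w) :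
    IsListing n k L.length (L.toFinset.filter (· ≤ n)) (padded k L) := by
  have hval : ∀ i (h : 2 * k ≤ i) (h' : i < 2 * k + L.length),
      padded k L i = L[i - 2 * k]'(by omega) := fun i h h' => by
    rw [padded, if_neg (by omega), List.getD_eq_getElem]
  refine ⟨fun i hi => by simp [padded, hi], fun i j hij hj hjl => ?_, fun u => ?_⟩
  · rw [hval j hj hjl]
    by_cases hi : 2 * k ≤ i
    · rw [hval i hi (by omega)]
      exact List.pairwise_iff_getElem.1 hL _ _ _ _ (by omega)
    · rw [padded, if_pos (by omega)]
      exact h0 _ (List.getElem_mem _)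
  · simp only [Finset.mem_filter, List.mem_toFinset, and_comm (b := u ≤ n)]
    refine and_congr_right fun _ => ⟨fun h => ?_, ?_⟩
    · obtain ⟨i, hi, rfl⟩ := List.mem_iff_getElem.1 h
      exact ⟨i + 2 * k, by omega, by omega, by rw [hval _ (by omega) (by omega)]; simp⟩
    · rintro ⟨i, hi, hil, rfl⟩
      rw [hval i hi hil]
      exact List.getElem_mem _

/-- Each step demands a member larger than the last one, so the path is strictly increasing. Its
having no repetitions later turns the cost of the path into the cost of a set. -/
theorem IsPath.isFeasible {n k : ℕ} {tot : Bool} {R : ℕ → ℕ → ℕ} (hR : IsUmbrellaMatrix n R)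
    (hk : 1 ≤ k) {L : List ℕ} (h : IsPath n k tot R 0 L) :
    L.Nodup ∧ IsFeasible n k tot R (L.toFinset.filter (· ≤ n)) := by
  obtain ⟨h1, h2⟩ := (isPath_zero_iff hk h.lt).1 h
  have hlt : ∀ t < L.length, padded k L (t + (2 * k - 1)) < padded k L (t + 2 * k) :=
    fun t ht => (h1 t ht).2.2.1
  have hval : ∀ i (h : i < L.length), padded k L (i + 2 * k) = L[i] := fun i h => by
    rw [padded, if_neg (by omega), List.getD_eq_getElem _ _ (by omega)]
    simp
  have hpos : ∀ w ∈ L, 1 ≤ w := fun w hw => by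
    obtain ⟨i, hi, rfl⟩ := List.mem_iff_getElem.1 hw
    have := hlt i hi
    rw [hval i hi] at this
    omega
  have hsort : L.Pairwise (· < ·) := by
    rw [← List.isChain_iff_pairwise, List.isChain_iff_getElem]
    intro i hi
    have := hlt (i + 1) hi
    rwa [hval (i + 1) hi, show i + 1 + (2 * k - 1) = i + 2 * k by omega, hval i (by omega)] at this
  exact ⟨hsort.imp fun h => h.ne, (isListing_padded hsort hpos).isFeasible hR hk h2 h1⟩

theorem IsFeasible.exists_isPath {n k : ℕ} {tot : Bool} {R : ℕ → ℕ → ℕ} {U : Finset ℕ}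
    (hR : IsUmbrellaMatrix n R) (hk : 1 ≤ k) (hU : IsFeasible n k tot R U) :
    ∃ L : List ℕ, IsPath n k tot R 0 L ∧ L.toFinset.filter (· ≤ n) = U := by
  set S := U.sort (· ≤ ·) with hS
  -- The `2 * k` sentinels `n + 1, …, n + 2 * k` are just enough to push the last member of `U` out
  -- of the window, and they are still digits to the base `n + 2 * k + 1`.
  set L := S ++ List.range' (n + 1) (2 * k) with hL
  have hSU : ∀ u, u ∈ S ↔ u ∈ U := fun u => Finset.mem_sort _
  have hmem : ∀ w, w ∈ L ↔ w ∈ U ∨ (n + 1 ≤ w ∧ w < n + 1 + 2 * k) := fun w => by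
    rw [hL, List.mem_append, hSU, List.mem_range'_1]
  have hlt : ∀ w ∈ L, w < n + 2 * k + 1 := fun w hw => by
    rcases (hmem w).1 hw with h | h
    · have := hU.1 w h; omega
    · omega
  have hsort : L.Pairwise (· < ·) := by
    rw [hL, List.pairwise_append]
    refine ⟨(Finset.sortedLT_sort U).pairwise, List.pairwise_lt_range' _, fun u hu w hw => ?_⟩
    have := hU.1 u ((hSU u).1 hu)
    rw [List.mem_range'_1] at hw
    omega
  have hfilter : L.toFinset.filter (· ≤ n) = U := by
    ext u
    simp only [Finset.mem_filter, List.mem_toFinset, hmem]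
    constructor
    · rintro ⟨h | h, h'⟩
      · exact h
      · omega
    · exact fun h => ⟨.inl h, (hU.1 u h).2⟩
  have hlen : L.length = S.length + 2 * k := by simp [hL]
  have hli := isListing_padded (n := n) (k := k) hsort fun w hw => by
    rcases (hmem w).1 hw with h | h
    · exact (hU.1 w h).1
    · omega
  rw [hfilter] at hli
  refine ⟨L, (isPath_zero_iff hk hlt).2 ⟨fun t ht => hli.isStep hR hk hU ht ?_ ?_, ?_⟩, hfilter⟩
  · unfold padded
    split_ifs with h
    · omega
    · have : t - 2 * k < S.length := by omega
      rw [hL, List.getD_append _ _ _ _ this, List.getD_eq_getElem _ _ this]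
      exact (hU.1 _ ((hSU _).1 (List.getElem_mem _))).2
  · rw [padded, if_neg (by omega), List.getD_eq_getElem _ _ (by omega)]
    exact hlt _ (List.getElem_mem _)
  · rw [padded, if_neg (by omega), List.getD_eq_getElem _ _ (by omega)]
    simp [hL]

/-! ### The instance in terms of positions, and auxiliary tables -/

/-- The adjacency matrix `a` rewritten in terms of positions `1, …, n` in the ordering `q`. -/
def positionMatrix (n : ℕ) (a : ℕ → ℕ → ℕ) (q : ℕ → ℕ) (x y : ℕ) : ℕ :=
  if (1 ≤ x ∧ x ≤ n) ∧ 1 ≤ y ∧ y ≤ n then a (q (x - 1)) (q (y - 1)) else 0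

/-- The cost function `c` rewritten in terms of positions `1, …, n` in the ordering `q`. -/
def positionCost (n : ℕ) (c : ℕ → ℝ) (q : ℕ → ℕ) (x : ℕ) : ℝ :=
  if 1 ≤ x ∧ x ≤ n then c (q (x - 1)) else 0

theorem isUmbrellaMatrix_positionMatrix {n : ℕ} {a : ℕ → ℕ → ℕ} {q : ℕ → ℕ}
    (ha : IsAdjMatrix n a) (hq : IsUmbrellaSeq a q n) :
    IsUmbrellaMatrix n (positionMatrix n a q) where
  le_one x y := by
    unfold positionMatrix
    split_ifs
    · exact ha.le_one _ _
    · omega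
  symm x y := by
    unfold positionMatrix
    simp only [ha.symm (q (x - 1)), and_comm]
  mem x y h := by
    unfold positionMatrix at h
    split_ifs at h with h'
    exact h'.1
  umbrella x y z hxy hyz h := by
    unfold positionMatrix at h ⊢
    split_ifs at h with h'
    rw [if_pos (by omega), if_pos (by omega)]
    exact hq _ _ _ (by omega) (by omega) (by omega) h

namespace RAM

/-- The `m`-th power of an expression. -/
def powE (e : IExpr) : ℕ → IExpr
  | 0 => .lit 1
  | m + 1 => .mul (powE e m) e

theorem powE_eval (e : IExpr) (s : State) (m : ℕ) : (powE e m).eval s = e.eval s ^ m := by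
  induction m with
  | zero => rfl
  | succ m ih => rw [powE, IExpr.eval, ih, pow_succ]

/-- Stores the base `n + 2 * k + 1`, its power `2 * k` and its power `2 * k - 1`. -/
def paramProg (k : ℕ) : Prog :=
  .seq (.setReg 1 (.add (.reg 0) (.lit (2 * k + 1))))
    (.seq (.setReg 2 (powE (.reg 1) (2 * k))) (.setReg 3 (powE (.reg 1) (2 * k - 1))))

theorem paramProg_spec {W n k B : ℕ} {s : State} (hB : B = n + 2 * k + 1) (hBW : B ≤ W)
    (hW : B ^ (2 * k) ≤ W) (hs : s.reg 0 = n) :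
    Runs W (paramProg k) s 1 fun s' =>
      s'.reg 1 = B ∧ s'.reg 2 = B ^ (2 * k) ∧ s'.reg 3 = B ^ (2 * k - 1) := by
  have hle : B ^ (2 * k - 1) ≤ B ^ (2 * k) := Nat.pow_le_pow_right (by omega) (by omega)
  have e1 : (IExpr.add (.reg 0) (.lit (2 * k + 1))).eval s = B := by
    simp [IExpr.eval, hs, hB, add_assoc]
  refine .seq (.setReg le_rfl (by rw [e1]; exact hBW) ?_)
  rw [e1]
  have e2 : (powE (.reg 1) (2 * k)).eval (s.setReg 1 B) = B ^ (2 * k) := by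
    rw [powE_eval]; simp [IExpr.eval, State.setReg]
  refine .seq (.setReg le_rfl (by rw [e2]; exact hW) ?_)
  rw [e2]
  have e3 : (powE (.reg 1) (2 * k - 1)).eval ((s.setReg 1 B).setReg 2 (B ^ (2 * k))) =
      B ^ (2 * k - 1) := by
    rw [powE_eval]; simp [IExpr.eval, State.setReg]
  refine .setReg le_rfl (by rw [e3]; omega) ?_
  rw [e3]
  simp [State.setReg]

/-- Stores the matrix and the costs in terms of positions. -/
def matrixProg : Prog :=
  .for 7 0 (.seq (.setCost 1 (.add (.reg 7) (.lit 1)) (.get 0 (.get 2 (.reg 7))))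
    (.for 8 0 (.setArr 6 (.add (.mul (.add (.reg 7) (.lit 1)) (.reg 1)) (.add (.reg 8) (.lit 1)))
      (adjE (.get 2 (.reg 7)) (.get 2 (.reg 8))))))

theorem mul_add_eq_iff {B x y x' y' : ℕ} (hy : y < B) (hy' : y' < B) :
    x * B + y = x' * B + y' ↔ x = x' ∧ y = y' := by
  constructor
  · intro h
    have h1 : (x * B + y) / B = x := by
      rw [add_comm, Nat.add_mul_div_right _ _ (by omega), Nat.div_eq_of_lt hy, zero_add]
    have h2 : (x' * B + y') / B = x' := by
      rw [add_comm, Nat.add_mul_div_right _ _ (by omega), Nat.div_eq_of_lt hy', zero_add]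
    have : x = x' := by rw [← h1, ← h2, h]
    subst this
    exact ⟨rfl, by omega⟩
  · rintro ⟨rfl, rfl⟩; rfl

theorem matrixProg_spec {W n B : ℕ} {a : ℕ → ℕ → ℕ} {s : State} (ha : IsAdjMatrix n a)
    (hB : n + 1 < B) (hBW : B * B ≤ W) (hs : HasAdj n a s) (hs1 : s.reg 1 = B)
    (hq : ∀ i < n, s.arr 2 i < n) (h6 : ∀ x, s.arr 6 x = 0) (hc1 : ∀ x, s.cost 1 x = 0) :
    Runs W matrixProg s ((n + 1) ^ 2) fun s' =>
      (∀ x y, x < B → y < B → s'.arr 6 (x * B + y) = positionMatrix n a (s.arr 2) x y) ∧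
      ∀ x, s'.cost 1 x = positionCost n (s.cost 0) (s.arr 2) x := by
  have hBB : ∀ x y, x < B → y < B → x * B + y < B * B := fun x y hx hy => by
    have : (x + 1) * B ≤ B * B := Nat.mul_le_mul_right _ hx
    rw [add_mul] at this
    omega
  have hBle : B ≤ B * B := Nat.le_mul_self B
  set R := positionMatrix n a (s.arr 2) with hR
  -- These cells are never written; they keep their initial `0`, which is the right value.
  have hR0 : ∀ x y, (x = 0 ∨ y = 0 ∨ n < x ∨ n < y) → R x y = 0 := fun x y h => by
    rw [hR, positionMatrix, if_neg]; omega
  refine Runs.for_of (K := n + 1) (m := n) (fun i s' =>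
      (∀ x y, x < B → y < B → s'.arr 6 (x * B + y) = if x ≤ i then R x y else 0) ∧
      ∀ x, s'.cost 1 x = if x ≤ i then positionCost n (s.cost 0) (s.arr 2) x else 0)
    (by omega) (by rw [pow_two]) hs.reg (by omega) rfl rfl ?_ ?_ ?_
  · refine ⟨fun x y _ _ => ?_, fun x => ?_⟩
    · simp only [State.setReg, h6]
      split_ifs with h
      · rw [hR0]; omega
      · rfl
    · simp only [State.setReg, hc1, positionCost]
      split_ifs <;> first | rfl | omega
  · intro i s₁ hi hri hF₁ ⟨h₁, hc₁⟩
    have e2 : s₁.arr 2 = s.arr 2 := hF₁.arr 2 rfl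
    have ec0 : s₁.cost 0 = s.cost 0 := hF₁.cost 0 rfl
    have hs₁ := hs.congr (hF₁.reg 0 rfl) (hF₁.arr 0 rfl)
    have e1 : s₁.reg 1 = B := (hF₁.reg 1 rfl).trans hs1
    refine .seq (.setCost (by omega) ?_ ?_)
    · simp [IExpr.eval, hri]; omega
    have eC : (CExpr.get 0 (.get 2 (.reg 7))).eval s₁ =
        positionCost n (s.cost 0) (s.arr 2) (i + 1) := by
      simp only [CExpr.eval, IExpr.eval, ec0, e2, hri, positionCost]
      rw [if_pos (by omega), Nat.add_sub_cancel]
    have eP : (IExpr.add (.reg 7) (.lit 1)).eval s₁ = i + 1 := by simp [IExpr.eval, hri]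
    rw [eC, eP]
    set s₁' := s₁.setCost 1 (i + 1) (positionCost n (s.cost 0) (s.arr 2) (i + 1)) with hs₁'
    have hs₁'' : HasAdj n a s₁' := hs₁.congr rfl rfl
    refine Runs.for_of (K := 1) (m := n) (fun j s' =>
      ∀ x y, x < B → y < B → s'.arr 6 (x * B + y) =
        if x ≤ i ∨ (x = i + 1 ∧ y ≤ j) then R x y else 0)
      le_rfl (by omega) hs₁''.reg (by omega) rfl rfl ?_ ?_ ?_
    · intro x y hx hy
      simp only [State.setReg, hs₁', State.setCost]
      rw [h₁ x y hx hy]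
      have := hR0 x 0 (by omega)
      split_ifs with h h' h'
      · rfl
      · omega
      · obtain ⟨-, rfl⟩ : x = i + 1 ∧ y = 0 := by omega
        rw [this]
      · rfl
    · intro j s₂ hj hrj hF₂ h₂
      have hs₂ := hs₁''.congr (hF₂.reg 0 rfl) (hF₂.arr 0 rfl)
      have f2 : s₂.arr 2 = s.arr 2 := (hF₂.arr 2 rfl).trans e2
      have f1 : s₂.reg 1 = B := (hF₂.reg 1 rfl).trans e1
      have f7 : s₂.reg 7 = i := (hF₂.reg 7 rfl).trans hri
      have hpos : (IExpr.add (.mul (.add (.reg 7) (.lit 1)) (.reg 1))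
          (.add (.reg 8) (.lit 1))).eval s₂ = (i + 1) * B + (j + 1) := by
        simp [IExpr.eval, f7, f1, hrj]
      have hval := hs₂.eval (u := .get 2 (.reg 7)) (v := .get 2 (.reg 8))
        (by simpa [IExpr.eval, f2, f7] using hq i hi)
        (by simpa [IExpr.eval, f2, hrj] using hq j hj)
      have hval' : (adjE (.get 2 (.reg 7)) (.get 2 (.reg 8))).eval s₂ = R (i + 1) (j + 1) := by
        rw [hval]
        simp only [IExpr.eval, f2, f7, hrj, hR, positionMatrix]
        rw [if_pos (by omega), Nat.add_sub_cancel, Nat.add_sub_cancel]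
      refine .setArr le_rfl ?_ ?_ ?_
      · have := hBB (i + 1) (j + 1) (by omega) (by omega)
        rw [hpos]; omega
      · have := ha.le_one (s₂.arr 2 i) (s₂.arr 2 j)
        rw [hval]
        simp only [IExpr.eval, f7, hrj]
        omega
      · intro x y hx hy
        rw [hpos, hval']
        simp only [State.setReg, State.setArr, Function.update_self, Function.update_apply]
        have hiff := mul_add_eq_iff (x := x) (x' := i + 1) hy (show j + 1 < B by omega)
        rw [h₂ x y hx hy]
        simp only [hiff]
        split_ifs with h h' h' h' h'
        · rw [h.1, h.2]
        · omega
        · rfl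
        · omega
        · omega
        · rfl
    · intro s₂ hF₂ h₂
      have fc : s₂.cost 1 = s₁'.cost 1 := hF₂.cost 1 rfl
      refine ⟨fun x y hx hy => ?_, fun x => ?_⟩
      · simp only [State.setReg]
        rw [h₂ x y hx hy]
        have := hR0 x y
        split_ifs with h h' h'
        · rfl
        · omega
        · rw [this]; omega
        · rfl
      · simp only [State.setReg, fc, hs₁', State.setCost, Function.update_self,
          Function.update_apply, hc₁]
        split_ifs with h h' h' h' h'
        · rw [h]
        · omega
        · rfl
        · omega
        · omega
        · rfl
  · intro s' hF ⟨h, hc⟩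
    refine ⟨fun x y hx hy => ?_, fun x => ?_⟩
    · rw [h x y hx hy]
      split_ifs with h'
      · rfl
      · rw [hR0]; omega
    · rw [hc x]
      split_ifs with h'
      · rfl
      · rw [positionCost, if_neg]; omega

/-- Tabulates the quotients by the base. -/
def divProg : Prog :=
  .for 7 2 (.setArr 7 (.add (.reg 7) (.reg 1)) (.add (.get 7 (.reg 7)) (.lit 1)))

/-- There is no division instruction. The table uses (x + B) / B = x / B + 1, starting from the
initial zeros below `B`. It writes beyond `N`, hence the room `N + B`. -/
theorem divProg_spec {W B N : ℕ} {s : State} (hB : 1 ≤ B) (hW : N + B ≤ W) (hs1 : s.reg 1 = B)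
    (hs2 : s.reg 2 = N) (h7 : ∀ x, s.arr 7 x = 0) :
    Runs W divProg s (N + 1) fun s' => ∀ x < N, s'.arr 7 x = x / B := by
  refine Runs.for_of (K := 1) (m := N) (fun i s' => ∀ x < i + B, s'.arr 7 x = x / B)
    le_rfl (by omega) hs2 (by omega) rfl rfl ?_ ?_ ?_
  · intro x hx
    simp only [State.setReg, h7]
    rw [Nat.div_eq_of_lt (by omega)]
  · intro i s₁ hi hri hF h
    have e1 : s₁.reg 1 = B := (hF.reg 1 rfl).trans hs1
    have hi' := h i (by omega)
    have := Nat.div_le_self i B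
    refine .setArr le_rfl ?_ ?_ ?_
    · simp [IExpr.eval, hri, e1]; omega
    · simp [IExpr.eval, hri, hi']; omega
    · intro x hx
      simp only [State.setReg, State.setArr, IExpr.eval, hri, e1, hi', Function.update_self,
        Function.update_apply]
      split_ifs with h'
      · rw [h', Nat.add_div_right _ hB]
      · exact h x (by omega)
  · exact fun s' _ h x hx => h x (by omega)

end RAM

/-! ### Bellman equations on the acyclic digraph of windows -/

theorem dig_last {B m c : ℕ} (hm : 1 ≤ m) (hc : c < B ^ m) : dig B c (m - 1) = c / B ^ (m - 1) := by
  refine Nat.mod_eq_of_lt (Nat.div_lt_of_lt_mul ?_)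
  rwa [← pow_succ, Nat.sub_add_cancel hm]

/-- The top digit grows, whatever happens below it. This makes the digraph acyclic and gives the
order in which the table is filled. -/
theorem lt_shiftCode {B m c w : ℕ} (hm : 1 ≤ m) (hc : c < B ^ m)
    (hw : dig B c (m - 1) < w) : c < shiftCode B m c w := by
  have hB : 0 < B := by
    by_contra h
    obtain rfl : B = 0 := by omega
    rw [zero_pow (by omega)] at hc
    omega
  rw [dig_last hm hc] at hw
  have h1 := Nat.lt_mul_div_succ c (Nat.pow_pos hB (n := m - 1))
  have h2 : B ^ (m - 1) * (c / B ^ (m - 1) + 1) ≤ B ^ (m - 1) * w := Nat.mul_le_mul_left _ hw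
  have h3 : B ^ (m - 1) * w = w * B ^ (m - 1) := mul_comm _ _
  have h4 : w * B ^ (m - 1) ≤ shiftCode B m c w := Nat.le_add_left _ _
  omega

theorem shiftCode_lt {B m c w : ℕ} (hm : 1 ≤ m) (hc : c < B ^ m) (hw : w < B) :
    shiftCode B m c w < B ^ m := by
  obtain ⟨m, rfl⟩ : ∃ m', m = m' + 1 := ⟨m - 1, by omega⟩
  rw [pow_succ'] at hc ⊢
  have h1 : c / B < B ^ m := Nat.div_lt_of_lt_mul hc
  have h2 : (w + 1) * B ^ m ≤ B * B ^ m := Nat.mul_le_mul_right _ hw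
  rw [add_mul] at h2
  simp only [shiftCode, Nat.add_sub_cancel]
  omega

/-- The Bellman equations at the window with code `c`: `f` tells which windows have a path, `v` is
the minimum cost of a path, and `nx` is the first member of an optimal path. -/
structure IsTableAt (n k : ℕ) (tot : Bool) (R : ℕ → ℕ → ℕ) (pc : ℕ → ℝ) (f : ℕ → ℕ) (v : ℕ → ℝ)
    (nx : ℕ → ℕ) (c : ℕ) : Prop where
  final : n < dig (n + 2 * k + 1) c 0 → f c = 1 ∧ v c = 0
  next : f c = 1 → dig (n + 2 * k + 1) c 0 ≤ n →
    IsStep n k tot R (dig (n + 2 * k + 1) c) (nx c) ∧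
      f (shiftCode (n + 2 * k + 1) (2 * k) c (nx c)) = 1 ∧
      v c = pc (nx c) + v (shiftCode (n + 2 * k + 1) (2 * k) c (nx c))
  le : ∀ w, IsStep n k tot R (dig (n + 2 * k + 1) c) w →
    f (shiftCode (n + 2 * k + 1) (2 * k) c w) = 1 →
    f c = 1 ∧ v c ≤ pc w + v (shiftCode (n + 2 * k + 1) (2 * k) c w)

theorem IsStep.lt_shiftCode {n k c w : ℕ} {tot : Bool} {R : ℕ → ℕ → ℕ} (hk : 1 ≤ k)
    (h : IsStep n k tot R (dig (n + 2 * k + 1) c) w) (hc : c < (n + 2 * k + 1) ^ (2 * k)) :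
    c < shiftCode (n + 2 * k + 1) (2 * k) c w ∧
      shiftCode (n + 2 * k + 1) (2 * k) c w < (n + 2 * k + 1) ^ (2 * k) :=
  ⟨_root_.lt_shiftCode (by omega) hc h.2.2.1, shiftCode_lt (by omega) hc h.2.1⟩

/-- The equations at `c` involve only codes from `c` on, so later writes at smaller codes do not
disturb them. -/
theorem IsTableAt.congr {n k c : ℕ} {tot : Bool} {R : ℕ → ℕ → ℕ} {pc v v' : ℕ → ℝ} {f f' : ℕ → ℕ}
    {nx nx' : ℕ → ℕ} (hk : 1 ≤ k) (hc : c < (n + 2 * k + 1) ^ (2 * k))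
    (h : IsTableAt n k tot R pc f v nx c) (hf : ∀ x, c ≤ x → f' x = f x)
    (hv : ∀ x, c ≤ x → v' x = v x) (hnx : nx' c = nx c) :
    IsTableAt n k tot R pc f' v' nx' c := by
  refine ⟨fun h0 => ?_, fun h1 h0 => ?_, fun w hw h1 => ?_⟩
  · rw [hf c le_rfl, hv c le_rfl]; exact h.final h0
  · rw [hf c le_rfl] at h1
    obtain ⟨h2, h3, h4⟩ := h.next h1 h0
    have := (h2.lt_shiftCode hk hc).1.le
    rw [hnx, hf _ this, hv _ this, hv c le_rfl]
    exact ⟨h2, h3, h4⟩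
  · have := (hw.lt_shiftCode hk hc).1.le
    rw [hf _ this] at h1
    rw [hf c le_rfl, hv c le_rfl, hv _ this]
    exact h.le w hw h1

/-- This is the lower-bound half of optimality; that the value is attained is shown by the walk
along the stored successors. -/
theorem IsTableAt.le_of_isPath {n k : ℕ} {tot : Bool} {R : ℕ → ℕ → ℕ} {pc v : ℕ → ℝ} {f : ℕ → ℕ}
    {nx : ℕ → ℕ} (hk : 1 ≤ k)
    (h : ∀ c < (n + 2 * k + 1) ^ (2 * k), IsTableAt n k tot R pc f v nx c) {c : ℕ}
    (hc : c < (n + 2 * k + 1) ^ (2 * k)) {L : List ℕ} (hL : IsPath n k tot R c L) :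
    f c = 1 ∧ v c ≤ (L.map pc).sum := by
  induction L generalizing c with
  | nil =>
    obtain ⟨h1, h2⟩ := (h c hc).final hL
    exact ⟨h1, by simp [h2]⟩
  | cons w L ih =>
    obtain ⟨h1, h2⟩ := ih (hL.1.lt_shiftCode hk hc).2 hL.2
    obtain ⟨h3, h4⟩ := (h c hc).le w hL.1 h1
    refine ⟨h3, ?_⟩
    rw [List.map_cons, List.sum_cons]
    linarith

/-! ### The dynamic program -/

namespace RAM

/-- The result of dropping the first `i` digits of `c`. -/
def divE (c : IExpr) : ℕ → IExpr
  | 0 => c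
  | i + 1 => .get 7 (divE c i)

/-- Digit `i` of `c`. -/
def digE (c : IExpr) (i : ℕ) : IExpr := .sub (divE c i) (.mul (.get 7 (divE c i)) (.reg 1))

/-- The number of neighbours of `x` among the first `m` members of the window `c`. -/
def windowSumE (x c : IExpr) : ℕ → IExpr
  | 0 => .lit 0
  | m + 1 => .add (windowSumE x c m) (.get 6 (.add (.mul x (.reg 1)) (digE c m)))

/-- The state holds the instance in terms of positions, and the table of quotients. -/
structure IsPrepared (n k : ℕ) (R : ℕ → ℕ → ℕ) (pc : ℕ → ℝ) (s : State) : Prop where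
  size : s.reg 0 = n
  base : s.reg 1 = n + 2 * k + 1
  codes : s.reg 2 = (n + 2 * k + 1) ^ (2 * k)
  top : s.reg 3 = (n + 2 * k + 1) ^ (2 * k - 1)
  matrix : ∀ x y, x < n + 2 * k + 1 → y < n + 2 * k + 1 → s.arr 6 (x * (n + 2 * k + 1) + y) = R x y
  div : ∀ x < (n + 2 * k + 1) ^ (2 * k), s.arr 7 x = x / (n + 2 * k + 1)
  cost : ∀ x, s.cost 1 x = pc x

variable {n k : ℕ} {R : ℕ → ℕ → ℕ} {pc : ℕ → ℝ} {s s' : State}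

theorem IsPrepared.congr (h : IsPrepared n k R pc s) (h0 : s'.reg 0 = s.reg 0)
    (h1 : s'.reg 1 = s.reg 1) (h2 : s'.reg 2 = s.reg 2) (h3 : s'.reg 3 = s.reg 3)
    (h6 : s'.arr 6 = s.arr 6) (h7 : s'.arr 7 = s.arr 7) (hc : s'.cost 1 = s.cost 1) :
    IsPrepared n k R pc s' :=
  ⟨h0.trans h.size, h1.trans h.base, h2.trans h.codes, h3.trans h.top, by rw [h6]; exact h.matrix,
    by rw [h7]; exact h.div, by rw [hc]; exact h.cost⟩

theorem IsPrepared.divE_eval (h : IsPrepared n k R pc s) {c : IExpr}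
    (hc : c.eval s < (n + 2 * k + 1) ^ (2 * k)) (i : ℕ) :
    (divE c i).eval s = c.eval s / (n + 2 * k + 1) ^ i := by
  induction i with
  | zero => simp [divE]
  | succ i ih =>
    rw [divE, IExpr.eval, ih, h.div _ ((Nat.div_le_self _ _).trans_lt hc), Nat.div_div_eq_div_mul,
      pow_succ]

theorem IsPrepared.digE_eval (h : IsPrepared n k R pc s) {c : IExpr}
    (hc : c.eval s < (n + 2 * k + 1) ^ (2 * k)) (i : ℕ) :
    (digE c i).eval s = dig (n + 2 * k + 1) (c.eval s) i := by
  simp only [digE, IExpr.eval, h.divE_eval hc, h.base, dig]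
  rw [h.div _ ((Nat.div_le_self _ _).trans_lt hc), Nat.mod_eq_sub_div_mul]

theorem dig_lt (n k c i : ℕ) : dig (n + 2 * k + 1) c i < n + 2 * k + 1 :=
  Nat.mod_lt _ (by omega)

theorem IsPrepared.windowSumE_eval (h : IsPrepared n k R pc s) {x c : IExpr}
    (hx : x.eval s < n + 2 * k + 1) (hc : c.eval s < (n + 2 * k + 1) ^ (2 * k)) (m : ℕ) :
    (windowSumE x c m).eval s =
      ∑ i ∈ Finset.range m, R (x.eval s) (dig (n + 2 * k + 1) (c.eval s) i) := by
  induction m with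
  | zero => rfl
  | succ m ih =>
    rw [windowSumE, IExpr.eval, ih, Finset.sum_range_succ]
    simp only [IExpr.eval, h.digE_eval hc, h.base]
    rw [h.matrix _ _ hx (dig_lt n k _ _)]

/-- The test that fails where position `reg 7 + 1` is undominated in the middle of the window. -/
def gapTest (k : ℕ) : Test :=
  .conj (.le (digE (.reg 11) (k - 1)) (.reg 7))
    (.conj (.le (.add (.reg 7) (.lit 2)) (digE (.reg 11) k))
      (.le (.add (windowSumE (.add (.reg 7) (.lit 1)) (.reg 11) (2 * k)) (.lit 1)) (.lit k)))

/-- The test whether the middle member of the window followed by `reg 7` is dominated. -/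
def memberTest (k : ℕ) : Bool → Test
  | false => .eq (.lit 0) (.lit 0)
  | true => .neg (.conj (.le (.lit 1) (digE (.reg 11) k)) (.conj (.le (digE (.reg 11) k) (.reg 0))
      (.le (.add (.add (windowSumE (digE (.reg 11) k) (.reg 11) (2 * k))
        (.get 6 (.add (.mul (digE (.reg 11) k) (.reg 1)) (.reg 7)))) (.lit 1)) (.lit k))))

/-- The code of the window `reg 11` shifted by `reg 7`. -/
def shiftE : IExpr := .add (.get 7 (.reg 11)) (.mul (.reg 7) (.reg 3))

/-- The cost of a best path through `reg 7`. -/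
def viaE : CExpr := .add (.get 1 (.reg 7)) (.get 2 shiftE)

/-- The test whether `reg 7` is a possible next member that improves the table. -/
def improveTest (k : ℕ) (tot : Bool) : Test :=
  .conj (.le (.add (digE (.reg 11) (2 * k - 1)) (.lit 1)) (.reg 7))
    (.conj (memberTest k tot) (.conj (.eq (.get 8 shiftE) (.lit 1))
      (.neg (.conj (.eq (.get 8 (.reg 11)) (.lit 1))
        (.neg (.costLe viaE (.get 2 (.reg 11))))))))

theorem IsPrepared.gapTest_holds (h : IsPrepared n k R pc s) {c v : ℕ}
    (hc : c < (n + 2 * k + 1) ^ (2 * k)) (h11 : s.reg 11 = c) (h7 : s.reg 7 = v) (hv : v < n) :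
    (gapTest k).Holds s ↔ ¬ (dig (n + 2 * k + 1) c (k - 1) < v + 1 → v + 1 < dig (n + 2 * k + 1) c k →
      k ≤ ∑ i ∈ Finset.range (2 * k), R (v + 1) (dig (n + 2 * k + 1) c i)) := by
  have hc' : (IExpr.reg 11).eval s < (n + 2 * k + 1) ^ (2 * k) := by simpa [IExpr.eval, h11]
  simp only [gapTest, Test.Holds, IExpr.eval, h.digE_eval hc',
    h.windowSumE_eval (x := .add (.reg 7) (.lit 1))
      (by simp only [IExpr.eval, h7]; omega) hc', h11, h7]
  omega

theorem IsPrepared.memberTest_holds (h : IsPrepared n k R pc s) {tot : Bool} {c w : ℕ}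
    (hc : c < (n + 2 * k + 1) ^ (2 * k)) (h11 : s.reg 11 = c) (h7 : s.reg 7 = w)
    (hw : w < n + 2 * k + 1) :
    (memberTest k tot).Holds s ↔ (tot = true → 1 ≤ dig (n + 2 * k + 1) c k →
      dig (n + 2 * k + 1) c k ≤ n → k ≤ ∑ i ∈ Finset.range (2 * k), R (dig (n + 2 * k + 1) c k)
        (dig (n + 2 * k + 1) c i) + R (dig (n + 2 * k + 1) c k) w) := by
  have hc' : (IExpr.reg 11).eval s < (n + 2 * k + 1) ^ (2 * k) := by simpa [IExpr.eval, h11]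
  cases tot
  · simp [memberTest, Test.Holds]
  · have hd := dig_lt n k c k
    simp only [memberTest, Test.Holds, IExpr.eval, h.digE_eval hc',
      h.windowSumE_eval (x := digE (.reg 11) k)
        (by rw [h.digE_eval hc']; exact dig_lt _ _ _ _) hc', h11, h7, h.base, h.size]
    rw [h.matrix _ _ hd hw]
    simp only [forall_const]
    omega

theorem IsPrepared.shiftE_eval (h : IsPrepared n k R pc s) {c w : ℕ}
    (hc : c < (n + 2 * k + 1) ^ (2 * k)) (h11 : s.reg 11 = c) (h7 : s.reg 7 = w) :
    shiftE.eval s = shiftCode (n + 2 * k + 1) (2 * k) c w := by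
  simp only [shiftE, IExpr.eval, h11, h7, h.top, h.div c hc, shiftCode]

theorem IsPrepared.viaE_eval (h : IsPrepared n k R pc s) {c w : ℕ}
    (hc : c < (n + 2 * k + 1) ^ (2 * k)) (h11 : s.reg 11 = c) (h7 : s.reg 7 = w) :
    viaE.eval s = pc w + s.cost 2 (shiftCode (n + 2 * k + 1) (2 * k) c w) := by
  simp only [viaE, CExpr.eval, h.shiftE_eval hc h11 h7, IExpr.eval, h7, h.cost]

/-- Updates the table at the window `reg 11` with the next member `reg 7`. -/
def improveProg (k : ℕ) (tot : Bool) : Prog :=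
  .ite (improveTest k tot)
    (.seq (.setArr 8 (.reg 11) (.lit 1))
      (.seq (.setArr 9 (.reg 11) (.reg 7)) (.setCost 2 (.reg 11) viaE))) .skip

/-- Computes the table at the window with code `reg 2 - 1 - reg 6`. -/
def tableStep (k : ℕ) (tot : Bool) : Prog :=
  .seq (.setReg 11 (.sub (.sub (.reg 2) (.lit 1)) (.reg 6)))
    (.ite (.le (.add (.reg 0) (.lit 1)) (digE (.reg 11) 0))
      (.seq (.setArr 8 (.reg 11) (.lit 1)) (.setCost 2 (.reg 11) .zero))
      (.seq (.setReg 10 (.lit 1))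
        (.seq (.for 7 0 (.ite (gapTest k) (.setReg 10 (.lit 0)) .skip))
          (.ite (.eq (.reg 10) (.lit 1)) (.for 7 1 (improveProg k tot)) .skip))))

/-- Effect of `improveProg`, for a window without undominated gap. -/
theorem improveProg_spec {W : ℕ} {tot : Bool} (hk : 1 ≤ k) (h : IsPrepared n k R pc s) {c w : ℕ}
    (hc : c < (n + 2 * k + 1) ^ (2 * k)) (h11 : s.reg 11 = c) (h7 : s.reg 7 = w)
    (hw : w < n + 2 * k + 1) (hW : (n + 2 * k + 1) ^ (2 * k) ≤ W) (hBW : n + 2 * k + 1 ≤ W)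
    (hd : dig (n + 2 * k + 1) c 0 ≤ n)
    (hgap : ∀ v, 1 ≤ v → v ≤ n → dig (n + 2 * k + 1) c (k - 1) < v → v < dig (n + 2 * k + 1) c k →
      k ≤ ∑ i ∈ Finset.range (2 * k), R v (dig (n + 2 * k + 1) c i))
    {D : ℕ → ℕ} (hD : D = dig (n + 2 * k + 1) c)
    {S : ℕ → ℕ} (hS : S = shiftCode (n + 2 * k + 1) (2 * k) c) :
    Runs W (improveProg k tot) s 1 fun s' =>
      (∀ x, x ≠ c → s'.arr 8 x = s.arr 8 x ∧ s'.arr 9 x = s.arr 9 x ∧ s'.cost 2 x = s.cost 2 x) ∧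
      ((s'.arr 8 c = s.arr 8 c ∧ s'.arr 9 c = s.arr 9 c ∧ s'.cost 2 c = s.cost 2 c) ∨
        (s'.arr 8 c = 1 ∧ s'.arr 9 c = w ∧ s'.cost 2 c = pc w + s.cost 2 (S w) ∧
          IsStep n k tot R D w ∧ s.arr 8 (S w) = 1 ∧
          (s.arr 8 c = 1 → s'.cost 2 c ≤ s.cost 2 c))) ∧
      (IsStep n k tot R D w → s.arr 8 (S w) = 1 →
        s'.arr 8 c = 1 ∧ s'.cost 2 c ≤ pc w + s.cost 2 (S w)) := by
  subst hD hS
  have hc' : (IExpr.reg 11).eval s < (n + 2 * k + 1) ^ (2 * k) := by simpa [IExpr.eval, h11]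
  have hT : (improveTest k tot).Holds s ↔ IsStep n k tot R (dig (n + 2 * k + 1) c) w ∧
      s.arr 8 (shiftCode (n + 2 * k + 1) (2 * k) c w) = 1 ∧ (s.arr 8 c = 1 →
        pc w + s.cost 2 (shiftCode (n + 2 * k + 1) (2 * k) c w) ≤ s.cost 2 c) := by
    simp only [improveTest, Test.Holds, h.memberTest_holds hc h11 h7 hw, IExpr.eval,
      h.digE_eval hc', h.viaE_eval hc h11 h7, h.shiftE_eval hc h11 h7, CExpr.eval, h11, h7, IsStep]
    rw [not_and, not_not]
    have e1 : dig (n + 2 * k + 1) c (2 * k - 1) + 1 ≤ w ↔ dig (n + 2 * k + 1) c (2 * k - 1) < w :=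
      Iff.rfl
    rw [e1]
    tauto
  have hvia := h.viaE_eval hc h11 h7
  refine .ite le_rfl (fun hb => ?_) (fun hb => .skip le_rfl ?_)
  · obtain ⟨hst, hf, himp⟩ := hT.1 hb
    have hne := (hst.lt_shiftCode hk hc).1.ne'
    refine .seq (.setArr le_rfl ?_ ?_ (.seq (.setArr le_rfl ?_ ?_ (.setCost le_rfl ?_ ?_))))
    · simp [IExpr.eval, h11]; omega
    · simp [IExpr.eval]; omega
    · simp [IExpr.eval, h11, State.setArr]; omega
    · simp [IExpr.eval, h7, State.setArr]; omega
    · simp [IExpr.eval, h11, State.setArr]; omega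
    set s₁ := (s.setArr 8 ((IExpr.reg 11).eval s) ((IExpr.lit 1).eval s)) with hs₁
    set s₂ := s₁.setArr 9 ((IExpr.reg 11).eval s₁) ((IExpr.reg 7).eval s₁) with hs₂
    have hv₂ : viaE.eval s₂ = pc w + s.cost 2 (shiftCode (n + 2 * k + 1) (2 * k) c w) :=
      IsPrepared.viaE_eval (s := s₂) (h.congr rfl rfl rfl rfl rfl rfl rfl) hc h11 h7
    have hr₂ : (IExpr.reg 11).eval s₂ = c := h11
    rw [hv₂, hr₂]
    have a8 : (s₂.setCost 2 c (pc w + s.cost 2 (shiftCode (n + 2 * k + 1) (2 * k) c w))).arr 8 =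
        Function.update (s.arr 8) c 1 := by
      simp [hs₂, hs₁, State.setCost, State.setArr, IExpr.eval, h11]
    have a9 : (s₂.setCost 2 c (pc w + s.cost 2 (shiftCode (n + 2 * k + 1) (2 * k) c w))).arr 9 =
        Function.update (s.arr 9) c w := by
      simp [hs₂, hs₁, State.setCost, State.setArr, IExpr.eval, h11, h7]
    have a2 : (s₂.setCost 2 c (pc w + s.cost 2 (shiftCode (n + 2 * k + 1) (2 * k) c w))).cost 2 =
        Function.update (s.cost 2) c (pc w + s.cost 2 (shiftCode (n + 2 * k + 1) (2 * k) c w)) := by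
      simp [hs₂, hs₁, State.setCost, State.setArr]
    rw [a8, a9, a2]
    refine ⟨fun x hx => ?_, .inr ?_, fun _ _ => ?_⟩
    · simp [Function.update_of_ne hx]
    · simp only [Function.update_self]
      exact ⟨trivial, trivial, trivial, hst, hf, himp⟩
    · simp
  · refine ⟨fun x _ => ⟨rfl, rfl, rfl⟩, .inl ⟨rfl, rfl, rfl⟩, fun hst hf => ?_⟩
    rw [hT] at hb
    by_contra hcon
    exact hb ⟨hst, hf, fun h8 => (not_le.1 fun h' => hcon ⟨h8, h'⟩).le⟩

/-- The gap condition does not involve the next member, so it is tested once per window in O(n)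
steps. Each of the B candidates then takes constant time, which gives the exponent 2k + 1 overall.
-/
theorem tableStep_spec {W : ℕ} {tot : Bool} (hk : 1 ≤ k) (h : IsPrepared n k R pc s) {c : ℕ}
    (hc : c < (n + 2 * k + 1) ^ (2 * k)) (h6 : s.reg 6 + c + 1 = (n + 2 * k + 1) ^ (2 * k))
    (hW : (n + 2 * k + 1) ^ (2 * k) ≤ W) (hBW : n + 2 * k + 1 ≤ W) (h8 : s.arr 8 c = 0) :
    Runs W (tableStep k tot) s (n + 2 * k + 1 + 1) fun s' =>
      (∀ x, x ≠ c → s'.arr 8 x = s.arr 8 x ∧ s'.arr 9 x = s.arr 9 x ∧ s'.cost 2 x = s.cost 2 x) ∧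
      IsTableAt n k tot R pc (s'.arr 8) (s'.cost 2) (s'.arr 9) c := by
  have e11 : (IExpr.sub (.sub (.reg 2) (.lit 1)) (.reg 6)).eval s = c := by
    simp only [IExpr.eval, h.codes]; omega
  refine .seq (.setReg (by omega) (by rw [e11]; omega) ?_)
  rw [e11]
  set s₀ := s.setReg 11 c with hs₀
  have h₀ : IsPrepared n k R pc s₀ := h.congr rfl rfl rfl rfl rfl rfl rfl
  have r11 : s₀.reg 11 = c := by simp [hs₀, State.setReg]
  have a8 : s₀.arr 8 = s.arr 8 := rfl
  have a9 : s₀.arr 9 = s.arr 9 := rfl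
  have c2 : s₀.cost 2 = s.cost 2 := rfl
  rw [← a8] at h8
  simp only [← a8, ← a9, ← c2]
  clear_value s₀
  clear a8 a9 c2
  have hc' : (IExpr.reg 11).eval s₀ < (n + 2 * k + 1) ^ (2 * k) := by simpa [IExpr.eval, r11]
  have hb : (Test.le (.add (.reg 0) (.lit 1)) (digE (.reg 11) 0)).Holds s₀ ↔
      n < dig (n + 2 * k + 1) c 0 := by
    simp only [Test.Holds, h₀.digE_eval hc', IExpr.eval, h₀.size, r11]
    rfl
  refine .ite (by omega) (fun hf => ?_) (fun hf => ?_)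
  · rw [hb] at hf
    refine .seq (.setArr (by omega) ?_ ?_ (.setCost (by omega) ?_ ?_))
    · simp [IExpr.eval, r11]; omega
    · simp [IExpr.eval]; omega
    · simp [IExpr.eval, r11, State.setArr]; omega
    · have e1 : (IExpr.reg 11).eval (s₀.setArr 8 ((IExpr.reg 11).eval s₀)
        ((IExpr.lit 1).eval s₀)) = c := r11
      rw [e1]
      refine ⟨fun x hx => ?_, ⟨fun _ => ?_, fun _ h' => ?_, fun w hw => ?_⟩⟩
      · simp [State.setArr, State.setCost, IExpr.eval, r11, Function.update_of_ne hx]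
      · simp [State.setArr, State.setCost, IExpr.eval, CExpr.eval, r11]
      · omega
      · have := hw.1
        omega
  rw [hb, not_lt] at hf
  have hnofin : ¬ n < dig (n + 2 * k + 1) c 0 := by omega
  refine .seq (.setReg (by omega) (by simp [IExpr.eval]; omega) ?_)
  refine .seq (Runs.for_of (K := 1) (m := n) (fun i s' => s'.reg 10 = 1 ↔
      ∀ v < i, (dig (n + 2 * k + 1) c (k - 1) < v + 1 → v + 1 < dig (n + 2 * k + 1) c k →
      k ≤ ∑ i ∈ Finset.range (2 * k), R (v + 1) (dig (n + 2 * k + 1) c i)))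
    le_rfl (by omega) (by simpa [State.setReg] using h₀.size) (by omega) rfl rfl ?_ ?_ ?_)
  · simp [State.setReg, IExpr.eval]
  · intro v s₁ hv hrv hF h₁
    have hp : IsPrepared n k R pc s₁ := IsPrepared.congr (s := s₀) h₀ (hF.reg 0 rfl) (hF.reg 1 rfl)
      (hF.reg 2 rfl) (hF.reg 3 rfl) (hF.arr 6 rfl) (hF.arr 7 rfl) (hF.cost 1 rfl)
    have f11 : s₁.reg 11 = c := (hF.reg 11 rfl).trans r11
    have hg := hp.gapTest_holds hc f11 hrv hv
    refine .ite le_rfl (fun hb => .setReg le_rfl (Nat.zero_le _) ?_) (fun hb => .skip le_rfl ?_)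
    · rw [hg] at hb
      simp only [State.setReg, IExpr.eval, Function.update_apply]
      norm_num only
      exact ⟨fun h' => absurd h' (by norm_num), fun h' => absurd (h' v (by omega)) hb⟩
    · rw [hg, not_not] at hb
      have e10 : (s₁.setReg 7 (v + 1)).reg 10 = s₁.reg 10 := by simp [State.setReg]
      rw [e10, h₁]
      refine ⟨fun h' u hu => ?_, fun h' u hu => h' u (by omega)⟩
      rcases Nat.lt_succ_iff_lt_or_eq.1 hu with hu | rfl
      · exact h' u hu
      · exact hb
  · intro s₁ hF h₁
    have hp : IsPrepared n k R pc s₁ := IsPrepared.congr (s := s₀) h₀ (hF.reg 0 rfl) (hF.reg 1 rfl)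
      (hF.reg 2 rfl) (hF.reg 3 rfl) (hF.arr 6 rfl) (hF.arr 7 rfl) (hF.cost 1 rfl)
    have f11 : s₁.reg 11 = c := (hF.reg 11 rfl).trans r11
    have a8 : s₁.arr 8 = s₀.arr 8 := hF.arr 8 rfl
    have a9 : s₁.arr 9 = s₀.arr 9 := hF.arr 9 rfl
    have c2 : s₁.cost 2 = s₀.cost 2 := hF.cost 2 rfl
    refine .ite (by omega) (fun hg => ?_) (fun hg => .skip (by omega) ?_)
    swap
    · rw [a8, a9, c2]
      refine ⟨fun x _ => ⟨rfl, rfl, rfl⟩, ⟨fun h' => absurd h' hnofin, fun h' => by omega,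
        fun w hw => ?_⟩⟩
      exfalso
      -- An undominated gap excludes every step from this window, so the initial entry `0` is
      -- correct.
      refine hg (h₁.2 fun v hv h1 h2 => hw.2.2.2.1 (v + 1) (by omega) (by omega) h1 h2)
    have hgap : ∀ v, 1 ≤ v → v ≤ n → dig (n + 2 * k + 1) c (k - 1) < v →
        v < dig (n + 2 * k + 1) c k →
        k ≤ ∑ i ∈ Finset.range (2 * k), R v (dig (n + 2 * k + 1) c i) := by
      intro v h1 h2 h3 h4
      have := h₁.1 hg (v - 1) (by omega)
      rw [Nat.sub_add_cancel h1] at this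
      exact this h3 h4
    rw [← a8] at h8 ⊢
    rw [← a9, ← c2]
    have hlt : ∀ w, IsStep n k tot R (dig (n + 2 * k + 1) c) w →
        shiftCode (n + 2 * k + 1) (2 * k) c w ≠ c := fun w hw => (hw.lt_shiftCode hk hc).1.ne'
    set D := dig (n + 2 * k + 1) c with hD
    set S := shiftCode (n + 2 * k + 1) (2 * k) c with hS
    -- The entries at successors are read from `s₁` throughout: a successor code differs from `c`,
    -- and only the entries at `c` change.
    refine Runs.for_of (K := 1) (m := n + 2 * k + 1) (fun j s' =>
      (∀ x, x ≠ c → s'.arr 8 x = s₁.arr 8 x ∧ s'.arr 9 x = s₁.arr 9 x ∧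
        s'.cost 2 x = s₁.cost 2 x) ∧
      (s'.arr 8 c = 1 → IsStep n k tot R D (s'.arr 9 c) ∧ s₁.arr 8 (S (s'.arr 9 c)) = 1 ∧
        s'.cost 2 c = pc (s'.arr 9 c) + s₁.cost 2 (S (s'.arr 9 c))) ∧
      (∀ w < j, IsStep n k tot R D w → s₁.arr 8 (S w) = 1 →
        s'.arr 8 c = 1 ∧ s'.cost 2 c ≤ pc w + s₁.cost 2 (S w)))
      le_rfl (by omega) hp.base hBW rfl rfl ?_ ?_ ?_
    · refine ⟨fun x _ => ⟨rfl, rfl, rfl⟩, fun h' => ?_, fun w hw => by omega⟩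
      have : s₁.arr 8 c = 1 := h'
      omega
    · intro w s₂ hw hrw hF₂ ⟨i1, i2, i3⟩
      have hp₂ : IsPrepared n k R pc s₂ := IsPrepared.congr (s := s₁) hp (hF₂.reg 0 rfl)
        (hF₂.reg 1 rfl) (hF₂.reg 2 rfl) (hF₂.reg 3 rfl) (hF₂.arr 6 rfl) (hF₂.arr 7 rfl)
        (hF₂.cost 1 rfl)
      have g11 : s₂.reg 11 = c := (hF₂.reg 11 rfl).trans f11
      refine (improveProg_spec (tot := tot) hk hp₂ hc g11 hrw hw hW hBW hf hgap hD hS).mono le_rfl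
        fun s₃ hF₃ ⟨j1, j2, j3⟩ => ?_
      have key : (s₃.arr 8 c = 1 → IsStep n k tot R D (s₃.arr 9 c) ∧ s₁.arr 8 (S (s₃.arr 9 c)) = 1 ∧
          s₃.cost 2 c = pc (s₃.arr 9 c) + s₁.cost 2 (S (s₃.arr 9 c))) := by
        intro h'
        rcases j2 with ⟨k1, k2, k3⟩ | ⟨k1, k2, k3, k4, k5, k6⟩
        · rw [k1] at h'
          rw [k2, k3]
          exact i2 h'
        · obtain ⟨l1, l2, l3⟩ := i1 (S w) (hlt w k4)
          rw [k2, k3]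
          rw [l1] at k5
          rw [l3]
          exact ⟨k4, k5, rfl⟩
      refine ⟨fun x hx => ?_, key, fun u hu hst hfu => ?_⟩
      · obtain ⟨l1, l2, l3⟩ := i1 x hx
        obtain ⟨l4, l5, l6⟩ := j1 x hx
        exact ⟨l4.trans l1, l5.trans l2, l6.trans l3⟩
      · change s₃.arr 8 c = 1 ∧ s₃.cost 2 c ≤ _
        rcases Nat.lt_succ_iff_lt_or_eq.1 hu with hu | rfl
        · obtain ⟨m1, m2⟩ := i3 u hu hst hfu
          rcases j2 with ⟨k1, k2, k3⟩ | ⟨k1, k2, k3, k4, k5, k6⟩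
          · rw [k1, k3]; exact ⟨m1, m2⟩
          · exact ⟨k1, (k6 m1).trans m2⟩
        · obtain ⟨l1, l2, l3⟩ := i1 (S u) (hlt u hst)
          rw [← l3]
          exact j3 hst (by rw [l1]; exact hfu)
    · intro s₂ hF₂ ⟨i1, i2, i3⟩
      refine ⟨i1, ⟨fun h' => absurd h' hnofin, fun h' _ => ?_, fun w hw h' => ?_⟩⟩
      · obtain ⟨k1, k2, k3⟩ := i2 h'
        obtain ⟨l1, l2, l3⟩ := i1 _ (hlt _ k1)
        refine ⟨k1, ?_, ?_⟩
        · rw [l1]; exact k2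
        · rw [l3]; exact k3
      · obtain ⟨l1, l2, l3⟩ := i1 _ (hlt w hw)
        rw [l3]
        exact i3 w hw.2.1 hw (by rw [← l1]; exact h')

/-- Computes the table at all windows. -/
def tableProg (k : ℕ) (tot : Bool) : Prog := .for 6 2 (tableStep k tot)

theorem tableProg_spec {W : ℕ} {tot : Bool} (hk : 1 ≤ k) (h : IsPrepared n k R pc s)
    (hW : (n + 2 * k + 1) ^ (2 * k) ≤ W) (hBW : n + 2 * k + 1 ≤ W) (h8 : ∀ x, s.arr 8 x = 0) :
    Runs W (tableProg k tot) s (((n + 2 * k + 1) ^ (2 * k) + 1) * (n + 2 * k + 1 + 1)) fun s' =>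
      ∀ c < (n + 2 * k + 1) ^ (2 * k),
        IsTableAt n k tot R pc (s'.arr 8) (s'.cost 2) (s'.arr 9) c := by
  refine Runs.for_of (K := n + 2 * k + 1 + 1) (m := (n + 2 * k + 1) ^ (2 * k)) (fun i s' =>
      (∀ c < (n + 2 * k + 1) ^ (2 * k), (n + 2 * k + 1) ^ (2 * k) ≤ c + i →
        IsTableAt n k tot R pc (s'.arr 8) (s'.cost 2) (s'.arr 9) c) ∧
      ∀ c, c + i < (n + 2 * k + 1) ^ (2 * k) → s'.arr 8 c = 0)
    (by omega) le_rfl h.codes hW rfl rfl ?_ ?_ ?_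
  · exact ⟨fun c hc hc' => by omega, fun c _ => h8 c⟩
  · intro i s₁ hi hri hF ⟨h1, h2⟩
    have hp : IsPrepared n k R pc s₁ := IsPrepared.congr (s := s) h (hF.reg 0 rfl) (hF.reg 1 rfl)
      (hF.reg 2 rfl) (hF.reg 3 rfl) (hF.arr 6 rfl) (hF.arr 7 rfl) (hF.cost 1 rfl)
    obtain ⟨c, hc⟩ : ∃ c, i + c + 1 = (n + 2 * k + 1) ^ (2 * k) :=
      ⟨(n + 2 * k + 1) ^ (2 * k) - 1 - i, by omega⟩
    refine (tableStep_spec (tot := tot) hk hp (by omega) (by rw [hri]; exact hc) hW hBW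
      (h2 c (by omega))).mono le_rfl fun s₂ _ ⟨h3, h4⟩ => ⟨fun x hx hx' => ?_, fun x hx => ?_⟩
    · rcases Nat.lt_or_ge c x with hcx | hcx
      · refine (h1 x hx (by omega)).congr hk hx (fun y hy => (h3 y (by omega)).1)
          (fun y hy => (h3 y (by omega)).2.2) (h3 x (by omega)).2.1
      · obtain rfl : x = c := by omega
        exact h4
    · exact ((h3 x (by omega)).1).trans (h2 x (by omega))
  · exact fun s' _ h' c hc => h'.1 c hc (by omega)

/-! ### Recovering an optimal set from the table -/

/-- Follows an optimal path and marks its members in integer array `1`. -/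
def walkProg : Prog :=
  .seq (.setReg 11 (.lit 0))
    (.for 6 2 (.ite (.le (digE (.reg 11) 0) (.reg 0))
      (.seq (.setReg 7 (.get 9 (.reg 11)))
        (.seq (.ite (.le (.reg 7) (.reg 0))
            (.setArr 1 (.get 2 (.sub (.reg 7) (.lit 1))) (.lit 1)) .skip)
          (.setReg 11 shiftE))) .skip))

theorem walkProg_spec {W : ℕ} {tot : Bool} (hk : 1 ≤ k) (h : IsPrepared n k R pc s)
    (hW : (n + 2 * k + 1) ^ (2 * k) ≤ W) (hBW : n + 2 * k + 1 ≤ W)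
    (ht : ∀ c < (n + 2 * k + 1) ^ (2 * k),
      IsTableAt n k tot R pc (s.arr 8) (s.cost 2) (s.arr 9) c)
    (h0 : s.arr 8 0 = 1) (h1 : ∀ x, s.arr 1 x = 0) (hq : ∀ i < n, s.arr 2 i < n) :
    Runs W walkProg s ((n + 2 * k + 1) ^ (2 * k) + 1) fun s' => ∃ L, IsPath n k tot R 0 L ∧
      (L.map pc).sum = s.cost 2 0 ∧
      ∀ x, s'.arr 1 x = 1 ↔ ∃ w ∈ L, w ≤ n ∧ s.arr 2 (w - 1) = x := by
  have hN : 0 < (n + 2 * k + 1) ^ (2 * k) := Nat.pow_pos (by omega)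
  refine .seq (.setReg (by omega) (Nat.zero_le _) ?_)
  -- `P` is the list walked so far: it turns any path from the current window into a path from `0`,
  -- and its cost plus the current table value is the optimum. The code grows in each round until a
  -- final window is reached, so it is at least `j` before that.
  refine Runs.for_of (K := 1) (m := (n + 2 * k + 1) ^ (2 * k)) (fun j s' =>
    s'.reg 11 < (n + 2 * k + 1) ^ (2 * k) ∧ s.arr 8 (s'.reg 11) = 1 ∧
    (n < dig (n + 2 * k + 1) (s'.reg 11) 0 ∨ j ≤ s'.reg 11) ∧
    ∃ P : List ℕ, (∀ L, IsPath n k tot R (s'.reg 11) L → IsPath n k tot R 0 (P ++ L)) ∧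
      (P.map pc).sum + s.cost 2 (s'.reg 11) = s.cost 2 0 ∧
      ∀ x, s'.arr 1 x = 1 ↔ ∃ w ∈ P, w ≤ n ∧ s.arr 2 (w - 1) = x)
    le_rfl (by omega) (by simpa [State.setReg] using h.codes) hW rfl rfl ?_ ?_ ?_
  · have e : ((s.setReg 11 ((IExpr.lit 0).eval s)).setReg 6 0).reg 11 = 0 := by
      simp [State.setReg, IExpr.eval]
    rw [e]
    exact ⟨hN, h0, .inr le_rfl, [], fun L hL => hL, by simp, fun x => by simp [State.setReg, h1]⟩
  · rintro j s₁ hj hrj hF ⟨hc, hf, hjc, P, hP, hcost, hout⟩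
    have hp : IsPrepared n k R pc s₁ := IsPrepared.congr (s := s) h (hF.reg 0 rfl) (hF.reg 1 rfl)
      (hF.reg 2 rfl) (hF.reg 3 rfl) (hF.arr 6 rfl) (hF.arr 7 rfl) (hF.cost 1 rfl)
    have e9 : s₁.arr 9 = s.arr 9 := hF.arr 9 rfl
    have e2 : s₁.arr 2 = s.arr 2 := hF.arr 2 rfl
    obtain ⟨c, hrc⟩ : ∃ c, s₁.reg 11 = c := ⟨_, rfl⟩
    rw [hrc] at hc hf hjc hP hcost
    have hb : (Test.le (digE (.reg 11) 0) (.reg 0)).Holds s₁ ↔ dig (n + 2 * k + 1) c 0 ≤ n := by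
      simp only [Test.Holds, hp.digE_eval (c := .reg 11) (by simpa [IExpr.eval, hrc] using hc)]
      simp only [IExpr.eval, hrc, hp.size]
    refine .ite le_rfl (fun hd => ?_) (fun hd => .skip le_rfl ?_)
    · rw [hb] at hd
      obtain ⟨hst, hf', hv⟩ := (ht c hc).next hf hd
      obtain ⟨hlt, hltN⟩ := hst.lt_shiftCode hk hc
      have hw := hst.2.1
      set w := s.arr 9 c with hwdef
      have ew : (IExpr.get 9 (.reg 11)).eval s₁ = w := by simp [IExpr.eval, hrc, e9, hwdef]
      refine .seq (.setReg le_rfl (by rw [ew]; omega) ?_)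
      rw [ew]
      set s₂ := s₁.setReg 7 w with hs₂
      have hp₂ : IsPrepared n k R pc s₂ := hp.congr rfl rfl rfl rfl rfl rfl rfl
      have g7 : s₂.reg 7 = w := by simp [hs₂, State.setReg]
      have g11 : s₂.reg 11 = c := by simp [hs₂, State.setReg, hrc]
      have g2 : s₂.arr 2 = s.arr 2 := e2
      have g1 : s₂.arr 1 = s₁.arr 1 := rfl
      rw [← g1] at hout
      clear_value s₂
      have hw1 : 1 ≤ w := Nat.one_le_of_lt hst.2.2.1
      have hmark : Runs W (.ite (.le (.reg 7) (.reg 0))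
          (.setArr 1 (.get 2 (.sub (.reg 7) (.lit 1))) (.lit 1)) .skip) s₂ 1 fun s₃ =>
          ∀ x, s₃.arr 1 x = 1 ↔ ∃ u ∈ P ++ [w], u ≤ n ∧ s.arr 2 (u - 1) = x := by
        have ep : (IExpr.get 2 (.sub (.reg 7) (.lit 1))).eval s₂ = s.arr 2 (w - 1) := by
          simp [IExpr.eval, g7, g2]
        refine .ite le_rfl (fun hwn => .setArr le_rfl ?_ ?_ fun x => ?_)
          (fun hwn => .skip le_rfl fun x => ?_)
        · simp only [Test.Holds, IExpr.eval, g7, hp₂.size] at hwn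
          have := hq (w - 1) (by omega)
          rw [ep]; omega
        · simp [IExpr.eval]; omega
        · simp only [Test.Holds, IExpr.eval, g7, hp₂.size] at hwn
          rw [ep]
          simp only [State.setArr, Function.update_self, Function.update_apply, IExpr.eval,
            List.mem_append, List.mem_singleton, or_and_right, exists_or, exists_eq_left, ← hout]
          split_ifs with hx
          · simp [hx, hwn]
          · simp [Ne.symm hx]
        · simp only [Test.Holds, IExpr.eval, g7, hp₂.size] at hwn
          simp only [List.mem_append, List.mem_singleton, or_and_right, exists_or, exists_eq_left,
            ← hout, hwn, false_and, or_false]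
      refine .seq (hmark.mono le_rfl fun s₃ hF₃ h₃ => ?_)
      have hp₃ : IsPrepared n k R pc s₃ := IsPrepared.congr (s := s₂) hp₂ (hF₃.reg 0 rfl)
        (hF₃.reg 1 rfl) (hF₃.reg 2 rfl) (hF₃.reg 3 rfl) (hF₃.arr 6 rfl) (hF₃.arr 7 rfl)
        (hF₃.cost 1 rfl)
      have es := hp₃.shiftE_eval hc ((hF₃.reg 11 rfl).trans g11) ((hF₃.reg 7 rfl).trans g7)
      refine .setReg le_rfl (by rw [es]; omega) ?_
      rw [es]
      have e : ((s₃.setReg 11 (shiftCode (n + 2 * k + 1) (2 * k) c w)).setReg 6 (j + 1)).reg 11 =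
          shiftCode (n + 2 * k + 1) (2 * k) c w := by simp [State.setReg]
      rw [e]
      refine ⟨hltN, hf', .inr (by omega), P ++ [w], fun L hL => ?_, ?_, h₃⟩
      · rw [List.append_assoc]
        exact hP _ ⟨hst, hL⟩
      · rw [List.map_append, List.sum_append, List.map_singleton, List.sum_singleton, ← hcost, hv,
          add_assoc]
    · rw [hb, not_le] at hd
      have e : (s₁.setReg 6 (j + 1)).reg 11 = c := by simp [State.setReg, hrc]
      rw [e]
      exact ⟨hc, hf, .inl hd, P, hP, hcost, hout⟩
  · rintro s' hF ⟨hc, hf, hjc, P, hP, hcost, hout⟩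
    -- The code stays below the number of rounds, so the second alternative of `hjc` is impossible.
    have hd : n < dig (n + 2 * k + 1) (s'.reg 11) 0 := by omega
    have := hP [] hd
    rw [List.append_nil] at this
    refine ⟨P, this, ?_, hout⟩
    rw [((ht _ hc).final hd).2, add_zero] at hcost
    exact hcost

end RAM

/-! ### Translation between vertices and positions -/

/-- The positions of the vertices in `U` under the ordering `σ`. -/
def positions {n : ℕ} (σ : Fin n ≃ Fin n) (U : Finset (Fin n)) : Finset ℕ :=
  U.map ⟨fun x => (σ.symm x).val + 1, fun x y h => by
    simpa [Fin.val_inj] using h⟩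

theorem sum_positions {n : ℕ} {M : Type*} [AddCommMonoid M] (σ : Fin n ≃ Fin n)
    (U : Finset (Fin n)) (f : ℕ → M) :
    ∑ p ∈ positions σ U, f p = ∑ x ∈ U, f ((σ.symm x).val + 1) :=
  Finset.sum_map _ _ _

theorem mem_positions {n : ℕ} {σ : Fin n ≃ Fin n} {U : Finset (Fin n)} {p : ℕ} :
    p ∈ positions σ U ↔ ∃ x ∈ U, (σ.symm x).val + 1 = p :=
  Finset.mem_map

open Classical in
theorem isFeasible_positions_iff {n k : ℕ} {tot : Bool} {G : SimpleGraph (Fin n)} {q : ℕ → ℕ}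
    {σ : Fin n ≃ Fin n} (hσ : ∀ i, (σ i).val = q i) (U : Finset (Fin n)) :
    IsFeasible n k tot (positionMatrix n G.natAdj q) (positions σ U) ↔
      ∀ v, (v ∉ U ∨ tot = true) → k ≤ (U.filter fun u => G.Adj v u).card := by
  have hsum : ∀ v : Fin n, ∑ p ∈ positions σ U,
      positionMatrix n G.natAdj q ((σ.symm v).val + 1) p = (U.filter fun u => G.Adj v u).card := by
    intro v
    rw [sum_positions, Finset.card_filter]
    refine Finset.sum_congr rfl fun u _ => ?_
    have h1 := (σ.symm v).2
    have h2 := (σ.symm u).2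
    rw [positionMatrix, if_pos (by omega), Nat.add_sub_cancel, Nat.add_sub_cancel, ← hσ, ← hσ,
      Equiv.apply_symm_apply, Equiv.apply_symm_apply]
    have h3 := G.isAdjMatrix_natAdj.le_one v u
    have h4 := SimpleGraph.natAdj_val (G := G) (u := v) (v := u)
    split_ifs with h
    · exact h4.2 h
    · have := mt h4.1 h
      omega
  have hmem : ∀ v : Fin n, (σ.symm v).val + 1 ∈ positions σ U ↔ v ∈ U := by
    intro v
    rw [mem_positions]
    constructor
    · rintro ⟨x, hx, h⟩
      rwa [← σ.symm.injective (Fin.ext (Nat.succ.inj h))]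
    · exact fun h => ⟨v, h, rfl⟩
  constructor
  · rintro ⟨-, h⟩ v hv
    have := h ((σ.symm v).val + 1) (by omega) (σ.symm v).2 (by rwa [hmem])
    rwa [hsum] at this
  · refine fun h => ⟨fun p hp => ?_, fun p h1 hn hp => ?_⟩
    · obtain ⟨x, -, rfl⟩ := mem_positions.1 hp
      exact ⟨by omega, (σ.symm x).2⟩
    · obtain ⟨v, rfl⟩ : ∃ v : Fin n, p = (σ.symm v).val + 1 :=
        ⟨σ ⟨p - 1, by omega⟩, by rw [Equiv.symm_apply_apply]; simp; omega⟩
      rw [hmem] at hp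
      rw [hsum]
      exact h v hp

/-- Sentinels cost `0`, so discarding them does not change the sum. -/
theorem IsPath.sum_map_eq {n k : ℕ} {tot : Bool} {R : ℕ → ℕ → ℕ} (hR : IsUmbrellaMatrix n R)
    (hk : 1 ≤ k) {L : List ℕ} (h : IsPath n k tot R 0 L) (c : ℕ → ℝ) (q : ℕ → ℕ) :
    (L.map (positionCost n c q)).sum =
      ∑ p ∈ L.toFinset.filter (· ≤ n), positionCost n c q p := by
  rw [← List.sum_toFinset _ (h.isFeasible hR hk).1, Finset.sum_filter_of_ne]
  intro p _ hp
  by_contra hn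
  exact hp (by rw [positionCost, if_neg]; omega)

/-! ### The whole algorithm and its running time -/

namespace RAM

/-- The whole algorithm. -/
def dominationProg (k : ℕ) (tot : Bool) : Prog :=
  .seq orderProg (.seq (paramProg k) (.seq matrixProg (.seq divProg (.seq (tableProg k tot)
    (.ite (.eq (.get 8 (.lit 0)) (.lit 1)) (.seq walkProg (.setReg 0 (.lit 1)))
      (.setReg 0 (.lit 0)))))))

theorem hasAdj_input {n : ℕ} (G : SimpleGraph (Fin n)) (c : Fin n → ℝ) :
    HasAdj n G.natAdj (input G c) := by
  classical
  refine ⟨by simp [input], fun u v hu hv => ?_⟩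
  simp only [input, true_and, SimpleGraph.natAdj]
  refine if_congr ⟨?_, ?_⟩ rfl rfl
  · rintro ⟨u', v', h, h'⟩
    obtain ⟨h1, h2⟩ := (mul_add_eq_iff hv v'.2).1 h'
    exact ⟨u', v', h, h1.symm, h2.symm⟩
  · rintro ⟨u', v', h, rfl, rfl⟩
    exact ⟨u', v', h, rfl⟩

-- The flag `tot` covers both problems through `hP`. The factor `2` in `hW` leaves room for the
-- quotient table, since B ≤ B^(2k). Optimality compares the path that was walked, whose cost is the
-- table value at `0`, with the path of any other feasible set.
open Classical in
theorem dominationProg_spec {n k W : ℕ} {tot : Bool} (hk : 1 ≤ k) (hn : 1 ≤ n)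
    (hW : 2 * (n + 2 * k + 1) ^ (2 * k) ≤ W) {G : SimpleGraph (Fin n)}
    (hG : IsProperIntervalGraph G) (c : Fin n → ℝ) {P : Finset (Fin n) → Prop}
    (hP : ∀ U, P U ↔ ∀ v, (v ∉ U ∨ tot = true) → k ≤ (U.filter fun u => G.Adj v u).card) :
    Runs W (dominationProg k tot) (input G c)
      ((n + 1) ^ 3 + ((n + 2 * k + 1) ^ (2 * k) + 1) * (n + 2 * k + 1 + 1)) (Answers P c) := by
  have hWN : (n + 2 * k + 1) ^ (2 * k) ≤ W := by omega
  set B := n + 2 * k + 1 with hB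
  set K := (n + 1) ^ 3 + (B ^ (2 * k) + 1) * (B + 1) with hK
  have hBB : B * B ≤ B ^ (2 * k) := by
    rw [← pow_two]; exact Nat.pow_le_pow_right (by omega) (by omega)
  have hBle : B ≤ B * B := Nat.le_mul_self B
  have hK1 : (n + 1) ^ 3 ≤ K := Nat.le_add_right _ _
  have hK2 : (B ^ (2 * k) + 1) * (B + 1) ≤ K := Nat.le_add_left _ _
  have hK3 : (n + 1) ^ 2 ≤ K := (Nat.pow_le_pow_right (by omega) (by omega)).trans hK1
  have hK4 : B ^ (2 * k) + 1 ≤ K := (Nat.le_mul_of_pos_right _ (by omega)).trans hK2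
  obtain ⟨κ, hκ⟩ := hG.exists_isUmbrella
  have ha := G.isAdjMatrix_natAdj
  have hs := hasAdj_input G c
  have harr : ∀ i x, i ≠ 0 → (input G c).arr i x = 0 := fun i x hi => by simp [input, hi]
  have hcost : ∀ i x, i ≠ 0 → (input G c).cost i x = 0 := fun i x hi => by simp [input, hi]
  refine .seq ((orderProg_spec (W := W) ha hn (by omega) hs (fun v => harr 5 v (by omega))
    (by simp [input]) hκ).mono hK1 fun s₁ hF₁ ⟨hlt, hinj, hU⟩ => ?_)
  have hs₁ := hs.congr (hF₁.reg 0 rfl) (hF₁.arr 0 rfl)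
  refine .seq ((paramProg_spec hB (by omega) (by omega) hs₁.reg).mono (by omega)
    fun s₂ hF₂ ⟨r1, r2, r3⟩ => ?_)
  have hs₂ := hs₁.congr (hF₂.reg 0 rfl) (hF₂.arr 0 rfl)
  have hq₂ : s₂.arr 2 = s₁.arr 2 := hF₂.arr 2 rfl
  refine .seq ((matrixProg_spec (W := W) ha (show n + 1 < B by omega) (by omega) hs₂ r1
    (by rw [hq₂]; exact hlt)
    (fun x => by rw [hF₂.arr 6 rfl, hF₁.arr 6 rfl]; exact harr 6 x (by omega))
    (fun x => by rw [hF₂.cost 1 rfl, hF₁.cost 1 rfl]; exact hcost 1 x (by omega))).mono hK3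
    fun s₃ hF₃ ⟨h6, hc1⟩ => ?_)
  rw [hq₂] at h6 hc1
  refine .seq ((divProg_spec (W := W) (B := B) (N := B ^ (2 * k)) (by omega) (by omega)
    ((hF₃.reg 1 rfl).trans r1) ((hF₃.reg 2 rfl).trans r2)
    (fun x => by
      rw [hF₃.arr 7 rfl, hF₂.arr 7 rfl, hF₁.arr 7 rfl]; exact harr 7 x (by omega))).mono hK4
    fun s₄ hF₄ h7 => ?_)
  have hs₄ := (hs₂.congr (hF₃.reg 0 rfl) (hF₃.arr 0 rfl)).congr (hF₄.reg 0 rfl) (hF₄.arr 0 rfl)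
  set q := s₁.arr 2 with hqdef
  set R := positionMatrix n G.natAdj q with hRdef
  set pc := positionCost n ((input G c).cost 0) q with hpc
  have hc0 : s₂.cost 0 = (input G c).cost 0 := (hF₂.cost 0 rfl).trans (hF₁.cost 0 rfl)
  have hR : IsUmbrellaMatrix n R := isUmbrellaMatrix_positionMatrix ha hU
  have hp₄ : IsPrepared n k R pc s₄ := by
    refine ⟨hs₄.reg, (hF₄.reg 1 rfl).trans ((hF₃.reg 1 rfl).trans r1),
      (hF₄.reg 2 rfl).trans ((hF₃.reg 2 rfl).trans r2),
      (hF₄.reg 3 rfl).trans ((hF₃.reg 3 rfl).trans r3), ?_, h7, ?_⟩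
    · rw [hF₄.arr 6 rfl]; exact h6
    · rw [hF₄.cost 1 rfl]
      intro x
      rw [hc1 x, hc0]
  refine .seq ((tableProg_spec (W := W) (tot := tot) hk hp₄ hWN (by omega)
    (fun x => by
      rw [hF₄.arr 8 rfl, hF₃.arr 8 rfl, hF₂.arr 8 rfl, hF₁.arr 8 rfl]
      exact harr 8 x (by omega))).mono hK2 fun s₅ hF₅ ht => ?_)
  have hp₅ : IsPrepared n k R pc s₅ := IsPrepared.congr (s := s₄) hp₄ (hF₅.reg 0 rfl)
    (hF₅.reg 1 rfl) (hF₅.reg 2 rfl) (hF₅.reg 3 rfl) (hF₅.arr 6 rfl) (hF₅.arr 7 rfl)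
    (hF₅.cost 1 rfl)
  have hq₅ : s₅.arr 2 = q :=
    (hF₅.arr 2 rfl).trans ((hF₄.arr 2 rfl).trans ((hF₃.arr 2 rfl).trans hq₂))
  have hN : 0 < (n + 2 * k + 1) ^ (2 * k) := Nat.pow_pos (by omega)
  obtain ⟨σ, hσ⟩ : ∃ σ : Fin n ≃ Fin n, ∀ i, (σ i).val = q i := by
    refine ⟨Equiv.ofBijective (fun i : Fin n => (⟨q i, hlt i i.2⟩ : Fin n))
      (Finite.injective_iff_bijective.1 fun i j h => Fin.ext (hinj i j i.2 j.2 ?_)), fun i => rfl⟩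
    simpa using h
  have hpath : ∀ U, P U → ∃ L, IsPath n k tot R 0 L ∧ L.toFinset.filter (· ≤ n) = positions σ U :=
    fun U hPU => ((isFeasible_positions_iff hσ U).2 ((hP U).1 hPU)).exists_isPath hR hk
  have hpcs : ∀ U : Finset (Fin n), ∑ p ∈ positions σ U, pc p = ∑ u ∈ U, c u := fun U => by
    rw [sum_positions]
    refine Finset.sum_congr rfl fun x _ => ?_
    have h1 := (σ.symm x).2
    rw [hpc, positionCost, if_pos (by omega), Nat.add_sub_cancel, ← hσ, Equiv.apply_symm_apply]
    simp [input]
  refine .ite (by omega) (fun hb => ?_) (fun hb => .setReg (by omega) (Nat.zero_le _) (.inr ?_))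
  · refine .seq ((walkProg_spec (W := W) hk hp₅ hWN (by omega) ht hb (fun x => by
      rw [hF₅.arr 1 rfl, hF₄.arr 1 rfl, hF₃.arr 1 rfl, hF₂.arr 1 rfl, hF₁.arr 1 rfl]
      exact harr 1 x (by omega)) (by rw [hq₅]; exact hlt)).mono hK4
      fun s₆ hF₆ ⟨L, hL, hLcost, hout⟩ => .setReg (by omega) (by simp [IExpr.eval]; omega)
        (.inl ⟨by simp [State.setReg, IExpr.eval], ?_⟩))
    rw [hq₅] at hout
    have hfeas := (hL.isFeasible hR hk).2
    have hpos : positions σ (outputSet n (s₆.setReg 0 ((IExpr.lit 1).eval s₆))) =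
        L.toFinset.filter (· ≤ n) := by
      ext p
      rw [mem_positions]
      simp only [outputSet, State.setReg, Finset.mem_filter, Finset.mem_univ, true_and, hout,
        List.mem_toFinset]
      constructor
      · rintro ⟨x, ⟨w, hw, hwn, hwx⟩, rfl⟩
        have h1 := (hfeas.1 w (by simpa using ⟨hw, hwn⟩)).1
        have hx : σ ⟨w - 1, by omega⟩ = x := Fin.ext (by rw [hσ]; exact hwx)
        rw [← hx, Equiv.symm_apply_apply]
        simp only [Nat.sub_add_cancel h1]
        exact ⟨hw, hwn⟩
      · rintro ⟨hp, hpn⟩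
        have h1 := (hfeas.1 p (by simpa using ⟨hp, hpn⟩)).1
        refine ⟨σ ⟨p - 1, by omega⟩, ⟨p, hp, hpn, (hσ ⟨p - 1, by omega⟩).symm⟩, ?_⟩
        rw [Equiv.symm_apply_apply]
        simp only [Nat.sub_add_cancel h1]
    refine ⟨?_, fun U' hU' => ?_⟩
    · rw [hP, ← isFeasible_positions_iff hσ, hpos]
      exact hfeas
    · obtain ⟨L', hL', hL'U⟩ := hpath U' hU'
      have hle := (IsTableAt.le_of_isPath hk ht hN hL').2
      rw [← hLcost, hL.sum_map_eq hR hk, hL'.sum_map_eq hR hk, hL'U, ← hpos, hpcs, hpcs] at hle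
      exact hle
  · refine ⟨by simp [State.setReg, IExpr.eval], fun U hPU => hb ?_⟩
    obtain ⟨L, hL, -⟩ := hpath U hPU
    exact (IsTableAt.le_of_isPath hk ht hN hL).1

/-- For n ≥ 1, n + 1 ≤ 2n gives the `8`, the base is at most (2k + 2)n, and absorbing each `+ 1`
doubles a factor, which gives the `4`. -/
theorem running_time_le {n k : ℕ} (hk : 1 ≤ k) (hn : 1 ≤ n) :
    (n + 1) ^ 3 + ((n + 2 * k + 1) ^ (2 * k) + 1) * (n + 2 * k + 1 + 1) ≤
      (8 + 4 * (2 * k + 2) ^ (2 * k + 1)) * n ^ (3 * k) := by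
  have h1 : (n + 1) ^ 3 ≤ 8 * n ^ (3 * k) := by
    calc (n + 1) ^ 3 ≤ (2 * n) ^ 3 := Nat.pow_le_pow_left (by omega) 3
      _ = 8 * n ^ 3 := by ring
      _ ≤ 8 * n ^ (3 * k) :=
        Nat.mul_le_mul_left _ (Nat.pow_le_pow_right hn (by omega))
  have hB : n + 2 * k + 1 ≤ (2 * k + 2) * n := by nlinarith
  have h2 : ((n + 2 * k + 1) ^ (2 * k) + 1) * (n + 2 * k + 1 + 1) ≤
      4 * (2 * k + 2) ^ (2 * k + 1) * n ^ (3 * k) := by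
    have h3 : 1 ≤ (n + 2 * k + 1) ^ (2 * k) := Nat.one_le_pow _ _ (by omega)
    calc ((n + 2 * k + 1) ^ (2 * k) + 1) * (n + 2 * k + 1 + 1)
        ≤ (2 * (n + 2 * k + 1) ^ (2 * k)) * (2 * (n + 2 * k + 1)) :=
          Nat.mul_le_mul (by omega) (by omega)
      _ = 4 * (n + 2 * k + 1) ^ (2 * k + 1) := by ring
      _ ≤ 4 * ((2 * k + 2) * n) ^ (2 * k + 1) :=
          Nat.mul_le_mul_left _ (Nat.pow_le_pow_left hB _)
      _ = 4 * (2 * k + 2) ^ (2 * k + 1) * n ^ (2 * k + 1) := by rw [mul_pow, mul_assoc]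
      _ ≤ 4 * (2 * k + 2) ^ (2 * k + 1) * n ^ (3 * k) :=
          Nat.mul_le_mul_left _ (Nat.pow_le_pow_right hn (by omega))
  exact (add_le_add h1 h2).trans_eq (add_mul _ _ _).symm

open Classical in
theorem weightedProblemSolvableInTime {k : ℕ} (hk : 1 ≤ k) (tot : Bool)
    {Feasible : ∀ {n : ℕ}, SimpleGraph (Fin n) → Finset (Fin n) → Prop}
    (hF : ∀ {n : ℕ} (G : SimpleGraph (Fin n)) (U : Finset (Fin n)), Feasible G U ↔
      ∀ v, (v ∉ U ∨ tot = true) → k ≤ (U.filter fun u => G.Adj v u).card) :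
    WeightedProblemSolvableInTime (fun G => IsProperIntervalGraph G) (fun G U => Feasible G U)
      (fun n => n ^ (3 * k)) := by
  set C₁ := (dominationProg k tot).size * (8 + 4 * (2 * k + 2) ^ (2 * k + 1)) with hC₁
  set C₂ := 2 * (2 * k + 2) ^ (2 * k) with hC₂
  -- `C₁` pays for the time and `C₂` for the word size; one constant has to serve both.
  refine ⟨dominationProg k tot, C₁ + C₂, 2 * k, fun n hn G c hG _ => ?_⟩
  have hW : 2 * (n + 2 * k + 1) ^ (2 * k) ≤ (C₁ + C₂) * n ^ (2 * k) := by
    calc 2 * (n + 2 * k + 1) ^ (2 * k) ≤ 2 * ((2 * k + 2) * n) ^ (2 * k) :=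
          Nat.mul_le_mul_left _ (Nat.pow_le_pow_left (by nlinarith) _)
      _ = C₂ * n ^ (2 * k) := by rw [mul_pow, mul_assoc]
      _ ≤ (C₁ + C₂) * n ^ (2 * k) := Nat.mul_le_mul_right _ (Nat.le_add_left _ _)
  obtain ⟨t, s, hE, ht, hA⟩ := dominationProg_spec (tot := tot) hk hn hW hG c (hF G)
  refine ⟨t, s, hE, ht.trans ?_, hA⟩
  calc _ ≤ (dominationProg k tot).size * ((8 + 4 * (2 * k + 2) ^ (2 * k + 1)) * n ^ (3 * k)) :=
        Nat.mul_le_mul_left _ (running_time_le hk hn)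
    _ = C₁ * n ^ (3 * k) := by rw [hC₁, mul_assoc]
    _ ≤ (C₁ + C₂) * n ^ (3 * k) := Nat.mul_le_mul_right _ (Nat.le_add_right _ _)

end RAM

theorem theorem3 (k : ℕ) (hk : 1 ≤ k) :
    WeightedProblemSolvableInTime
        (fun G => IsProperIntervalGraph G) (fun G U => IsKDominating k G U)
        (fun n => n ^ (3 * k)) ∧
      WeightedProblemSolvableInTime
        (fun G => IsProperIntervalGraph G) (fun G U => IsTotalKDominating k G U)
        (fun n => n ^ (3 * k)) :=
  ⟨RAM.weightedProblemSolvableInTime hk false fun G U => by simp [IsKDominating],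
    RAM.weightedProblemSolvableInTime hk true fun G U => by simp [IsTotalKDominating]⟩
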